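/- Let $l>0$, let $\mathcal J\in\mathbb C^{p\times p}$ satisfy $\mathcal J^*=\mathcal J^{-1}=-\mathcal J$, and let $\mathcal F,\mathcal H$ be $p\times p$ matrix functions on $(0,l)$ with integrable entries, $\mathcal F(t)=\mathcal F(t)^*$ and $\mathcal H(t)=\mathcal H(t)^*\ge0$ a.e. Suppose that an absolutely continuous $f$ with $\mathcal Jf'+\mathcal Ff=0$ and $\mathcal Hf=0$ a.e. vanishes on $(0,l)$. **The relation $A$.** Let $\mathfrak H=L^2_{\mathcal H}(0,l)$ with $(f,g)=\int_0^l g^*\mathcal Hf\,dt$, let $A_{\max}$ be the set of pairs of classes of $f,g$ with $f$ absolutely continuous on $[0,l]$, $\mathcal Jf'+\mathcal Ff=\mathcal Hg$ a.e., and let $A=A_{\min}$ be the closure of the restriction of $A_{\max}$ to those $f$ that have compact support in $(0,l)$; $A^*=A_{\max}$. Let $U(\cdot,\lambda)$ solve $\mathcal JU'+\mathcal FU=\lambda\mathcal HU$, $U(0,\lambda)=I$, and put $U(\lambda)=U(l,\lambda)$. On $A_{\max}$ put $\Gamma_0(f,g)=\tfrac1{\sqrt2}(f(0)+f(l))$,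 $\Gamma_1(f,g)=-\tfrac1{\sqrt2}\mathcal J(f(0)-f(l))$, let $A_0=\ker\Gamma_0$, $R^0_\lambda=(A_0-\lambda)^{-1}$, let $\gamma(\lambda)u$ be the $h$ with $(h,\lambda h)\in A_{\max}$, $\Gamma_0(h,\lambda h)=u$, and let $M(\lambda)u=\Gamma_1(\gamma(\lambda)u,\lambda\gamma(\lambda)u)$, for $\lambda\in\rho(A_0)$. Put $K=\mathcal J\,\mathrm{Re}\,M(i)\,\mathcal J$ with $\mathrm{Re}\,M(i)=\tfrac12(M(i)+M(i)^*)$. **The gauge.** Let $\mathfrak H_+=\mathrm{dom}\,A^*$ with norm $(\|f\|^2+\|P_0f'\|^2)^{1/2}$ for $(f,f')\in A^*$, where $P_0$ is the orthogonal projection onto $\overline{\mathrm{dom}\,A}$; let $\mathfrak H_-$ be the space of bounded conjugate linear functionals on $\mathfrak H_+$, with the duality $\langle\varphi,h\rangle$, and identify $f\in\mathfrak H$ with the functional $h\mapsto(f,h)$. Suppose that $f(0)$ depends only on the class of $f$ for $f\in\mathfrak H_+$, so that $\langle\delta\otimes u,f\rangle=f(0)^*u$ is well defined. Let $Lu=\sqrt2\,\delta\otimes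 u$ for $u\in\mathbb C^p$ and $\mathscr L=\mathrm{ran}\,L$. Adjoints $^{\langle*\rangle}$ are taken with respect to the duality. Let $\mathbf A=\{(f,\varphi)\in\mathfrak H\times\mathfrak H_-:\langle\varphi,h\rangle=(f,h')\text{ for all }(h,h')\in A^*\}$. A point $\lambda$ belongs to $\rho(A,\mathscr L)$ if it is a point of regular type of $A$ and $\mathfrak H_-=\mathrm{ran}(\mathbf A-\lambda)\dotplus\mathscr L$; then $\Pi^\lambda$ is the projection onto $\mathscr L$ parallel to $\mathrm{ran}(\mathbf A-\lambda)$. **The functions $\mathcal P$ and $\mathcal Q$.** A generalized resolvent of $A$ is $\mathbf R_\lambda=P_{\mathfrak H}(\widetilde A-\lambda)^{-1}|_{\mathfrak H}$, $\lambda\in\rho(\widetilde A)$, where $\widetilde A$ is a selfadjoint extension of $A$ in a Pontryagin space containing $\mathfrak H$. Let $\widetilde{\mathbf R}_\lambda=(\mathbf R_{\bar\lambda})^{\langle*\rangle}:\mathfrak H_-\to\mathfrak H$ and $\widehat{\mathbf R}_\lambda=\widetilde{\mathbf R}_\lambda-\big(\tfrac12(R^0_i+R^0_{-i})\big)^{\langle*\rangle}$.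 For $\lambda\in\rho(A,\mathscr L)$ put $$\mathcal P(\lambda)=L^{-1}\Pi^\lambda:\mathfrak H_-\to\mathbb C^p,\qquad \mathcal Q(\lambda)=L^{\langle*\rangle}(\mathbf R_\lambda-\widehat{\mathbf R}_\lambda\Pi^\lambda):\mathfrak H\to\mathbb C^p,$$ where $\mathbf R$ is any generalized resolvent with $\lambda\in\rho(\widetilde A)$. **The resolvent matrices.** Let $A^{\langle*\rangle}=\{(f,\varphi)\in\mathfrak H\times\mathfrak H_-:\langle\varphi,h\rangle=(f,h')\text{ for all }(h,h')\in A\}$, and let $\widehat\Gamma_0,\widehat\Gamma_1$ be the linear maps on $A^{\langle*\rangle}$ which, for $\lambda\in\rho(A_0)$, $\varphi\in\mathfrak H_-$, are given by $\widehat\Gamma_0(\widetilde R^0_\lambda\varphi,\varphi+\lambda\widetilde R^0_\lambda\varphi)=0$, $\widehat\Gamma_1(\widetilde R^0_\lambda\varphi,\varphi+\lambda\widetilde R^0_\lambda\varphi)=\gamma(\bar\lambda)^{\langle*\rangle}\varphi$, and which agree with $\Gamma_0,\Gamma_1$ on the pairs $(h,\lambda h)\in A_{\max}$. Put $\widehat{\mathcal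 P}(\lambda)^{\langle*\rangle}v=(\mathcal P(\lambda)^{\langle*\rangle}v,\bar\lambda\mathcal P(\lambda)^{\langle*\rangle}v)$, $\widehat{\mathcal Q}(\lambda)^{\langle*\rangle}v=(\mathcal Q(\lambda)^*v,\bar\lambda\mathcal Q(\lambda)^*v+Lv)$ and $$\widehat W(\lambda)=\begin{bmatrix}-\widehat\Gamma_0\widehat{\mathcal Q}(\lambda)^{\langle*\rangle}&\widehat\Gamma_0\widehat{\mathcal P}(\lambda)^{\langle*\rangle}\\-\widehat\Gamma_1\widehat{\mathcal Q}(\lambda)^{\langle*\rangle}&\widehat\Gamma_1\widehat{\mathcal P}(\lambda)^{\langle*\rangle}\end{bmatrix}^*.$$ With $a_{11}=M(\lambda)$, $a_{12}=\gamma(\bar\lambda)^{\langle*\rangle}L$, $a_{21}=L^{\langle*\rangle}\gamma(\lambda)$, $a_{22}=L^{\langle*\rangle}\widehat R^0_\lambda L$ put $$W(\lambda)=\begin{bmatrix}a_{22}a_{12}^{-1}&a_{22}a_{12}^{-1}a_{11}-a_{21}\\a_{12}^{-1}&a_{12}^{-1}a_{11}\end{bmatrix},\qquad\lambda\in\rho(A,\mathscr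 L)\cap\rho(A_0).$$ **Proposition.** The functions $U(\cdot,\lambda)$ exist, the functionals $\delta\otimes u$ are bounded, $L$ is injective, $\rho(A,\mathscr L)=\mathbb C$, and for every $\lambda\in\mathbb C$ there is a generalized resolvent with $\lambda\in\rho(\widetilde A)$, and $\mathcal Q(\lambda)$ does not depend on its choice. Moreover: (i) for all $\lambda\in\mathbb C$, $$\mathcal P(\lambda)^{\langle*\rangle}=\tfrac1{\sqrt2}U(\cdot,\bar\lambda),\qquad\mathcal Q(\lambda)^*=-\tfrac1{\sqrt2}U(\cdot,\bar\lambda)(\mathcal J+K);$$ (ii) the left resolvent matrix $W^\ell(\lambda)=\widehat W(\bar\lambda)^*$ is, for all $\lambda\in\mathbb C$, $$W^\ell(\lambda)=\frac12\begin{bmatrix}(U(\lambda)-I)\mathcal J+(U(\lambda)+I)K&U(\lambda)+I\\\mathcal J(U(\lambda)+I)\mathcal J+\mathcal J(U(\lambda)-I)K&\mathcal J(U(\lambda)-I)\end{bmatrix},$$ and $W(\bar\lambda)^*=\widehat W(\bar\lambda)^*$ for all $\lambda\in\rho(A_0)$. -/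

import Mathlib

open MeasureTheory Matrix Set
open scoped ComplexConjugate ComplexOrder

noncomputable section

namespace LResolvent

/-! ## Linear relations, riggings, gauges

Throughout, the paper's inner product `(f, g)` (linear in the first entry) is `inner ℂ g f`,
and the pairing `(x, ξ) = ξ^* x` in `ℂ^p` is `star ξ ⬝ᵥ x`.

Objects that are determined by a defining property (values of a resolvent, Riesz representatives,
adjoint operators, boundary values) are introduced as the element with that property, by means of
`Classical.epsilon`. -/

section Relations

variable {H : Type*} [NormedAddCommGroup H] [InnerProductSpace ℂ H]

/-- `z` is a regular point of the linear relation `T`: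
`ker (T - z) = {0}` and `ran (T - z)` is the whole space. -/
def IsRegularPoint (T : Set (H × H)) (z : ℂ) : Prop :=
  (∀ h, (h, z • h) ∈ T → h = 0) ∧ ∀ f, ∃ h, (h, f + z • h) ∈ T

/-- The resolvent `(T - z)⁻¹` at a regular point `z`: `(T - z)⁻¹ f` is the `h` with
`(h, f + z h) ∈ T`. -/
def resolvent (T : Set (H × H)) (z : ℂ) (f : H) : H :=
  Classical.epsilon fun h => (h, f + z • h) ∈ T

/-- `z` is a point of regular type of `A`: `ker (A - z) = {0}` and `ran (A - z)` is closed. -/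
def IsRegularType (A : Submodule ℂ (H × H)) (z : ℂ) : Prop :=
  (∀ h, (h, z • h) ∈ A → h = 0) ∧ IsClosed {g : H | ∃ x ∈ A, g = x.2 - z • x.1}

/-- The space `H₊ = dom A^*`. -/
def Plus (A : Submodule ℂ (H × H)) : Submodule ℂ H :=
  A.adjoint.map (LinearMap.fst ℂ H H)

/-- The space `H₋` of bounded conjugate linear functionals on `H₊ = dom A^*`.
The norm of `H₊` is `(‖h‖² + ‖P h'‖²)^(1/2)` for `(h, h') ∈ A^*`, with `P` the orthogonal projection
onto the closure of `dom A`. As `(h, h') ∈ A^*` implies `(h, P h') ∈ A^*`, a functional is bounded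
in this norm if and only if it is bounded by the graph norm for every `(h, h') ∈ A^*`. -/
def Minus (A : Submodule ℂ (H × H)) : Submodule ℂ (Plus A →ₛₗ[starRingEnd ℂ] ℂ) where
  carrier := {φ | ∃ C : ℝ, ∀ (h : Plus A) (h' : H), ((h : H), h') ∈ A.adjoint →
    ‖φ h‖ ≤ C * (‖(h : H)‖ + ‖h'‖)}
  zero_mem' := ⟨0, fun h h' _ => by simp⟩
  add_mem' := by
    rintro φ ψ ⟨C, hC⟩ ⟨D, hD⟩
    refine ⟨C + D, fun h h' hh => ?_⟩
    calc ‖(φ + ψ) h‖ ≤ ‖φ h‖ + ‖ψ h‖ := norm_add_le _ _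
      _ ≤ C * (‖(h : H)‖ + ‖h'‖) + D * (‖(h : H)‖ + ‖h'‖) := add_le_add (hC h h' hh) (hD h h' hh)
      _ = (C + D) * (‖(h : H)‖ + ‖h'‖) := by ring
  smul_mem' := by
    rintro c φ ⟨C, hC⟩
    refine ⟨‖c‖ * C, fun h h' hh => ?_⟩
    calc ‖(c • φ) h‖ = ‖c‖ * ‖φ h‖ := by simp
      _ ≤ ‖c‖ * (C * (‖(h : H)‖ + ‖h'‖)) := mul_le_mul_of_nonneg_left (hC h h' hh) (norm_nonneg c)
      _ = ‖c‖ * C * (‖(h : H)‖ + ‖h'‖) := by ring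

open Classical in
/-- The duality `⟨φ, h⟩` of `φ ∈ H₋` and `h ∈ H₊` (set to `0` if `h ∉ H₊`). -/
def pair {A : Submodule ℂ (H × H)} (φ : Minus A) (h : H) : ℂ :=
  if hh : h ∈ Plus A then φ.1 ⟨h, hh⟩ else 0

theorem pair_add {A : Submodule ℂ (H × H)} (φ ψ : Minus A) (h : H) :
    pair (φ + ψ) h = pair φ h + pair ψ h := by
  unfold pair
  split_ifs <;> simp

theorem pair_smul {A : Submodule ℂ (H × H)} (c : ℂ) (φ : Minus A) (h : H) :
    pair (c • φ) h = c * pair φ h := by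
  unfold pair
  split_ifs <;> simp

/-- The map `H → H₋` that sends `f` to the functional `h ↦ (f, h)`. -/
def embed (A : Submodule ℂ (H × H)) : H →ₗ[ℂ] Minus A where
  toFun f :=
    ⟨{ toFun := fun h => inner ℂ (h : H) f
       map_add' := fun h k => inner_add_left _ _ _
       map_smul' := fun c h => inner_smul_left _ _ _ },
      ‖f‖, fun h h' _ => by
        calc ‖inner ℂ (h : H) f‖ ≤ ‖(h : H)‖ * ‖f‖ := norm_inner_le_norm _ _
          _ ≤ ‖f‖ * (‖(h : H)‖ + ‖h'‖) := by
            nlinarith [mul_nonneg (norm_nonneg f) (norm_nonneg h')]⟩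
  map_add' f g := by
    ext h
    exact inner_add_right _ _ _
  map_smul' c f := by
    ext h
    exact inner_smul_right _ _ _

/-- The extension of `A` to a linear relation from `H` to `H₋`: all `(f, φ)` with
`⟨φ, h⟩ = (f, h')` for every `(h, h') ∈ A^*`. -/
def bold (A : Submodule ℂ (H × H)) : Submodule ℂ (H × Minus A) where
  carrier := {x | ∀ k ∈ A.adjoint, pair x.2 k.1 = inner ℂ k.2 x.1}
  zero_mem' := fun k _ => by
    have h0 : pair (0 : Minus A) k.1 = 0 := by
      simpa using pair_smul (0 : ℂ) (0 : Minus A) k.1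
    simp [h0]
  add_mem' := by
    intro x y hx hy k hk
    simp [pair_add, hx k hk, hy k hk]
  smul_mem' := by
    intro c x hx k hk
    simp [pair_smul, hx k hk]

/-- The range, in `H₋`, of the extension of `A` shifted by `z`. -/
def boldRange (A : Submodule ℂ (H × H)) (z : ℂ) : Submodule ℂ (Minus A) :=
  (bold A).map (LinearMap.snd ℂ H (Minus A) - z • (embed A ∘ₗ LinearMap.fst ℂ H (Minus A)))

/-- The adjoint `T^{⟨*⟩} : H₋ → H` of an operator `T : H → H₊`:
`(T^{⟨*⟩} φ, h) = ⟨φ, T h⟩`. -/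
def dualExt (A : Submodule ℂ (H × H)) (T : H → H) (φ : Minus A) : H :=
  Classical.epsilon fun x => ∀ h, inner ℂ h x = pair φ (T h)

/-- `R` is a generalized resolvent of `A` with set of regular points `D`: there are a Pontryagin
space `K` (a Hilbert space with fundamental symmetry `j` and indefinite inner product
`[x, y] = (j x, y)`, where the eigenspace of `j` for `-1` has finite dimension) that contains `H`
isometrically by `V`, and a relation `B` in `K`, selfadjoint with respect to `[·,·]`, that extends
`A`, with `D = ρ(B)` and `R z = P (B - z)⁻¹ V`, where `P : K → H` is the orthogonal projection with
respect to `[·,·]`. -/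
def IsGeneralizedResolvent (A : Submodule ℂ (H × H)) (D : Set ℂ) (R : ℂ → H → H) : Prop :=
  ∃ (K : Type) (_ : NormedAddCommGroup K) (_ : InnerProductSpace ℂ K) (_ : CompleteSpace K)
    (j : K →L[ℂ] K) (V : H →L[ℂ] K) (B : Submodule ℂ (K × K)),
    (∀ x y, inner ℂ (j x) y = inner ℂ x (j y)) ∧ (∀ x, j (j x) = x) ∧
    FiniteDimensional ℂ (LinearMap.ker ((j : K →ₗ[ℂ] K) + LinearMap.id)) ∧
    (∀ f g, inner ℂ (V f) (j (V g)) = inner ℂ f g) ∧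
    (∀ x, x ∈ B ↔ ∀ y ∈ B, inner ℂ y.1 (j x.2) = inner ℂ y.2 (j x.1)) ∧
    (∀ x ∈ A, (V x.1, V x.2) ∈ B) ∧
    D = {z | IsRegularPoint (B : Set (K × K)) z} ∧
    ∀ z ∈ D, ∀ f g, inner ℂ g (R z f) = inner ℂ (V g) (j (resolvent (B : Set (K × K)) z (V f)))

end Relations

section Gauge

variable {p : ℕ} {H : Type*} [NormedAddCommGroup H] [InnerProductSpace ℂ H]

/-- The matrix of a linear operator in `ℂ^p`. -/
def matrixOf (T : (Fin p → ℂ) → (Fin p → ℂ)) : Matrix (Fin p) (Fin p) ℂ :=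
  Matrix.of fun i k => T (Pi.single k 1) i

/-- `S : ℂ^p → H` is the adjoint of `Q : H → ℂ^p`: `(f, S v) = v^* Q f`. -/
def IsHilbertAdjoint (Q : H → Fin p → ℂ) (S : (Fin p → ℂ) → H) : Prop :=
  ∀ v f, inner ℂ (S v) f = star v ⬝ᵥ Q f

/-- `S : ℂ^p → H₊` is the adjoint of `P : H₋ → ℂ^p` with respect to the duality:
`⟨φ, S v⟩ = v^* P φ`. -/
def IsDualAdjoint {A : Submodule ℂ (H × H)} (P : Minus A → Fin p → ℂ)
    (S : (Fin p → ℂ) → H) : Prop :=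
  ∀ v, S v ∈ Plus A ∧ ∀ φ, pair φ (S v) = star v ⬝ᵥ P φ

variable (p H) in
/-- A linear relation `A`, a pair of boundary maps `Γ₀, Γ₁` on `A^*`, and an operator
`L : ℂ^p → H₋` whose range is the gauge. -/
structure GaugeData where
  A : Submodule ℂ (H × H)
  Γ₀ : H × H → Fin p → ℂ
  Γ₁ : H × H → Fin p → ℂ
  L : (Fin p → ℂ) →ₗ[ℂ] Minus A

namespace GaugeData

variable (G : GaugeData p H)

/-- `A₀ = ker Γ₀`. -/
def A₀ : Set (H × H) := {x | x ∈ G.A.adjoint ∧ G.Γ₀ x = 0}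

/-- The resolvent set of `A₀`. -/
def rhoA₀ : Set ℂ := {z | IsRegularPoint G.A₀ z}

/-- `R⁰_z = (A₀ - z)⁻¹`. -/
def R₀ (z : ℂ) : H → H := resolvent G.A₀ z

/-- The `γ`-field: `γ(z) u` is the first entry of the `(h, z h) ∈ A^*` with `Γ₀ (h, z h) = u`. -/
def gammaField (z : ℂ) (u : Fin p → ℂ) : H :=
  Classical.epsilon fun h => (h, z • h) ∈ G.A.adjoint ∧ G.Γ₀ (h, z • h) = u

/-- The Weyl function. -/
def weyl (z : ℂ) : Matrix (Fin p) (Fin p) ℂ :=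
  matrixOf fun u => G.Γ₁ (G.gammaField z u, z • G.gammaField z u)

/-- The adjoint `γ(z)^{⟨*⟩} : H₋ → ℂ^p`, `⟨φ, γ(z) ξ⟩ = ξ^* γ(z)^{⟨*⟩} φ`. -/
def gammaDual (z : ℂ) (φ : Minus G.A) : Fin p → ℂ :=
  fun i => pair φ (G.gammaField z (Pi.single i 1))

/-- The adjoint `L^{⟨*⟩} : H₊ → ℂ^p`, `⟨L ξ, h⟩ = (L^{⟨*⟩} h)^* ξ`. -/
def Ldual (h : H) : Fin p → ℂ :=
  fun i => conj (pair (G.L (Pi.single i 1)) h)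

/-- The set of regular points `z` of `A` with respect to the gauge `ran L`: points of regular type
such that `H₋` is the direct sum of `boldRange A z` and the gauge. -/
def rhoL : Set ℂ :=
  {z | IsRegularType G.A z ∧ IsCompl (LinearMap.range G.L) (boldRange G.A z)}

open Classical in
/-- The projection in `H₋` onto the gauge, parallel to `boldRange A z`. -/
def gaugeProj (z : ℂ) (φ : Minus G.A) : Minus G.A :=
  if h : IsCompl (LinearMap.range G.L) (boldRange G.A z) then Submodule.projection _ _ h φ else 0

/-- The regularizing operator `(R⁰_i + R⁰_{-i}) / 2`. -/
def regularizer (f : H) : H :=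
  (1 / 2 : ℂ) • (G.R₀ Complex.I f + G.R₀ (-Complex.I) f)

/-- For a generalized resolvent `R` the regularized extended generalized resolvent: the difference
of the extension of `R z` to `H₋`, which is the adjoint of `R (conj z)` with respect to the duality,
and of the extension of the regularizing operator to `H₋`. -/
def regExt (R : ℂ → H → H) (z : ℂ) (φ : Minus G.A) : H :=
  dualExt G.A (R (conj z)) φ - dualExt G.A G.regularizer φ

/-- The operator function `𝒫(z) = L⁻¹ Π : H₋ → ℂ^p`, with `Π` the projection onto the gauge. -/
def P (z : ℂ) (φ : Minus G.A) : Fin p → ℂ :=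
  Function.invFun G.L (G.gaugeProj z φ)

/-- `Q : H → ℂ^p` is the operator `L^{⟨*⟩} (R_z - \hat R_z Π)` built from some generalized
resolvent `R` of `A` for which `z` is regular. -/
def IsQ (z : ℂ) (Q : H → Fin p → ℂ) : Prop :=
  ∃ D R, IsGeneralizedResolvent G.A D R ∧ z ∈ D ∧
    ∀ f, Q f = G.Ldual (R z f - G.regExt R z (G.gaugeProj z (embed G.A f)))

/-- The operator function `𝒬(z) = L^{⟨*⟩} (R_z - \hat R_z Π) : H → ℂ^p`; it does not depend on the
choice of the generalized resolvent. -/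
def Q (z : ℂ) : H → Fin p → ℂ := Classical.epsilon (G.IsQ z)

/-- `𝒫(z)^{⟨*⟩} : ℂ^p → H₊`. -/
def Pdual (z : ℂ) : (Fin p → ℂ) → H := Classical.epsilon (IsDualAdjoint (G.P z))

/-- `𝒬(z)^* : ℂ^p → H`. -/
def Qdual (z : ℂ) : (Fin p → ℂ) → H := Classical.epsilon (IsHilbertAdjoint (G.Q z))

/-- `\hat 𝒫(z)^{⟨*⟩} v = (𝒫(z)^{⟨*⟩} v, conj z 𝒫(z)^{⟨*⟩} v) ∈ H × H₋`. -/
def PhatDual (z : ℂ) (v : Fin p → ℂ) : H × Minus G.A :=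
  (G.Pdual z v, conj z • embed G.A (G.Pdual z v))

/-- `\hat 𝒬(z)^{⟨*⟩} v = (𝒬(z)^* v, conj z 𝒬(z)^* v + L v) ∈ H × H₋`. -/
def QhatDual (z : ℂ) (v : Fin p → ℂ) : H × Minus G.A :=
  (G.Qdual z v, conj z • embed G.A (G.Qdual z v) + G.L v)

/-- `b = (b₀, b₁)` is the pair of extended boundary values `(\hat Γ₀ x, \hat Γ₁ x)` of
`x ∈ H × H₋`. The extended boundary maps are linear on `A^{⟨*⟩}`; with `r = \tilde R⁰_w φ` they are
`\hat Γ₀ (r, φ + w r) = 0`, `\hat Γ₁ (r, φ + w r) = γ(conj w)^{⟨*⟩} φ` for `φ ∈ H₋`, and they agree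
with `Γ₀, Γ₁` on the pairs `(γ(w) u, w γ(w) u)`; every element of `A^{⟨*⟩}` is a unique sum of two
such elements, for each `w ∈ ρ(A₀)`. -/
def IsExtBoundaryValue (x : H × Minus G.A) (b : (Fin p → ℂ) × (Fin p → ℂ)) : Prop :=
  ∃ w ∈ G.rhoA₀, ∃ (φ : Minus G.A) (u : Fin p → ℂ),
    x.1 = dualExt G.A (G.R₀ (conj w)) φ + G.gammaField w u ∧
    x.2 = (φ + w • embed G.A (dualExt G.A (G.R₀ (conj w)) φ))
      + w • embed G.A (G.gammaField w u) ∧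
    b.1 = G.Γ₀ (G.gammaField w u, w • G.gammaField w u) ∧
    b.2 = G.gammaDual (conj w) φ + G.Γ₁ (G.gammaField w u, w • G.gammaField w u)

/-- The extended boundary map `\hat Γ₀`. -/
def Γhat₀ (x : H × Minus G.A) : Fin p → ℂ := (Classical.epsilon (G.IsExtBoundaryValue x)).1

/-- The extended boundary map `\hat Γ₁`. -/
def Γhat₁ (x : H × Minus G.A) : Fin p → ℂ := (Classical.epsilon (G.IsExtBoundaryValue x)).2

/-- The resolvent matrix in terms of the extended boundary maps and `𝒫`, `𝒬`. -/
def What (z : ℂ) : Matrix (Fin p ⊕ Fin p) (Fin p ⊕ Fin p) ℂ :=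
  (Matrix.fromBlocks
    (-matrixOf fun v => G.Γhat₀ (G.QhatDual z v)) (matrixOf fun v => G.Γhat₀ (G.PhatDual z v))
    (-matrixOf fun v => G.Γhat₁ (G.QhatDual z v)) (matrixOf fun v => G.Γhat₁ (G.PhatDual z v)))ᴴ

/-- The entries of the preresolvent matrix. -/
def a₁₁ (z : ℂ) : Matrix (Fin p) (Fin p) ℂ := G.weyl z

def a₁₂ (z : ℂ) : Matrix (Fin p) (Fin p) ℂ :=
  matrixOf fun u => G.gammaDual (conj z) (G.L u)

def a₂₁ (z : ℂ) : Matrix (Fin p) (Fin p) ℂ :=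
  matrixOf fun u => G.Ldual (G.gammaField z u)

def a₂₂ (z : ℂ) : Matrix (Fin p) (Fin p) ℂ :=
  matrixOf fun u => G.Ldual (G.regExt G.R₀ z (G.L u))

/-- The right resolvent matrix, for `z ∈ ρ(A, ran L) ∩ ρ(A₀)`, in terms of the preresolvent
matrix. -/
def W (z : ℂ) : Matrix (Fin p ⊕ Fin p) (Fin p ⊕ Fin p) ℂ :=
  Matrix.fromBlocks
    (G.a₂₂ z * (G.a₁₂ z)⁻¹) (G.a₂₂ z * (G.a₁₂ z)⁻¹ * G.a₁₁ z - G.a₂₁ z)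
    ((G.a₁₂ z)⁻¹) ((G.a₁₂ z)⁻¹ * G.a₁₁ z)

/-- The left resolvent matrix `W^#(z) = W(conj z)^*`. -/
def Wleft (z : ℂ) : Matrix (Fin p ⊕ Fin p) (Fin p ⊕ Fin p) ℂ := (G.W (conj z))ᴴ

/-- The left resolvent matrix in terms of the extended boundary maps and `𝒫`, `𝒬`. -/
def WhatLeft (z : ℂ) : Matrix (Fin p ⊕ Fin p) (Fin p ⊕ Fin p) ℂ := (G.What (conj z))ᴴ

end GaugeData

end Gauge

/-! ## Canonical systems -/

/-- The data of a canonical system `J f' + F f = z H f` on `(0, l)`: a matrix `J` with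
`J^* = J⁻¹ = -J`, and Hermitian matrix functions `F`, `H` with integrable entries, `H ≥ 0`. -/
structure CanonicalSystem (p : ℕ) where
  l : ℝ
  l_pos : 0 < l
  J : Matrix (Fin p) (Fin p) ℂ
  J_adjoint : Jᴴ = -J
  J_unitary : Jᴴ * J = 1
  F : ℝ → Matrix (Fin p) (Fin p) ℂ
  H : ℝ → Matrix (Fin p) (Fin p) ℂ
  F_integrable : ∀ i k, IntegrableOn (fun t => F t i k) (Ioo 0 l)
  H_integrable : ∀ i k, IntegrableOn (fun t => H t i k) (Ioo 0 l)
  F_hermitian : ∀ᵐ t ∂volume.restrict (Ioo 0 l), (F t).IsHermitian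
  H_posSemidef : ∀ᵐ t ∂volume.restrict (Ioo 0 l), (H t).PosSemidef

namespace CanonicalSystem

variable {p : ℕ} (S : CanonicalSystem p)

/-- Lebesgue measure on `(0, l)`. -/
abbrev μ : Measure ℝ := volume.restrict (Ioo 0 S.l)

/-- The function `g(t)^* H(t) f(t)`. -/
def form (g f : ℝ → Fin p → ℂ) (t : ℝ) : ℂ := star (g t) ⬝ᵥ (S.H t *ᵥ f t)

theorem form_add_left (f g h : ℝ → Fin p → ℂ) (t : ℝ) :
    S.form (f + g) h t = S.form f h t + S.form g h t := by
  simp [form, add_dotProduct]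

theorem form_add_right (f g h : ℝ → Fin p → ℂ) (t : ℝ) :
    S.form h (f + g) t = S.form h f t + S.form h g t := by
  simp [form, mulVec_add, dotProduct_add]

theorem form_smul_left (c : ℂ) (f g : ℝ → Fin p → ℂ) (t : ℝ) :
    S.form (c • f) g t = conj c * S.form f g t := by
  simp [form, smul_dotProduct]

theorem form_smul_right (c : ℂ) (f g : ℝ → Fin p → ℂ) (t : ℝ) :
    S.form g (c • f) t = c * S.form g f t := by
  simp [form, mulVec_smul, dotProduct_smul]

theorem form_aestronglyMeasurable {f g : ℝ → Fin p → ℂ} (hf : AEStronglyMeasurable f S.μ)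
    (hg : AEStronglyMeasurable g S.μ) : AEStronglyMeasurable (S.form g f) S.μ := by
  have hf' : ∀ i, AEStronglyMeasurable (fun t => f t i) S.μ := fun i =>
    (continuous_apply i).comp_aestronglyMeasurable hf
  have hg' : ∀ i, AEStronglyMeasurable (fun t => star (g t i)) S.μ := fun i =>
    (continuous_star.comp (continuous_apply i)).comp_aestronglyMeasurable hg
  unfold form
  simp only [dotProduct, mulVec, Pi.star_apply]
  refine Finset.aestronglyMeasurable_fun_sum _ fun i _ => (hg' i).mul ?_
  exact Finset.aestronglyMeasurable_fun_sum _ fun k _ =>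
    (S.H_integrable i k).aestronglyMeasurable.mul (hf' k)

theorem form_self_nonneg (f : ℝ → Fin p → ℂ) : ∀ᵐ t ∂S.μ, 0 ≤ S.form f f t := by
  filter_upwards [S.H_posSemidef] with t ht
  exact ht.dotProduct_mulVec_nonneg (f t)

theorem integrable_form_add {f g : ℝ → Fin p → ℂ}
    (hf : AEStronglyMeasurable f S.μ) (hg : AEStronglyMeasurable g S.μ)
    (hf' : Integrable (S.form f f) S.μ) (hg' : Integrable (S.form g g) S.μ) :
    Integrable (S.form (f + g) (f + g)) S.μ := by
  refine Integrable.mono' ((hf'.norm.const_mul 2).add (hg'.norm.const_mul 2))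
    (S.form_aestronglyMeasurable (hf.add hg) (hf.add hg)) ?_
  filter_upwards [S.form_self_nonneg f, S.form_self_nonneg g, S.form_self_nonneg (f + g),
    S.form_self_nonneg (f + (-1 : ℂ) • g)] with t h1 h2 h3 h4
  have key : S.form (f + g) (f + g) t + S.form (f + (-1 : ℂ) • g) (f + (-1 : ℂ) • g) t
      = 2 * S.form f f t + 2 * S.form g g t := by
    simp only [form_add_left, form_add_right, form_smul_left, form_smul_right, map_neg, map_one]
    ring
  have hre := congrArg Complex.re key
  simp only [Complex.add_re, Complex.mul_re, Complex.re_ofNat, Complex.im_ofNat, zero_mul,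
    sub_zero] at hre
  have hn : ∀ w : ℂ, 0 ≤ w → ‖w‖ = w.re := fun w hw => by
    rw [Complex.nonneg_iff] at hw
    rw [← Complex.abs_re_eq_norm.mpr hw.2.symm, abs_of_nonneg hw.1]
  have h4' : 0 ≤ (S.form (f + (-1 : ℂ) • g) (f + (-1 : ℂ) • g) t).re :=
    (Complex.nonneg_iff.mp h4).1
  simp only [Pi.add_apply]
  rw [hn _ h1, hn _ h2, hn _ h3]
  linarith

/-- The semi-Hilbert space of measurable functions `f` with `∫ f^* H f < ∞`. -/
def square : Submodule ℂ (ℝ → Fin p → ℂ) where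
  carrier := {f | AEStronglyMeasurable f S.μ ∧ Integrable (S.form f f) S.μ}
  zero_mem' := ⟨aestronglyMeasurable_zero, by
    have : S.form 0 0 = 0 := by
      ext t
      simp [form]
    rw [this]
    exact integrable_zero _ _ _⟩
  add_mem' := fun hf hg => ⟨hf.1.add hg.1, S.integrable_form_add hf.1 hg.1 hf.2 hg.2⟩
  smul_mem' := fun c f hf => ⟨hf.1.const_smul c, by
    have : S.form (c • f) (c • f) = fun t => conj c * (c * S.form f f t) := by
      ext t
      rw [form_smul_left, form_smul_right]
    rw [this]
    exact (hf.2.const_mul c).const_mul (conj c)⟩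

theorem integrable_form {f g : ℝ → Fin p → ℂ} (hf : f ∈ S.square) (hg : g ∈ S.square) :
    Integrable (S.form g f) S.μ := by
  have h1 := (S.square.add_mem hg hf).2
  have h2 := (S.square.add_mem hg (S.square.smul_mem Complex.I hf)).2
  have h := ((h1.sub hg.2).sub hf.2).const_mul (1 / 2 : ℂ) |>.sub
    ((((h2.sub hg.2).sub hf.2)).const_mul (Complex.I / 2))
  refine h.congr (Filter.Eventually.of_forall fun t => ?_)
  simp only [Pi.sub_apply, form_add_left, form_add_right, form_smul_left, form_smul_right,
    Complex.conj_I]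
  ring_nf
  simp only [Complex.I_sq, Complex.I_pow_three]
  ring

/-- The space `square` as a type of its own (without the topology of pointwise convergence). -/
def Pre : Type := S.square

instance : AddCommGroup S.Pre := inferInstanceAs (AddCommGroup S.square)

instance : Module ℂ S.Pre := inferInstanceAs (Module ℂ S.square)

/-- The semi-definite inner product `(f, g) = ∫ g^* H f` (`inner ℂ g f` in Mathlib's convention). -/
@[reducible]
def preCore : PreInnerProductSpace.Core ℂ S.Pre where
  inner g f := ∫ t, S.form g.1 f.1 t ∂S.μ
  conj_inner_symm g f := by
    rw [← integral_conj]
    refine integral_congr_ae ?_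
    filter_upwards [S.H_posSemidef] with t ht
    have hh : (S.H t)ᴴ = S.H t := ht.isHermitian
    change star (star (f.1 t) ⬝ᵥ (S.H t *ᵥ g.1 t)) = star (g.1 t) ⬝ᵥ (S.H t *ᵥ f.1 t)
    rw [star_dotProduct, star_star, star_mulVec, hh, dotProduct_comm, dotProduct_mulVec]
    exact dotProduct_comm _ _
  re_inner_nonneg f := by
    have h : RCLike.re (∫ t, S.form f.1 f.1 t ∂S.μ) = ∫ t, RCLike.re (S.form f.1 f.1 t) ∂S.μ :=
      (integral_re f.2.2).symm
    rw [h]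
    refine integral_nonneg_of_ae ?_
    filter_upwards [S.form_self_nonneg f.1] with t ht
    exact (Complex.nonneg_iff.mp ht).1
  add_left f g h := by
    rw [← integral_add (S.integrable_form h.2 f.2) (S.integrable_form h.2 g.2)]
    exact integral_congr_ae (Filter.Eventually.of_forall fun t => S.form_add_left f.1 g.1 h.1 t)
  smul_left f g c := by
    rw [← integral_const_mul]
    exact integral_congr_ae (Filter.Eventually.of_forall fun t => S.form_smul_left c f.1 g.1 t)

instance : SeminormedAddCommGroup S.Pre :=
  @InnerProductSpace.Core.toSeminormedAddCommGroup ℂ S.Pre _ _ _ S.preCore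

instance : InnerProductSpace ℂ S.Pre := InnerProductSpace.ofCore S.preCore

/-- The Hilbert space `L²_H(0, l)`: the quotient of `square` by its elements of norm zero. -/
abbrev L2 : Type := SeparationQuotient S.Pre

open Classical in
/-- The class in `L²_H(0, l)` of a function (`0` if the function is not square integrable). -/
def toL2 (f : ℝ → Fin p → ℂ) : S.L2 :=
  if hf : f ∈ S.square then SeparationQuotient.mk (⟨f, hf⟩ : S.square) else 0

theorem toL2_add {f g : ℝ → Fin p → ℂ} (hf : f ∈ S.square) (hg : g ∈ S.square) :
    S.toL2 (f + g) = S.toL2 f + S.toL2 g := by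
  rw [toL2, toL2, toL2, dif_pos hf, dif_pos hg, dif_pos (S.square.add_mem hf hg)]
  rfl

theorem toL2_smul (c : ℂ) {f : ℝ → Fin p → ℂ} (hf : f ∈ S.square) :
    S.toL2 (c • f) = c • S.toL2 f := by
  rw [toL2, toL2, dif_pos hf, dif_pos (S.square.smul_mem c hf)]
  rfl

/-- `f` is absolutely continuous on `[0, l]` and `J f' + F f = r` a.e. on `(0, l)`. -/
def Solves (f r : ℝ → Fin p → ℂ) : Prop :=
  AbsolutelyContinuousOnInterval f 0 S.l ∧
    ∀ᵐ t ∂S.μ, ∃ d, HasDerivAt f d t ∧ S.J *ᵥ d + S.F t *ᵥ f t = r t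

/-- `f` and `g` represent a pair in the maximal relation: `J f' + F f = H g`. -/
def MaxPair (f g : ℝ → Fin p → ℂ) : Prop :=
  f ∈ S.square ∧ g ∈ S.square ∧ S.Solves f fun t => S.H t *ᵥ g t

theorem MaxPair.add {f g f' g' : ℝ → Fin p → ℂ} (h : S.MaxPair f g) (h' : S.MaxPair f' g') :
    S.MaxPair (f + f') (g + g') := by
  refine ⟨S.square.add_mem h.1 h'.1, S.square.add_mem h.2.1 h'.2.1, h.2.2.1.add h'.2.2.1, ?_⟩
  filter_upwards [h.2.2.2, h'.2.2.2] with t ⟨d, hd, e⟩ ⟨d', hd', e'⟩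
  refine ⟨d + d', hd.add hd', ?_⟩
  simp only [Pi.add_apply, mulVec_add]
  rw [← e, ← e']
  abel

theorem MaxPair.smul (c : ℂ) {f g : ℝ → Fin p → ℂ} (h : S.MaxPair f g) :
    S.MaxPair (c • f) (c • g) := by
  refine ⟨S.square.smul_mem c h.1, S.square.smul_mem c h.2.1, h.2.2.1.const_smul c, ?_⟩
  filter_upwards [h.2.2.2] with t ⟨d, hd, e⟩
  refine ⟨c • d, hd.const_smul c, ?_⟩
  simp only [Pi.smul_apply, mulVec_smul]
  rw [← e, smul_add]

theorem MaxPair.zero : S.MaxPair 0 0 := by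
  refine ⟨S.square.zero_mem, S.square.zero_mem, ?_, Filter.Eventually.of_forall fun t => ?_⟩
  · simp [AbsolutelyContinuousOnInterval, tendsto_const_nhds]
  · exact ⟨0, hasDerivAt_const t 0, by simp⟩

/-- The maximal relation. -/
def Amax : Submodule ℂ (S.L2 × S.L2) where
  carrier := {x | ∃ f g, S.MaxPair f g ∧ x = (S.toL2 f, S.toL2 g)}
  zero_mem' := ⟨0, 0, MaxPair.zero S, by
    have h := S.toL2_smul 0 S.square.zero_mem
    rw [zero_smul, zero_smul] at h
    rw [h]
    rfl⟩
  add_mem' := by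
    rintro _ _ ⟨f, g, h, rfl⟩ ⟨f', g', h', rfl⟩
    exact ⟨f + f', g + g', h.add S h', by
      rw [S.toL2_add h.1 h'.1, S.toL2_add h.2.1 h'.2.1]
      rfl⟩
  smul_mem' := by
    rintro c _ ⟨f, g, h, rfl⟩
    exact ⟨c • f, c • g, h.smul S c, by
      rw [S.toL2_smul c h.1, S.toL2_smul c h.2.1]
      rfl⟩

/-- The preminimal relation: pairs in the maximal relation whose first entry has compact support
in `(0, l)`. -/
def Apre : Submodule ℂ (S.L2 × S.L2) where
  carrier := {x | ∃ f g, S.MaxPair f g ∧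
    (∃ a b, 0 < a ∧ b < S.l ∧ ∀ t ∈ Icc 0 S.l, t ∉ Icc a b → f t = 0) ∧
    x = (S.toL2 f, S.toL2 g)}
  zero_mem' := ⟨0, 0, MaxPair.zero S, ⟨S.l, 0, S.l_pos, S.l_pos, fun _ _ _ => rfl⟩, by
    have h := S.toL2_smul 0 S.square.zero_mem
    rw [zero_smul, zero_smul] at h
    rw [h]
    rfl⟩
  add_mem' := by
    rintro _ _ ⟨f, g, h, ⟨a, b, ha, hb, hs⟩, rfl⟩ ⟨f', g', h', ⟨a', b', ha', hb', hs'⟩, rfl⟩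
    refine ⟨f + f', g + g', h.add S h', ⟨min a a', max b b', lt_min ha ha', max_lt hb hb', ?_⟩, ?_⟩
    · intro t ht hn
      have h1 : t ∉ Icc a b := fun hm =>
        hn ⟨(min_le_left _ _).trans hm.1, hm.2.trans (le_max_left _ _)⟩
      have h2 : t ∉ Icc a' b' := fun hm =>
        hn ⟨(min_le_right _ _).trans hm.1, hm.2.trans (le_max_right _ _)⟩
      simp [hs t ht h1, hs' t ht h2]
    · rw [S.toL2_add h.1 h'.1, S.toL2_add h.2.1 h'.2.1]
      rfl
  smul_mem' := by
    rintro c _ ⟨f, g, h, ⟨a, b, ha, hb, hs⟩, rfl⟩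
    refine ⟨c • f, c • g, h.smul S c, ⟨a, b, ha, hb, fun t ht hn => by simp [hs t ht hn]⟩, ?_⟩
    rw [S.toL2_smul c h.1, S.toL2_smul c h.2.1]
    rfl

/-- The minimal relation. -/
def Amin : Submodule ℂ (S.L2 × S.L2) := S.Apre.topologicalClosure

/-- Definiteness: a solution of `J f' + F f = 0` with `H f = 0` a.e. vanishes. -/
def Definite : Prop :=
  ∀ f, S.Solves f 0 → (∀ᵐ t ∂S.μ, S.H t *ᵥ f t = 0) → ∀ t ∈ Ioo 0 S.l, f t = 0

/-- For `f` in the domain of the maximal relation, the value `f(0)` depends only on the class of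
`f`, i.e. `δ ⊗ u : f ↦ f(0)^* u` is a well-defined functional on this domain. -/
def DeltaWellDefined : Prop :=
  ∀ f g, S.MaxPair f g → (∀ᵐ t ∂S.μ, S.H t *ᵥ f t = 0) → f 0 = 0

/-- `Y` is the fundamental matrix solution for the parameter `z`. -/
def IsFundamental (z : ℂ) (Y : ℝ → Matrix (Fin p) (Fin p) ℂ) : Prop :=
  Y 0 = 1 ∧ ∀ v, S.Solves (fun t => Y t *ᵥ v) fun t => z • (S.H t *ᵥ (Y t *ᵥ v))

/-- The fundamental matrix solution `U(t, z)`. -/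
def U (z : ℂ) : ℝ → Matrix (Fin p) (Fin p) ℂ := Classical.epsilon (S.IsFundamental z)

/-- The absolutely continuous representative `f` of the first entry of a pair in the maximal
relation (unique on `[0, l]` for a definite system). -/
def rep (x : S.L2 × S.L2) : ℝ → Fin p → ℂ :=
  Classical.epsilon fun f => ∃ g, S.MaxPair f g ∧ x = (S.toL2 f, S.toL2 g)

/-- The boundary map `Γ₀ (f, g) = (f(0) + f(l)) / √2`. -/
def Γ₀ (x : S.L2 × S.L2) : Fin p → ℂ :=
  ((1 / Real.sqrt 2 : ℝ) : ℂ) • (S.rep x 0 + S.rep x S.l)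

/-- The boundary map `Γ₁ (f, g) = - J (f(0) - f(l)) / √2`. -/
def Γ₁ (x : S.L2 × S.L2) : Fin p → ℂ :=
  -((1 / Real.sqrt 2 : ℝ) : ℂ) • (S.J *ᵥ (S.rep x 0 - S.rep x S.l))

/-- `d u = δ ⊗ u` for all `u`: `⟨d u, f⟩ = f(0)^* u` for `f ∈ H₊`. -/
def IsDelta (d : (Fin p → ℂ) →ₗ[ℂ] Minus S.Amin) : Prop :=
  ∀ u f g, S.MaxPair f g → pair (d u) (S.toL2 f) = star (f 0) ⬝ᵥ u

/-- The map `u ↦ δ ⊗ u`. -/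
def delta : (Fin p → ℂ) →ₗ[ℂ] Minus S.Amin := Classical.epsilon S.IsDelta

/-- The minimal relation with the boundary maps `Γ₀, Γ₁` and the gauge operator
`L u = √2 δ ⊗ u`. -/
def gauge : GaugeData p S.L2 where
  A := S.Amin
  Γ₀ := S.Γ₀
  Γ₁ := S.Γ₁
  L := ((Real.sqrt 2 : ℝ) : ℂ) • S.delta

/-- `K = J Re M(i) J` with the Weyl function `M`. -/
def K : Matrix (Fin p) (Fin p) ℂ :=
  S.J * ((1 / 2 : ℂ) • (S.gauge.weyl Complex.I + (S.gauge.weyl Complex.I)ᴴ)) * S.J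

/-- The element `U(·, z) v` of `L²_H(0, l)`. -/
def solution (z : ℂ) (v : Fin p → ℂ) : S.L2 := S.toL2 fun t => S.U z t *ᵥ v

end CanonicalSystem

end LResolvent

end

noncomputable section

namespace LResolvent

/-! ## Absolutely continuous functions and linear Volterra equations -/

section AbsolutelyContinuous

/-! Since `J` is invertible, the system is a linear Volterra equation with an integrable
coefficient. For every `z` it therefore has exactly one solution for each initial value and each
forcing term `H g`, with a bound by the data. So every pair `(f, g)` of the maximal relation
satisfies `f = T(g - z f) + U(·, z) f(0)`, where the bounded operator `T` solves with initial value
zero (`eq_solutionOp_add_solution`). In particular, `ker (A_max - z)` consists of the functions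
`U(·, z) v`. The Lagrange identity writes the boundary form as the difference of the `J`-pairings of
the values at `l` and at `0`. Together with the density of compactly supported forcings this gives
`A_min^* = A_max` (`adjoint_Amin`).

For (i), the range of the extended `A - λ` in `H₋` is the annihilator of the functions `U(·, conj λ)
v` (`mem_boldRange`), while `⟨L u, U(·, conj λ) v⟩ = √2 v^* u`. Hence the gauge is complementary to
that range for every `λ`, and `𝒫(λ) φ` is read off by testing `φ` on `U(·, conj λ) v`
(`rt_mul_star_dotProduct_P`). For `𝒬`, write `Π f = L u` with `u = 𝒫(λ) f`. Green's identity shows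
that for every generalized resolvent the difference of `R_λ f` and of the extended resolvent at `L
u` is the same function `w`. It solves the system with forcing `H f` and satisfies `w(l) = 0`, `w(0)
= √2 J u` (`sub_dualExt_eq`). Thus the choice of extension drops out. Applying `L^{⟨*⟩}` gives `2 J
u`, the regularizer contributes `-(J + K) u` (`E_add_E_mul_J`), so `𝒬 = (J - K) 𝒫`, and the formula
for `𝒬^*` follows from `J^* = -J`, `K^* = K`. A generalized resolvent regular at a given `λ` comes
from a boundary condition `f(l) = c f(0)`, `|c| = 1`, with `c` off the finite spectrum of `U(l, λ)`.

For (ii), the extended boundary values `(b₀, b₁)` of `(x, φ)` are characterized by an abstract Green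
identity against all of `A_max` (`pair_sub_inner_eq`, `isExtBoundaryValue_of_forall`). In it the
functional `L v` contributes `(J v, v)`, and the remaining terms are ordinary boundary values of
multiples of `U(·, λ) v`. This gives the explicit matrix. The matrix `W` is computed separately from
`E = (U(l, ·) + I)⁻¹` and `M = J (U - I) E`, and the two agree by block algebra that uses only `U(l,
conj z)^* J U(l, z) = J` and `J² = -1`. -/

theorem intervalIntegrable_of_Ioo {E : Type*} [NormedAddCommGroup E] {q : ℝ → E} {a b : ℝ} (hab : a ≤ b)
    (h : Integrable q (volume.restrict (Ioo a b))) :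
    IntervalIntegrable q volume a b :=
  (intervalIntegrable_iff_integrableOn_Ioo_of_le hab).mpr h

variable {E : Type*} [NormedAddCommGroup E] [NormedSpace ℝ E] {f q : ℝ → E} {a b : ℝ}

/-- The increment of the primitive over each subinterval is bounded by the increment of the
primitive of `‖q‖`, so the scalar case suffices. -/
theorem absolutelyContinuousOnInterval_integral (h : IntervalIntegrable q volume a b) :
    AbsolutelyContinuousOnInterval (fun x => ∫ v in a..x, q v) a b := by
  have h1 := h.norm.absolutelyContinuousOnInterval_intervalIntegral (c := a) left_mem_uIcc
  unfold AbsolutelyContinuousOnInterval at h1 ⊢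
  refine squeeze_zero' (Filter.Eventually.of_forall fun _ =>
    Finset.sum_nonneg fun i hi => dist_nonneg) ?_ h1
  rw [Filter.eventually_inf_principal]
  refine Filter.Eventually.of_forall fun I hI => ?_
  refine Finset.sum_le_sum fun i hi => ?_
  have h2 := hI.1 i hi
  have hI1 : IntervalIntegrable q volume a (I.2 i).1 :=
    h.mono_set (uIcc_subset_uIcc left_mem_uIcc h2.1)
  have hI2 : IntervalIntegrable q volume a (I.2 i).2 :=
    h.mono_set (uIcc_subset_uIcc left_mem_uIcc h2.2)
  rw [dist_eq_norm, dist_eq_norm, intervalIntegral.integral_interval_sub_left hI1 hI2,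
    intervalIntegral.integral_interval_sub_left hI1.norm hI2.norm]
  exact intervalIntegral.norm_integral_le_abs_integral_norm

theorem ae_uIcc_of_ae_Ioo (hab : a ≤ b) {P : ℝ → Prop} (h : ∀ᵐ t ∂volume.restrict (Ioo a b), P t) :
    ∀ᵐ t, t ∈ uIcc a b → P t := by
  rw [uIcc_of_le hab]
  rw [Measure.restrict_congr_set (Ioo_ae_eq_Icc (μ := volume) (a := a) (b := b))] at h
  exact (ae_restrict_iff' measurableSet_Icc).mp h

/-- The fundamental theorem of calculus for absolutely continuous functions with values in a
Banach space and an almost everywhere derivative. -/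
theorem eq_add_integral_of_absolutelyContinuous [CompleteSpace E] (hab : a ≤ b)
    (hf : AbsolutelyContinuousOnInterval f a b)
    (hq : Integrable q (volume.restrict (Ioo a b)))
    (hd : ∀ᵐ t ∂volume.restrict (Ioo a b), HasDerivAt f (q t) t) {t : ℝ} (ht : t ∈ Icc a b) :
    f t = f a + ∫ s in a..t, q s := by
  have hq' := intervalIntegrable_of_Ioo hab hq
  -- `f` minus the primitive of `q` is absolutely continuous with derivative zero almost everywhere,
  -- hence constant.
  have h1 := hf.sub (absolutelyContinuousOnInterval_integral hq')
  obtain ⟨C, hC⟩ := h1.const_of_ae_hasDerivAt_zero (by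
    filter_upwards [ae_uIcc_of_ae_Ioo hab hd, hq'.ae_hasDerivAt_integral] with x hx hx' hm
    simpa using (hx hm).sub (hx' hm a left_mem_uIcc))
  rw [← uIcc_of_le hab] at ht
  have h2 := hC t ht
  have h3 := hC a left_mem_uIcc
  simp only [Pi.sub_apply, intervalIntegral.integral_same, sub_zero] at h2 h3
  rw [h3, ← h2]
  abel

/-- A function that is an indefinite integral on `[a, b]` is absolutely continuous there and has the
integrand as its derivative almost everywhere. -/
theorem absolutelyContinuous_of_eq_add_integral [CompleteSpace E] (hab : a ≤ b)
    (hq : Integrable q (volume.restrict (Ioo a b))) {c : E}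
    (h : ∀ t ∈ Icc a b, f t = c + ∫ s in a..t, q s) :
    AbsolutelyContinuousOnInterval f a b ∧
      ∀ᵐ t ∂volume.restrict (Ioo a b), HasDerivAt f (q t) t := by
  have hq' := intervalIntegrable_of_Ioo hab hq
  constructor
  · have h1 := absolutelyContinuousOnInterval_integral hq'
    rw [absolutelyContinuousOnInterval_iff] at h1 ⊢
    intro ε hε
    obtain ⟨δ, hδ, H⟩ := h1 ε hε
    refine ⟨δ, hδ, fun I hI hI' => lt_of_eq_of_lt (Finset.sum_congr rfl fun i hi => ?_) (H I hI hI')⟩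
    have h2 := hI.1 i hi
    rw [uIcc_of_le hab] at h2
    rw [h _ h2.1, h _ h2.2, dist_add_left]
  · rw [ae_restrict_iff' measurableSet_Ioo]
    filter_upwards [hq'.ae_hasDerivAt_integral] with x hx hm
    have h1 := (hx (by rw [uIcc_of_le hab]; exact Ioo_subset_Icc_self hm) a left_mem_uIcc).const_add c
    refine h1.congr_of_eventuallyEq ?_
    filter_upwards [Ioo_mem_nhds hm.1 hm.2] with y hy using h y (Ioo_subset_Icc_self hy)

end AbsolutelyContinuous

/-! ### Invertibility of Volterra operators with integrable coefficient. -/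

section Volterra

variable {V : Type*} [NormedAddCommGroup V] [NormedSpace ℂ V] {l : ℝ}

/-- The coefficient is only integrable, so it is split into a bounded continuous `g` and a remainder
of `L¹` norm at most `1/4`. The exponential weight has integral at most `1/c`, and `c = 4 ‖g‖ + 1`
makes the bounded part contribute at most `1/4`. -/
theorem exists_exp_weight {a : ℝ → ℝ} (hl : 0 ≤ l)
    (ha : Integrable a (volume.restrict (Ioo 0 l))) :
    ∃ c : ℝ, 0 < c ∧ ∀ t ∈ Icc 0 l, ∫ s in (0 : ℝ)..t, Real.exp (c * (s - t)) * ‖a s‖ ≤ 1 / 2 := by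
  obtain ⟨g, hg, hg'⟩ := ha.exists_boundedContinuous_integral_sub_le (ε := 1 / 4) (by norm_num)
  set N := ‖g‖
  have hN : 0 ≤ N := norm_nonneg g
  refine ⟨4 * N + 1, by positivity, fun t ht => ?_⟩
  set c := 4 * N + 1
  have hc : 0 < c := by positivity
  have hsub : uIcc 0 t ⊆ uIcc 0 l := by
    rw [uIcc_of_le ht.1, uIcc_of_le hl]; exact Icc_subset_Icc_right ht.2
  have hce : Continuous fun s : ℝ => Real.exp (c * (s - t)) := by fun_prop
  have hia := ((intervalIntegrable_of_Ioo hl ha).mono_set hsub).norm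
  have hid := ((intervalIntegrable_of_Ioo hl (ha.sub hg')).mono_set hsub).norm
  simp only [Pi.sub_apply] at hid
  have hexp : ∫ s in (0 : ℝ)..t, Real.exp (c * (s - t)) ≤ 1 / c := by
    have h1 : ∀ s ∈ uIcc 0 t, HasDerivAt (fun s => Real.exp (c * (s - t)) / c)
        (Real.exp (c * (s - t))) s := by
      intro s _
      have := ((((hasDerivAt_id s).sub_const t).const_mul c).exp).div_const c
      simpa [hc.ne'] using this
    rw [intervalIntegral.integral_eq_sub_of_hasDerivAt h1 (hce.intervalIntegrable _ _)]
    have := (Real.exp_pos (c * (0 - t))).le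
    simp only [sub_self, mul_zero, Real.exp_zero]
    have := div_nonneg this hc.le
    linarith
  calc ∫ s in (0 : ℝ)..t, Real.exp (c * (s - t)) * ‖a s‖
      ≤ ∫ s in (0 : ℝ)..t, (‖a s - g s‖ + N * Real.exp (c * (s - t))) := by
        refine intervalIntegral.integral_mono_on ht.1 (hia.continuousOn_mul hce.continuousOn)
          (hid.add ((hce.intervalIntegrable _ _).const_mul N)) fun s hs => ?_
        have h1 : ‖a s‖ ≤ ‖a s - g s‖ + N := by
          calc ‖a s‖ = ‖(a s - g s) + g s‖ := by rw [sub_add_cancel]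
            _ ≤ ‖a s - g s‖ + ‖g s‖ := norm_add_le _ _
            _ ≤ _ := by gcongr; exact g.norm_coe_le_norm s
        have h2 : Real.exp (c * (s - t)) ≤ 1 := by
          rw [Real.exp_le_one_iff]
          exact mul_nonpos_of_nonneg_of_nonpos hc.le (by linarith [hs.2])
        have h3 := (Real.exp_pos (c * (s - t))).le
        nlinarith [norm_nonneg (a s - g s)]
    _ = (∫ s in (0 : ℝ)..t, ‖a s - g s‖) + N * ∫ s in (0 : ℝ)..t, Real.exp (c * (s - t)) := by
        rw [intervalIntegral.integral_add hid ((hce.intervalIntegrable _ _).const_mul N),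
          intervalIntegral.integral_const_mul]
    _ ≤ 1 / 4 + N * (1 / c) := by
        gcongr
        refine le_trans ?_ hg
        rw [intervalIntegral.integral_of_le ht.1, integral_Ioc_eq_integral_Ioo]
        exact setIntegral_mono_set (ha.sub hg').norm
          (Filter.Eventually.of_forall fun _ => norm_nonneg _)
          (Ioo_subset_Ioo_right ht.2).eventuallyLE
    _ ≤ 1 / 2 := by
        have : N * (1 / c) ≤ 1 / 4 := by
          rw [mul_one_div, div_le_iff₀ hc]; simp only [c]; linarith
        linarith

theorem intervalIntegrable_clm_apply {A : ℝ → V →L[ℂ] V} (hl : 0 ≤ l)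
    (hA : Integrable A (volume.restrict (Ioo 0 l))) {y : ℝ → V} (hy : Continuous y) {t : ℝ}
    (ht : t ∈ Icc 0 l) : IntervalIntegrable (fun s => A s (y s)) volume 0 t := by
  have h1 : IntervalIntegrable A volume 0 t := (intervalIntegrable_of_Ioo hl hA).mono_set (by
    rw [uIcc_of_le ht.1, uIcc_of_le hl]; exact Icc_subset_Icc_right ht.2)
  obtain ⟨C, hC⟩ := (isCompact_uIcc (a := (0 : ℝ)) (b := t)).exists_bound_of_continuousOn
    hy.continuousOn
  refine (h1.norm.mul_const C).mono_fun
    ((ContinuousLinearMap.id ℂ (V →L[ℂ] V)).aestronglyMeasurable_comp₂ h1.def'.aestronglyMeasurable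
      hy.aestronglyMeasurable) ?_
  refine (ae_restrict_iff' measurableSet_uIoc).mpr (Filter.Eventually.of_forall fun s hs => ?_)
  refine (A s).le_opNorm_of_le (hC s (uIoc_subset_uIcc hs)) |>.trans ?_
  exact le_abs_self _

/-- The Volterra operator `y ↦ ∫₀ᵗ A y` on `C([0, l], V)`. -/
def volterra (hl : 0 ≤ l) (A : ℝ → V →L[ℂ] V)
    (hA : Integrable A (volume.restrict (Ioo 0 l))) : C(Icc 0 l, V) →L[ℂ] C(Icc 0 l, V) :=
  LinearMap.mkContinuous
    { toFun := fun y => ⟨fun t => ∫ s in (0 : ℝ)..t, A s (IccExtend hl y s), by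
        have h := intervalIntegral.continuousOn_primitive_interval'
          (intervalIntegrable_clm_apply hl hA (y.continuous.Icc_extend' (h := hl)) (right_mem_Icc.mpr hl))
          left_mem_uIcc
        rw [uIcc_of_le hl] at h
        exact continuousOn_iff_continuous_domRestrict.mp h⟩
      map_add' := fun y z => by
        ext t
        change ∫ s in (0 : ℝ)..t, A s (IccExtend hl (y + z) s) =
          (∫ s in (0 : ℝ)..t, A s (IccExtend hl y s)) + ∫ s in (0 : ℝ)..t, A s (IccExtend hl z s)
        rw [← intervalIntegral.integral_add
          (intervalIntegrable_clm_apply hl hA (y.continuous.Icc_extend' (h := hl)) t.2)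
          (intervalIntegrable_clm_apply hl hA (z.continuous.Icc_extend' (h := hl)) t.2)]
        simp [IccExtend]
      map_smul' := fun c y => by
        ext t
        change ∫ s in (0 : ℝ)..t, A s (IccExtend hl (c • y) s) =
          c • ∫ s in (0 : ℝ)..t, A s (IccExtend hl y s)
        rw [← intervalIntegral.integral_smul]
        simp [IccExtend] }
    (∫ s in (0 : ℝ)..l, ‖A s‖) fun y => by
      have hi := (intervalIntegrable_of_Ioo hl hA).norm
      have h0 : 0 ≤ ∫ s in (0 : ℝ)..l, ‖A s‖ :=
        intervalIntegral.integral_nonneg hl fun _ _ => norm_nonneg _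
      rw [ContinuousMap.norm_le _ (by positivity)]
      intro t
      have hit : IntervalIntegrable (fun s => ‖A s‖) volume 0 t := hi.mono_set (by
        rw [uIcc_of_le t.2.1, uIcc_of_le hl]; exact Icc_subset_Icc_right t.2.2)
      calc ‖∫ s in (0 : ℝ)..t, A s (IccExtend hl y s)‖
          ≤ ∫ s in (0 : ℝ)..t, ‖A s‖ * ‖y‖ := by
            refine intervalIntegral.norm_integral_le_of_norm_le t.2.1
              (Filter.Eventually.of_forall fun s _ => ?_) (hit.mul_const _)
            exact (A s).le_opNorm_of_le (y.norm_coe_le_norm _)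
        _ = (∫ s in (0 : ℝ)..t, ‖A s‖) * ‖y‖ := intervalIntegral.integral_mul_const _ _
        _ ≤ _ := by
            gcongr
            exact intervalIntegral.integral_mono_interval le_rfl t.2.1 t.2.2
              (Filter.Eventually.of_forall fun _ => norm_nonneg _) hi

theorem volterra_apply (hl : 0 ≤ l) (A : ℝ → V →L[ℂ] V)
    (hA : Integrable A (volume.restrict (Ioo 0 l))) (y : C(Icc 0 l, V)) (t : Icc 0 l) :
    volterra hl A hA y t = ∫ s in (0 : ℝ)..t, A s (IccExtend hl y s) := rfl

/-- Multiplication by `exp (c t)` on `C([0, l], V)`. -/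
def expMul (l c : ℝ) : C(Icc 0 l, V) →L[ℂ] C(Icc 0 l, V) :=
  LinearMap.mkContinuous
    { toFun := fun y => ⟨fun t => ((Real.exp (c * t) : ℝ) : ℂ) • y t, by fun_prop⟩
      map_add' := fun y z => by ext t; simp
      map_smul' := fun d y => by ext t; simp [smul_comm d] }
    (Real.exp (|c| * |l|)) fun y => by
      rw [ContinuousMap.norm_le _ (by positivity)]
      intro t
      have h1 : c * t ≤ |c| * |l| := by
        calc c * t ≤ |c * t| := le_abs_self _
          _ = |c| * t := by rw [abs_mul, abs_of_nonneg t.2.1]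
          _ ≤ _ := by
            gcongr
            exact t.2.2.trans (le_abs_self l)
      calc ‖((Real.exp (c * t) : ℝ) : ℂ) • y t‖ = Real.exp (c * t) * ‖y t‖ := by
            rw [norm_smul, Complex.norm_real, Real.norm_of_nonneg (Real.exp_pos _).le]
        _ ≤ _ := by gcongr; exact y.norm_coe_le_norm t

theorem expMul_apply (c : ℝ) (y : C(Icc 0 l, V)) (t : Icc 0 l) :
    expMul l c y t = ((Real.exp (c * t) : ℝ) : ℂ) • y t := rfl

theorem expMul_mul_neg (c : ℝ) : (expMul l c * expMul l (-c) : C(Icc 0 l, V) →L[ℂ] _) = 1 := by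
  ext y t
  change ((Real.exp (c * t) : ℝ) : ℂ) • ((Real.exp (-c * t) : ℝ) : ℂ) • y t = y t
  rw [smul_smul, ← Complex.ofReal_mul, ← Real.exp_add]
  simp

/-- Conjugation with multiplication by `exp (c t)`, that is, passage to an exponentially weighted
sup norm, turns the Volterra operator into a contraction of norm at most `1/2`. The Neumann series
then inverts the conjugate, whatever the length of the interval. -/
theorem isUnit_one_sub_volterra [CompleteSpace V] (hl : 0 ≤ l) (A : ℝ → V →L[ℂ] V)
    (hA : Integrable A (volume.restrict (Ioo 0 l))) : IsUnit (1 - volterra hl A hA) := by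
  obtain ⟨c, hc, H⟩ := exists_exp_weight hl hA.norm
  set K := expMul l (-c) * volterra hl A hA * expMul l c
  have h1 : (expMul l c * expMul l (-c) : C(Icc 0 l, V) →L[ℂ] _) = 1 := expMul_mul_neg c
  have h2 : (expMul l (-c) * expMul l c : C(Icc 0 l, V) →L[ℂ] _) = 1 := by
    simpa using expMul_mul_neg (l := l) (V := V) (-c)
  have hK : ‖K‖ ≤ 1 / 2 := by
    refine ContinuousLinearMap.opNorm_le_bound _ (by norm_num) fun y => ?_
    rw [ContinuousMap.norm_le _ (by positivity)]
    intro t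
    have hit : IntervalIntegrable (fun s => ‖A s‖) volume 0 t :=
      (intervalIntegrable_of_Ioo hl hA).norm.mono_set (by
        rw [uIcc_of_le t.2.1, uIcc_of_le hl]; exact Icc_subset_Icc_right t.2.2)
    change ‖((Real.exp (-c * t) : ℝ) : ℂ) • ∫ s in (0 : ℝ)..t, A s (IccExtend hl (expMul l c y) s)‖ ≤ _
    rw [← intervalIntegral.integral_smul]
    calc ‖∫ s in (0 : ℝ)..t, ((Real.exp (-c * t) : ℝ) : ℂ) • A s (IccExtend hl (expMul l c y) s)‖
        ≤ ∫ s in (0 : ℝ)..t, (Real.exp (c * (s - t)) * ‖‖A s‖‖) * ‖y‖ := by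
          refine intervalIntegral.norm_integral_le_of_norm_le t.2.1
            (Filter.Eventually.of_forall fun s hs => ?_)
            ((hit.norm.continuousOn_mul (by fun_prop)).mul_const _)
          have hs' : s ∈ Icc 0 l := ⟨hs.1.le, hs.2.trans t.2.2⟩
          rw [IccExtend_of_mem hl _ hs', expMul_apply, norm_smul, Complex.norm_real,
            Real.norm_of_nonneg (Real.exp_pos _).le, map_smul, norm_smul, Complex.norm_real,
            Real.norm_of_nonneg (Real.exp_pos _).le, norm_norm, ← mul_assoc, ← Real.exp_add,
            mul_assoc]
          have : -c * t + c * s = c * (s - t) := by ring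
          rw [this]
          gcongr
          exact (A s).le_opNorm_of_le (y.norm_coe_le_norm _)
      _ = (∫ s in (0 : ℝ)..t, Real.exp (c * (s - t)) * ‖‖A s‖‖) * ‖y‖ :=
          intervalIntegral.integral_mul_const _ _
      _ ≤ 1 / 2 * ‖y‖ := by gcongr; exact H t t.2
  have hu : IsUnit (1 - K) := isUnit_one_sub_of_norm_lt_one (R := C(Icc 0 l, V) →L[ℂ] C(Icc 0 l, V)) (x := K)
    (hK.trans_lt (by norm_num))
  have he : 1 - volterra hl A hA = expMul l c * (1 - K) * expMul l (-c) := by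
    rw [mul_sub, sub_mul, mul_one, h1]
    congr 1
    calc volterra hl A hA = (expMul l c * expMul l (-c)) * volterra hl A hA
          * (expMul l c * expMul l (-c)) := by rw [h1, one_mul, mul_one]
      _ = _ := by simp only [K, mul_assoc]
  rw [he]
  exact ((Units.mk _ _ h1 h2).isUnit.mul hu).mul (Units.mk _ _ h2 h1).isUnit

end Volterra

namespace CanonicalSystem
variable {p : ℕ} (S : CanonicalSystem p)

/-! ## The initial value problem and the Lagrange identity -/

theorem J_mul_J : S.J * S.J = -1 := by
  have h := S.J_unitary
  rw [S.J_adjoint, neg_mul] at h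
  rw [← h, neg_neg]

theorem J_mulVec_J_mulVec (v : Fin p → ℂ) : S.J *ᵥ (S.J *ᵥ v) = -v := by
  rw [mulVec_mulVec, J_mul_J, neg_mulVec, one_mulVec]

theorem star_J_mulVec_dotProduct (u v : Fin p → ℂ) :
    star (S.J *ᵥ u) ⬝ᵥ v = -(star u ⬝ᵥ (S.J *ᵥ v)) := by
  rw [star_mulVec, S.J_adjoint, ← dotProduct_mulVec, neg_mulVec, dotProduct_neg]

/-- The coefficient `J (F - z H)` of the system written as `f' = J (F - z H) f - J r`. -/
def coeff (z : ℂ) (t : ℝ) : (Fin p → ℂ) →L[ℂ] (Fin p → ℂ) :=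
  LinearMap.toContinuousLinearMap (Matrix.toLin' (S.J * (S.F t - z • S.H t)))

theorem coeff_apply (z : ℂ) (t : ℝ) (v : Fin p → ℂ) :
    S.coeff z t v = S.J *ᵥ (S.F t *ᵥ v) - z • (S.J *ᵥ (S.H t *ᵥ v)) := by
  simp [coeff, Matrix.toLin'_apply, mulVec_sub, mulVec_smul]

/-- Expansion in matrix units reduces the claim to the entries, so that no norm on matrices is
involved. -/
theorem integrable_linearMap_comp {E : Type*} [NormedAddCommGroup E] [NormedSpace ℂ E]
    (Λ : Matrix (Fin p) (Fin p) ℂ →ₗ[ℂ] E) {μ : Measure ℝ} {M : ℝ → Matrix (Fin p) (Fin p) ℂ}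
    (hM : ∀ i k, Integrable (fun t => M t i k) μ) : Integrable (fun t => Λ (M t)) μ := by
  have h : (fun t => Λ (M t)) = fun t => ∑ i, ∑ k, M t i k • Λ (Matrix.single i k 1) := by
    ext1 t
    conv_lhs => rw [Matrix.matrix_eq_sum_single (M t)]
    simp only [map_sum]
    refine Finset.sum_congr rfl fun i _ => Finset.sum_congr rfl fun k _ => ?_
    rw [← map_smul, Matrix.smul_single]
    simp
  rw [h]
  exact integrable_finsetSum _ fun i _ => integrable_finsetSum _ fun k _ => (hM i k).smul_const _

theorem integrable_coeff (z : ℂ) : Integrable (S.coeff z) S.μ :=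
  integrable_linearMap_comp ((LinearMap.toContinuousLinearMap.toLinearMap).comp
      ((Matrix.toLin'.toLinearMap).comp (LinearMap.mulLeft ℂ S.J)))
    (M := fun t => S.F t - z • S.H t) fun i k => (S.F_integrable i k).sub ((S.H_integrable i k).const_mul z)

theorem integrable_mulVec_const (M : Matrix (Fin p) (Fin p) ℂ) {r : ℝ → Fin p → ℂ}
    (hr : Integrable r S.μ) : Integrable (fun t => M *ᵥ r t) S.μ :=
  (LinearMap.toContinuousLinearMap (Matrix.toLin' M)).integrable_comp hr

/-- Multiplication by `J` with `J² = -1` solves the equation for the derivative. -/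
theorem hasDerivAt_iff_of_eq (z : ℂ) (t : ℝ) (y d s : Fin p → ℂ) :
    S.J *ᵥ d + S.F t *ᵥ y = z • (S.H t *ᵥ y) + s ↔ d = S.coeff z t y - S.J *ᵥ s := by
  rw [coeff_apply]
  constructor
  · intro h
    have h1 := congrArg (S.J *ᵥ ·) h
    simp only [mulVec_add, J_mulVec_J_mulVec, mulVec_smul] at h1
    have h2 : d = S.J *ᵥ (S.F t *ᵥ y) - (-d + S.J *ᵥ (S.F t *ᵥ y)) := by abel
    rw [h1] at h2
    rw [h2]
    abel
  · rintro rfl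
    simp only [mulVec_sub, J_mulVec_J_mulVec, mulVec_smul]
    module

theorem integrable_coeff_apply (z : ℂ) {f : ℝ → Fin p → ℂ} (hf : ContinuousOn f (Icc 0 S.l)) :
    Integrable (fun t => S.coeff z t (f t)) S.μ := by
  have h : Continuous (IccExtend S.l_pos.le (domRestrict (Icc 0 S.l) f)) :=
    (continuousOn_iff_continuous_domRestrict.mp hf).Icc_extend'
  have h1 := intervalIntegrable_clm_apply S.l_pos.le (S.integrable_coeff z) h
    (right_mem_Icc.mpr S.l_pos.le)
  rw [intervalIntegrable_iff_integrableOn_Ioo_of_le S.l_pos.le] at h1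
  refine h1.congr ?_
  filter_upwards [ae_restrict_mem measurableSet_Ioo] with t ht
  rw [IccExtend_of_mem _ _ (Ioo_subset_Icc_self ht)]
  rfl

variable {S}

theorem Solves.continuousOn {f r : ℝ → Fin p → ℂ} (h : S.Solves f r) :
    ContinuousOn f (Icc 0 S.l) := by
  have := h.1.continuousOn
  rwa [uIcc_of_le S.l_pos.le] at this

theorem solves_congr {f r s : ℝ → Fin p → ℂ} (h : S.Solves f r) (hrs : r =ᵐ[S.μ] s) :
    S.Solves f s := by
  refine ⟨h.1, ?_⟩
  filter_upwards [h.2, hrs] with t ⟨d, hd, e⟩ ht using ⟨d, hd, e.trans ht⟩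

/-- The system as an integral equation. -/
theorem solves_iff {z : ℂ} {f r : ℝ → Fin p → ℂ} (hr : Integrable r S.μ) :
    S.Solves f (fun t => z • (S.H t *ᵥ f t) + r t) ↔ ContinuousOn f (Icc 0 S.l) ∧
      ∀ t ∈ Icc 0 S.l, f t = f 0 + ∫ s in (0 : ℝ)..t, (S.coeff z s (f s) - S.J *ᵥ r s) := by
  constructor
  · intro h
    refine ⟨h.continuousOn, fun t ht => ?_⟩
    refine eq_add_integral_of_absolutelyContinuous S.l_pos.le h.1
      ((S.integrable_coeff_apply z h.continuousOn).sub (S.integrable_mulVec_const S.J hr)) ?_ ht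
    filter_upwards [h.2] with t ⟨d, hd, e⟩
    rw [S.hasDerivAt_iff_of_eq] at e
    rwa [e] at hd
  · rintro ⟨hf, h⟩
    obtain ⟨h1, h2⟩ := absolutelyContinuous_of_eq_add_integral S.l_pos.le
      ((S.integrable_coeff_apply z hf).sub (S.integrable_mulVec_const S.J hr)) h
    refine ⟨h1, ?_⟩
    filter_upwards [h2] with t ht
    exact ⟨_, ht, (S.hasDerivAt_iff_of_eq _ _ _ _ _).mpr rfl⟩

variable (S)

/-- Existence of solutions of the initial value problem, with a bound. -/
theorem exists_solves (z : ℂ) : ∃ C : ℝ, 0 ≤ C ∧ ∀ (c : Fin p → ℂ) (r : ℝ → Fin p → ℂ),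
    Integrable r S.μ → ∀ B : ℝ, (∀ t ∈ Icc 0 S.l, ‖∫ s in (0 : ℝ)..t, S.J *ᵥ r s‖ ≤ B) →
    ∃ f, f 0 = c ∧ S.Solves f (fun t => z • (S.H t *ᵥ f t) + r t) ∧
      ∀ t ∈ Icc 0 S.l, ‖f t‖ ≤ C * (‖c‖ + B) := by
  have hl := S.l_pos.le
  obtain ⟨u, hu⟩ := isUnit_one_sub_volterra hl (S.coeff z) (S.integrable_coeff z)
  set R : C(Icc 0 S.l, Fin p → ℂ) →L[ℂ] C(Icc 0 S.l, Fin p → ℂ) := ↑u⁻¹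
  -- The forcing term enters the integral equation only through the primitive of `J r`. Bounding
  -- that primitive, and not `r`, is what later allows an estimate by the `L²_H` norm of `g` when `r
  -- = H g`.
  refine ⟨‖R‖, R.opNorm_nonneg, fun c r hr B hB => ?_⟩
  have hJr := intervalIntegrable_of_Ioo hl (S.integrable_mulVec_const S.J hr)
  let b : C(Icc 0 S.l, Fin p → ℂ) := ⟨fun t => c - ∫ s in (0 : ℝ)..t, S.J *ᵥ r s, by
    have h := intervalIntegral.continuousOn_primitive_interval' hJr left_mem_uIcc
    rw [uIcc_of_le hl] at h
    exact continuous_const.sub (continuousOn_iff_continuous_domRestrict.mp h)⟩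
  have hb : ‖b‖ ≤ ‖c‖ + B := by
    have hB0 : 0 ≤ B := (norm_nonneg _).trans (hB 0 (left_mem_Icc.mpr hl))
    rw [ContinuousMap.norm_le _ (by positivity)]
    exact fun t => (norm_sub_le _ _).trans (by gcongr; exact hB t t.2)
  set y := R b
  have hy : y = b + volterra hl (S.coeff z) (S.integrable_coeff z) y := by
    have h1 : (1 - volterra hl (S.coeff z) (S.integrable_coeff z)) (R b) = b := by
      rw [← hu, ← mul_apply_eq_comp, Units.mul_inv, one_apply_eq_self]
    rw [_root_.sub_apply, one_apply_eq_self] at h1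
    exact eq_add_of_sub_eq h1
  have hcont : Continuous (IccExtend hl y) := y.continuous.Icc_extend'
  have hyt : ∀ t ∈ Icc 0 S.l, IccExtend hl y t =
      c + ∫ s in (0 : ℝ)..t, (S.coeff z s (IccExtend hl y s) - S.J *ᵥ r s) := by
    intro t ht
    have h1 := congrArg (fun g : C(Icc 0 S.l, Fin p → ℂ) => g ⟨t, ht⟩) hy
    simp only [ContinuousMap.add_apply, volterra_apply] at h1
    rw [IccExtend_of_mem hl _ ht, h1, intervalIntegral.integral_sub
      (intervalIntegrable_clm_apply hl (S.integrable_coeff z) hcont ht)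
      (hJr.mono_set (by rw [uIcc_of_le ht.1, uIcc_of_le hl]; exact Icc_subset_Icc_right ht.2))]
    change c - _ + _ = _
    abel
  have h0 : IccExtend hl y 0 = c := by
    rw [hyt 0 (left_mem_Icc.mpr hl), intervalIntegral.integral_same, add_zero]
  refine ⟨IccExtend hl y, h0, (solves_iff hr).mpr ⟨hcont.continuousOn, fun t ht => ?_⟩,
    fun t ht => ?_⟩
  · rw [h0]
    exact hyt t ht
  · rw [IccExtend_of_mem hl _ ht]
    calc ‖y ⟨t, ht⟩‖ ≤ ‖y‖ := y.norm_coe_le_norm _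
      _ ≤ ‖R‖ * ‖b‖ := R.le_opNorm b
      _ ≤ _ := by gcongr

variable {S}

theorem Solves.add {f g r s : ℝ → Fin p → ℂ} (hf : S.Solves f r) (hg : S.Solves g s) :
    S.Solves (f + g) (r + s) := by
  refine ⟨hf.1.add hg.1, ?_⟩
  filter_upwards [hf.2, hg.2] with t ⟨d, hd, e⟩ ⟨d', hd', e'⟩
  refine ⟨d + d', hd.add hd', ?_⟩
  simp only [Pi.add_apply, mulVec_add]
  rw [← e, ← e']
  abel

theorem Solves.smul (c : ℂ) {f r : ℝ → Fin p → ℂ} (hf : S.Solves f r) :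
    S.Solves (c • f) (c • r) := by
  refine ⟨hf.1.const_smul c, ?_⟩
  filter_upwards [hf.2] with t ⟨d, hd, e⟩
  refine ⟨c • d, hd.const_smul c, ?_⟩
  simp only [Pi.smul_apply, mulVec_smul]
  rw [← e, smul_add]

/-- A solution of the homogeneous system with initial value zero vanishes. -/
theorem Solves.eq_zero {z : ℂ} {f : ℝ → Fin p → ℂ}
    (hf : S.Solves f fun t => z • (S.H t *ᵥ f t)) (h0 : f 0 = 0) : ∀ t ∈ Icc 0 S.l, f t = 0 := by
  have hl := S.l_pos.le
  have h1 : S.Solves f (fun t => z • (S.H t *ᵥ f t) + (0 : ℝ → Fin p → ℂ) t) := by simpa using hf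
  rw [solves_iff (integrable_zero _ _ _)] at h1
  obtain ⟨u, hu⟩ := isUnit_one_sub_volterra hl (S.coeff z) (S.integrable_coeff z)
  let y : C(Icc 0 S.l, Fin p → ℂ) :=
    ⟨domRestrict (Icc 0 S.l) f, continuousOn_iff_continuous_domRestrict.mp h1.1⟩
  -- With zero initial value the integral equation puts `f` in the kernel of the invertible
  -- operator.
  have hy : (1 - volterra hl (S.coeff z) (S.integrable_coeff z)) y = 0 := by
    rw [_root_.sub_apply, one_apply_eq_self, sub_eq_zero]
    ext1 t
    rw [volterra_apply]
    change f t = _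
    rw [h1.2 t t.2, h0, zero_add]
    refine intervalIntegral.integral_congr fun s hs => ?_
    rw [uIcc_of_le t.2.1] at hs
    have hs' : s ∈ Icc 0 S.l := ⟨hs.1, hs.2.trans t.2.2⟩
    simp only [Pi.zero_apply, mulVec_zero, sub_zero]
    rw [IccExtend_of_mem _ _ hs']
    rfl
  have hy0 : y = 0 := by
    have := congrArg (↑u⁻¹ : C(Icc 0 S.l, Fin p → ℂ) →L[ℂ] C(Icc 0 S.l, Fin p → ℂ)) hy
    rwa [← hu, ← mul_apply_eq_comp, Units.inv_mul, one_apply_eq_self,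
      map_zero] at this
  intro t ht
  exact congrArg (fun g : C(Icc 0 S.l, Fin p → ℂ) => g ⟨t, ht⟩) hy0

theorem Solves.apply {f r : ℝ → Fin p → ℂ} (h : S.Solves f r) (i : Fin p) :
    AbsolutelyContinuousOnInterval (fun t => f t i) 0 S.l := by
  have h1 := h.1
  rw [absolutelyContinuousOnInterval_iff] at h1 ⊢
  intro ε hε
  obtain ⟨δ, hδ, H⟩ := h1 ε hε
  refine ⟨δ, hδ, fun I hI hI' => lt_of_le_of_lt (Finset.sum_le_sum fun k _ => ?_) (H I hI hI')⟩
  exact dist_le_pi_dist _ _ i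

theorem absolutelyContinuousOnInterval_star {f : ℝ → ℂ} {a b : ℝ}
    (h : AbsolutelyContinuousOnInterval f a b) :
    AbsolutelyContinuousOnInterval (fun t => star (f t)) a b := by
  rw [absolutelyContinuousOnInterval_iff] at h ⊢
  simpa only [dist_star_star] using h

theorem absolutelyContinuousOnInterval_sum {ι : Type*} {F : Type*} [SeminormedAddCommGroup F]
    (s : Finset ι) {f : ι → ℝ → F} {a b : ℝ}
    (h : ∀ i ∈ s, AbsolutelyContinuousOnInterval (f i) a b) :
    AbsolutelyContinuousOnInterval (fun t => ∑ i ∈ s, f i t) a b := by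
  classical
  induction s using Finset.induction_on with
  | empty => simp [AbsolutelyContinuousOnInterval, tendsto_const_nhds]
  | insert i s hi ih =>
    simp only [Finset.sum_insert hi]
    exact (h i (Finset.mem_insert_self i s)).add
      (ih fun k hk => h k (Finset.mem_insert_of_mem hk))

theorem hasDerivAt_star_dotProduct {f h : ℝ → Fin p → ℂ} {d e : Fin p → ℂ} {t : ℝ}
    (hf : HasDerivAt f d t) (hh : HasDerivAt h e t) (M : Matrix (Fin p) (Fin p) ℂ) :
    HasDerivAt (fun t => star (h t) ⬝ᵥ (M *ᵥ f t)) (star e ⬝ᵥ (M *ᵥ f t) + star (h t) ⬝ᵥ (M *ᵥ d))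
      t := by
  simp only [dotProduct, mulVec, Pi.star_apply]
  rw [← Finset.sum_add_distrib]
  refine HasDerivAt.fun_sum fun i _ => ?_
  refine ((hasDerivAt_pi.mp hh i).star).mul ?_
  exact HasDerivAt.fun_sum fun k _ => (hasDerivAt_pi.mp hf k).const_mul (M i k)

theorem integrable_star_dotProduct {f r : ℝ → Fin p → ℂ} (hf : ContinuousOn f (Icc 0 S.l))
    (hr : Integrable r S.μ) : Integrable (fun t => star (f t) ⬝ᵥ r t) S.μ := by
  unfold dotProduct
  refine integrable_finsetSum _ fun i _ => ?_
  obtain ⟨C, hC⟩ := isCompact_Icc.exists_bound_of_continuousOn hf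
  have hfi : ContinuousOn (fun t => star (f t) i) (Icc 0 S.l) := by
    simp only [Pi.star_apply]
    fun_prop
  refine (hr.eval i).bdd_mul (c := C)
    ((hfi.mono Ioo_subset_Icc_self).aestronglyMeasurable measurableSet_Ioo) ?_
  filter_upwards [ae_restrict_mem measurableSet_Ioo] with t ht
  rw [Pi.star_apply, norm_star]
  exact (norm_le_pi_norm _ i).trans (hC t (Ioo_subset_Icc_self ht))

/-- The Lagrange identity. -/
theorem Solves.lagrange {f h r s : ℝ → Fin p → ℂ} (hf : S.Solves f r) (hh : S.Solves h s)
    (hr : Integrable r S.μ) (hs : Integrable s S.μ) :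
    (∫ t, star (h t) ⬝ᵥ r t ∂S.μ) - ∫ t, star (s t) ⬝ᵥ f t ∂S.μ =
      star (h S.l) ⬝ᵥ (S.J *ᵥ f S.l) - star (h 0) ⬝ᵥ (S.J *ᵥ f 0) := by
  have i1 := integrable_star_dotProduct hh.continuousOn hr
  have i2 : Integrable (fun t => star (s t) ⬝ᵥ f t) S.μ := by
    refine (Complex.conjCLE.toContinuousLinearMap.integrable_comp
      (integrable_star_dotProduct hf.continuousOn hs)).congr (Filter.Eventually.of_forall fun t => ?_)
    change star (star (f t) ⬝ᵥ s t) = _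
    rw [star_dotProduct, star_star]
  have hac : AbsolutelyContinuousOnInterval (fun t => star (h t) ⬝ᵥ (S.J *ᵥ f t)) 0 S.l := by
    simp only [dotProduct, mulVec, Pi.star_apply]
    refine absolutelyContinuousOnInterval_sum _ fun i _ =>
      (absolutelyContinuousOnInterval_star (hh.apply i)).smul
        (absolutelyContinuousOnInterval_sum _ fun k _ => ?_)
    simpa only [smul_eq_mul] using (hf.apply k).const_smul (S.J i k)
  -- In the derivative of `h^* J f` the terms with `F` cancel because `F` is Hermitian, and `J^* =
  -- -J` supplies the signs.
  have h1 := eq_add_integral_of_absolutelyContinuous S.l_pos.le hac (i1.sub i2) (by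
    filter_upwards [hf.2, hh.2, S.F_hermitian] with t ⟨d, hd, ed⟩ ⟨e, he, ee⟩ hF
    refine (hasDerivAt_star_dotProduct hd he S.J).congr_deriv ?_
    rw [Pi.sub_apply, ← ed, ← ee, dotProduct_add, star_add, add_dotProduct, star_J_mulVec_dotProduct,
      star_mulVec, hF.eq, ← dotProduct_mulVec]
    ring) (right_mem_Icc.mpr S.l_pos.le)
  rw [← integral_sub i1 i2]
  rw [h1, intervalIntegral.integral_of_le S.l_pos.le, integral_Ioc_eq_integral_Ioo]
  simp only [Pi.sub_apply]
  ring

end CanonicalSystem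

/-! ## Positive semidefinite matrix functions -/

/-- The regularized inverses `(H + ε)⁻¹ H` of a positive semidefinite matrix converge to a
right unit of `H`. -/
theorem exists_tendsto_regularized_inverse {n : Type*} [Fintype n] [DecidableEq n]
    {H : Matrix n n ℂ} (hH : H.PosSemidef) :
    ∃ P : Matrix n n ℂ, H * P = H ∧
      Filter.Tendsto (fun m : ℕ => (H + ((1 / (m + 1) : ℝ) : ℂ) • (1 : Matrix n n ℂ))⁻¹ * H)
        Filter.atTop (nhds P) := by
  set U : Matrix n n ℂ := (hH.isHermitian.eigenvectorUnitary : Matrix n n ℂ)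
  set e := hH.isHermitian.eigenvalues
  have he : ∀ i, 0 ≤ e i := hH.eigenvalues_nonneg
  have hU : star U * U = 1 := Unitary.coe_star_mul_self hH.isHermitian.eigenvectorUnitary
  have hU' : U * star U = 1 := Unitary.coe_mul_star_self hH.isHermitian.eigenvectorUnitary
  have hs : H = U * diagonal (fun i => (e i : ℂ)) * star U := by
    have h := hH.isHermitian.spectral_theorem
    rw [Unitary.conjStarAlgAut_apply] at h
    exact h
  have hmul : ∀ a b : n → ℂ, (U * diagonal a * star U) * (U * diagonal b * star U) =
      U * diagonal (fun i => a i * b i) * star U := fun a b => by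
    calc (U * diagonal a * star U) * (U * diagonal b * star U)
        = U * diagonal a * (star U * U) * diagonal b * star U := by simp only [mul_assoc]
      _ = _ := by rw [hU, mul_one, mul_assoc U, diagonal_mul_diagonal]
  have hadd : ∀ c : ℂ, H + c • (1 : Matrix n n ℂ) =
      U * diagonal (fun i => (e i : ℂ) + c) * star U := fun c => by
    have h1 : diagonal (fun i => (e i : ℂ) + c) =
        diagonal (fun i => (e i : ℂ)) + c • (1 : Matrix n n ℂ) := by
      rw [← diagonal_one, ← diagonal_smul, diagonal_add]
      simp
    rw [h1, mul_add, add_mul, ← hs, mul_smul_comm, smul_mul_assoc, mul_one, hU']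
  -- The limit is the spectral projection onto the orthogonal complement of the kernel: `e / (e +
  -- ε)` tends to `1` for `e > 0` and is `0` for `e = 0`.
  refine ⟨U * diagonal (fun i => if e i = 0 then 0 else 1) * star U, ?_, ?_⟩
  · conv_lhs => rw [hs]
    rw [hmul]
    conv_rhs => rw [hs]
    congr 3
    ext i
    by_cases h : e i = 0 <;> simp [h]
  · have hlim : ∀ m : ℕ, (H + ((1 / (m + 1) : ℝ) : ℂ) • (1 : Matrix n n ℂ))⁻¹ * H =
        U * diagonal (fun i => ((e i / (e i + 1 / (m + 1)) : ℝ) : ℂ)) * star U := fun m => by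
      have hpos : (0 : ℝ) < 1 / (m + 1) := by positivity
      have hne : ∀ i, ((e i : ℂ) + ((1 / (m + 1) : ℝ) : ℂ)) ≠ 0 := fun i => by
        rw [← Complex.ofReal_add]
        exact_mod_cast (add_pos_of_nonneg_of_pos (he i) hpos).ne'
      have hi : (H + ((1 / (m + 1) : ℝ) : ℂ) • (1 : Matrix n n ℂ))⁻¹ =
          U * diagonal (fun i => ((e i : ℂ) + ((1 / (m + 1) : ℝ) : ℂ))⁻¹) * star U := by
        refine Matrix.inv_eq_right_inv ?_
        rw [hadd, hmul]
        simp only [mul_inv_cancel₀ (hne _)]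
        rw [diagonal_one, mul_one, hU']
      rw [hi]
      conv_lhs => rw [hs]
      rw [hmul]
      congr 3
      ext i
      push_cast
      exact (div_eq_inv_mul _ _).symm
    simp only [hlim]
    have hd : Filter.Tendsto (fun m : ℕ => fun i => ((e i / (e i + 1 / (m + 1)) : ℝ) : ℂ))
        Filter.atTop (nhds fun i => if e i = 0 then (0 : ℂ) else 1) := by
      rw [tendsto_pi_nhds]
      intro i
      by_cases h : e i = 0
      · simp [h]
      · have h1 := (tendsto_one_div_add_atTop_nhds_zero_nat (𝕜 := ℝ)).const_add (e i)
        rw [add_zero] at h1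
        have h2 := (tendsto_const_nhds (x := e i)).div h1 h
        rw [div_self h] at h2
        simp only [if_neg h]
        rw [← Complex.ofReal_one]
        exact (Complex.continuous_ofReal.tendsto _).comp h2
    have hc : Continuous fun a : n → ℂ => U * diagonal a * star U := by fun_prop
    exact (hc.tendsto _).comp hd

theorem aestronglyMeasurable_matrix {α m n : Type*} [MeasurableSpace α] {μ : Measure α}
    [Fintype m] [Fintype n] [DecidableEq m] [DecidableEq n]
    {M : α → Matrix m n ℂ} (hM : ∀ i k, AEStronglyMeasurable (fun t => M t i k) μ) :
    AEStronglyMeasurable M μ := by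
  have h : M = fun t => ∑ i, ∑ k, M t i k • Matrix.single i k (1 : ℂ) := by
    ext1 t
    conv_lhs => rw [Matrix.matrix_eq_sum_single (M t)]
    simp
  rw [h]
  exact Finset.aestronglyMeasurable_fun_sum _ fun i _ =>
    Finset.aestronglyMeasurable_fun_sum _ fun k _ => (hM i k).smul_const _

theorem aestronglyMeasurable_matrix_inv {α n : Type*} [MeasurableSpace α] {μ : Measure α}
    [Fintype n] [DecidableEq n] {M : α → Matrix n n ℂ} (hM : AEStronglyMeasurable M μ) :
    AEStronglyMeasurable (fun t => (M t)⁻¹) μ := by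
  simp only [Matrix.inv_def, Ring.inverse_eq_inv']
  have h1 : AEStronglyMeasurable (fun t => (M t).det) μ :=
    (continuous_id.matrix_det).comp_aestronglyMeasurable hM
  have h2 : AEStronglyMeasurable (fun t => (M t).adjugate) μ :=
    (continuous_id.matrix_adjugate).comp_aestronglyMeasurable hM
  exact h1.inv₀.smul h2

theorem aestronglyMeasurable_mulVec {α n : Type*} [MeasurableSpace α] {μ : Measure α}
    [Fintype n] {M : α → Matrix n n ℂ} {f : α → n → ℂ}
    (hM : AEStronglyMeasurable M μ) (hf : AEStronglyMeasurable f μ) :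
    AEStronglyMeasurable (fun t => M t *ᵥ f t) μ := by
  have hc : Continuous fun x : Matrix n n ℂ × (n → ℂ) => x.1 *ᵥ x.2 :=
    continuous_fst.matrix_mulVec continuous_snd
  exact hc.comp_aestronglyMeasurable (hM.prodMk hf)

/-- A measurable selection: if `w` takes values in the range of the positive semidefinite `H`, then
`w = H g` with a measurable `g`. -/
theorem exists_measurable_mulVec_eq {α n : Type*} [MeasurableSpace α] {μ : Measure α}
    [Fintype n] [DecidableEq n] {H : α → Matrix n n ℂ} {w : α → n → ℂ}
    (hH : AEStronglyMeasurable H μ) (hw : AEStronglyMeasurable w μ)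
    (hp : ∀ᵐ t ∂μ, (H t).PosSemidef) (hr : ∀ᵐ t ∂μ, ∃ x, w t = H t *ᵥ x) :
    ∃ g : α → n → ℂ, AEStronglyMeasurable g μ ∧ ∀ᵐ t ∂μ, w t = H t *ᵥ g t := by
  -- The regularized inverses depend measurably on `H`, and applied to `w = H x` they converge
  -- pointwise. The limit is thus a measurable preimage, although `x` itself was chosen pointwise
  -- without measurability.
  let a : ℕ → α → n → ℂ := fun m t =>
    (H t + ((1 / (m + 1) : ℝ) : ℂ) • (1 : Matrix n n ℂ))⁻¹ *ᵥ w t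
  have hlim : ∀ᵐ t ∂μ, ∃ y, w t = H t *ᵥ y ∧
      Filter.Tendsto (fun m => a m t) Filter.atTop (nhds y) := by
    filter_upwards [hp, hr] with t ht ⟨x, hx⟩
    obtain ⟨P, hP, hP'⟩ := exists_tendsto_regularized_inverse ht
    refine ⟨P *ᵥ x, by rw [mulVec_mulVec, hP, hx], ?_⟩
    have hc : Continuous fun M : Matrix n n ℂ => M *ᵥ x := by fun_prop
    refine ((hc.tendsto _).comp hP').congr fun m => ?_
    simp only [Function.comp_apply, a, hx, mulVec_mulVec]
  refine ⟨fun t => Filter.limUnder Filter.atTop fun m => a m t, ?_, ?_⟩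
  · refine aestronglyMeasurable_of_tendsto_ae Filter.atTop (f := a) (fun m => ?_) ?_
    · exact aestronglyMeasurable_mulVec
        (aestronglyMeasurable_matrix_inv (hH.add aestronglyMeasurable_const)) hw
    · filter_upwards [hlim] with t ⟨y, _, hy⟩ using tendsto_nhds_limUnder ⟨y, hy⟩
  · filter_upwards [hlim] with t ⟨y, h, hy⟩
    rw [hy.limUnder_eq, h]

open scoped MatrixOrder in
/-- A measurable square root of a positive semidefinite matrix function. -/
theorem exists_measurable_sqrt {α n : Type*} [MeasurableSpace α] {μ : Measure α}
    [Fintype n] [DecidableEq n] {H : α → Matrix n n ℂ}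
    (hH : AEStronglyMeasurable H μ) (hp : ∀ᵐ t ∂μ, (H t).PosSemidef) :
    ∃ R : α → Matrix n n ℂ, AEStronglyMeasurable R μ ∧
      ∀ᵐ t ∂μ, (R t).PosSemidef ∧ R t * R t = H t := by
  -- The square root is continuous only on positive matrices, whereas `H` is positive only almost
  -- everywhere. The map `A ↦ √√(A^* A)` is continuous on all matrices and equals `√A` for positive
  -- `A`, so composition with `H` is measurable.
  have hc : Continuous fun A : Matrix n n ℂ => CFC.sqrt (CFC.sqrt (star A * A)) := by
    open scoped Matrix.Norms.L2Operator in
    have h : ContinuousOn (CFC.sqrt : Matrix n n ℂ → _) {a | 0 ≤ a} := CFC.continuousOn_sqrt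
    exact h.comp_continuous (h.comp_continuous (by fun_prop) fun A => star_mul_self_nonneg A)
      fun A => by exact CFC.sqrt_nonneg (star A * A)
  refine ⟨_, hc.comp_aestronglyMeasurable hH, ?_⟩
  filter_upwards [hp] with t ht
  refine ⟨Matrix.nonneg_iff_posSemidef.mp (CFC.sqrt_nonneg _), ?_⟩
  rw [CFC.sqrt_mul_sqrt_self _ (CFC.sqrt_nonneg _)]
  have h1 : star (H t) = H t := ht.isHermitian
  rw [h1]
  exact CFC.sqrt_mul_self _ (Matrix.nonneg_iff_posSemidef.mpr ht)

namespace CanonicalSystem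
variable {p : ℕ} (S : CanonicalSystem p)

/-! ## The space `L²_H(0, l)` -/

theorem aestronglyMeasurable_H : AEStronglyMeasurable S.H S.μ :=
  aestronglyMeasurable_matrix fun i k => (S.H_integrable i k).aestronglyMeasurable

variable {S}

/-- A square integrable function as an element of `Pre`. -/
def toPre {f : ℝ → Fin p → ℂ} (hf : f ∈ S.square) : S.Pre := ⟨f, hf⟩

theorem toL2_of_mem {f : ℝ → Fin p → ℂ} (hf : f ∈ S.square) :
    S.toL2 f = SeparationQuotient.mk (toPre hf) := dif_pos hf

theorem inner_toL2 {f g : ℝ → Fin p → ℂ} (hf : f ∈ S.square) (hg : g ∈ S.square) :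
    inner ℂ (S.toL2 g) (S.toL2 f) = ∫ t, S.form g f t ∂S.μ := by
  rw [toL2_of_mem hf, toL2_of_mem hg, SeparationQuotient.inner_mk_mk]
  rfl

theorem exists_toL2 (x : S.L2) : ∃ f ∈ S.square, x = S.toL2 f := by
  obtain ⟨f, rfl⟩ := SeparationQuotient.surjective_mk x
  exact ⟨f.1, f.2, (toL2_of_mem f.2).symm⟩

theorem toL2_sub {f g : ℝ → Fin p → ℂ} (hf : f ∈ S.square) (hg : g ∈ S.square) :
    S.toL2 (f - g) = S.toL2 f - S.toL2 g := by
  have h : f - g = f + (-1 : ℂ) • g := by simp [sub_eq_add_neg]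
  rw [h, S.toL2_add hf (S.square.smul_mem _ hg), S.toL2_smul _ hg]
  simp [sub_eq_add_neg]

/-- A nonnegative integrand with integral zero vanishes almost everywhere, and `f^* H f = 0` forces
`H f = 0` because `H` is positive semidefinite. -/
theorem toL2_eq_zero_iff {f : ℝ → Fin p → ℂ} (hf : f ∈ S.square) :
    S.toL2 f = 0 ↔ ∀ᵐ t ∂S.μ, S.H t *ᵥ f t = 0 := by
  rw [← inner_self_eq_zero (𝕜 := ℂ), inner_toL2 hf hf]
  constructor
  · intro h
    have hre : ∫ t, (S.form f f t).re ∂S.μ = 0 := by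
      have h1 : ∫ t, (S.form f f t).re ∂S.μ = (∫ t, S.form f f t ∂S.μ).re := integral_re hf.2
      rw [h1, h, Complex.zero_re]
    have hi : Integrable (fun t => (S.form f f t).re) S.μ := hf.2.re
    rw [integral_eq_zero_iff_of_nonneg_ae _ hi] at hre
    · filter_upwards [hre, S.form_self_nonneg f, S.H_posSemidef] with t h1 h2 h3
      rw [← h3.dotProduct_mulVec_zero_iff]
      exact Complex.ext h1 (Complex.nonneg_iff.mp h2).2.symm
    · filter_upwards [S.form_self_nonneg f] with t ht using (Complex.nonneg_iff.mp ht).1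
  · intro h
    rw [← integral_zero ℝ ℂ (μ := S.μ)]
    refine integral_congr_ae ?_
    filter_upwards [h] with t ht
    simp [form, ht]

theorem toL2_eq_iff {f g : ℝ → Fin p → ℂ} (hf : f ∈ S.square) (hg : g ∈ S.square) :
    S.toL2 f = S.toL2 g ↔ ∀ᵐ t ∂S.μ, S.H t *ᵥ f t = S.H t *ᵥ g t := by
  rw [← sub_eq_zero, ← toL2_sub hf hg, toL2_eq_zero_iff (S.square.sub_mem hf hg)]
  simp only [Pi.sub_apply, mulVec_sub, sub_eq_zero]

variable (S)

/-- With `R = √H`, the map `f ↦ R f` is isometric into the complete space of ordinary square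
integrable `ℂ^p`-valued functions. Its range is closed: a subsequence converges almost everywhere,
the limit lies pointwise in the finite-dimensional, hence closed, range of `R t`, and a measurable
preimage under `R` can be selected. -/
instance : CompleteSpace S.Pre := by
  obtain ⟨R, hR, hRH⟩ := exists_measurable_sqrt S.aestronglyMeasurable_H S.H_posSemidef
  have hform : ∀ᵐ t ∂S.μ, ∀ x y : Fin p → ℂ,
      star (R t *ᵥ x) ⬝ᵥ (R t *ᵥ y) = star x ⬝ᵥ (S.H t *ᵥ y) := by
    filter_upwards [hRH] with t ht x y
    rw [star_mulVec, ht.1.isHermitian.eq, ← dotProduct_mulVec, mulVec_mulVec, ht.2]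
  have hnorm : ∀ v : Fin p → ℂ, ‖WithLp.toLp 2 v‖ ^ 2 = (star v ⬝ᵥ v).re := fun v => by
    rw [← @inner_self_eq_norm_sq ℂ, EuclideanSpace.inner_eq_star_dotProduct, dotProduct_comm]
    rfl
  have hcont : Continuous (WithLp.toLp 2 : (Fin p → ℂ) → EuclideanSpace ℂ (Fin p)) :=
    PiLp.continuous_toLp 2 _
  have hmem : ∀ f ∈ S.square,
      MemLp (fun t => (WithLp.toLp 2 (R t *ᵥ f t) : EuclideanSpace ℂ (Fin p))) 2 S.μ := by
    intro f hf
    rw [memLp_two_iff_integrable_sq_norm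
      (hcont.comp_aestronglyMeasurable (aestronglyMeasurable_mulVec hR hf.1))]
    refine hf.2.re.congr ?_
    filter_upwards [hform] with t ht
    rw [hnorm, ht]
    rfl
  let Φ₀ : S.Pre →ₗ[ℂ] Lp (EuclideanSpace ℂ (Fin p)) 2 S.μ :=
    { toFun := fun f => (hmem f.1 f.2).toLp _
      map_add' := fun f g => by
        rw [← MemLp.toLp_add]
        refine MemLp.toLp_congr _ _ (Filter.Eventually.of_forall fun t => ?_)
        change WithLp.toLp 2 (R t *ᵥ (f.1 t + g.1 t)) = _
        rw [mulVec_add]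
        rfl
      map_smul' := fun c f => by
        rw [RingHom.id_apply, ← MemLp.toLp_const_smul]
        refine MemLp.toLp_congr _ _ (Filter.Eventually.of_forall fun t => ?_)
        change WithLp.toLp 2 (R t *ᵥ (c • f.1 t)) = _
        rw [mulVec_smul]
        rfl }
  have hΦ : ∀ f : S.Pre, ∀ᵐ t ∂S.μ, Φ₀ f t = WithLp.toLp 2 (R t *ᵥ f.1 t) := fun f =>
    (hmem f.1 f.2).coeFn_toLp
  let Φ : S.Pre →ₗᵢ[ℂ] Lp (EuclideanSpace ℂ (Fin p)) 2 S.μ := Φ₀.isometryOfInner fun f g => by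
    rw [MeasureTheory.L2.inner_def]
    change _ = ∫ t, S.form f.1 g.1 t ∂S.μ
    refine integral_congr_ae ?_
    filter_upwards [hΦ f, hΦ g, hform] with t h1 h2 h3
    rw [h1, h2, EuclideanSpace.inner_eq_star_dotProduct, dotProduct_comm]
    exact h3 _ _
  refine Metric.complete_of_cauchySeq_tendsto fun u hu => ?_
  obtain ⟨G, hG⟩ := cauchySeq_tendsto_of_complete (u := Φ ∘ u)
    (Φ.isometry.uniformContinuous.comp_cauchySeq hu)
  obtain ⟨ns, -, hns⟩ := (tendstoInMeasure_of_tendsto_Lp hG).exists_seq_tendsto_ae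
  have hGm : AEStronglyMeasurable (fun t => (G t).ofLp) S.μ :=
    (PiLp.continuous_ofLp 2 _).comp_aestronglyMeasurable (Lp.aestronglyMeasurable G)
  have hex : ∀ᵐ t ∂S.μ, ∃ x, (G t).ofLp = R t *ᵥ x := by
    filter_upwards [hns, ae_all_iff.mpr fun n => hΦ (u (ns n))] with t h1 h2
    have hcl := (LinearMap.range (Matrix.mulVecLin (R t))).closed_of_finiteDimensional
    have h3 := ((PiLp.continuous_ofLp 2 fun _ : Fin p => ℂ).tendsto _).comp h1
    obtain ⟨x, hx⟩ := hcl.mem_of_tendsto h3 (Filter.Eventually.of_forall fun n => by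
      change (Φ₀ (u (ns n)) t).ofLp ∈ _
      rw [h2 n]
      exact ⟨_, rfl⟩)
    exact ⟨x, hx.symm⟩
  obtain ⟨g, hg, hGg⟩ := exists_measurable_mulVec_eq hR hGm (hRH.mono fun t ht => ht.1) hex
  have hgs : g ∈ S.square := by
    refine ⟨hg, ⟨S.form_aestronglyMeasurable hg hg, ?_⟩⟩
    have h1 := (memLp_two_iff_integrable_sq_norm (Lp.aestronglyMeasurable G)).mp (Lp.memLp G)
    refine h1.2.congr' ?_
    filter_upwards [hform, hGg, S.form_self_nonneg g] with t h2 h3 h4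
    have h5 : S.form g g t = ((‖G t‖ ^ 2 : ℝ) : ℂ) := by
      have h6 : ‖G t‖ ^ 2 = (S.form g g t).re := by
        have := hnorm (G t).ofLp
        rw [WithLp.toLp_ofLp] at this
        rw [this, h3, h2]
        rfl
      rw [h6]
      exact Complex.ext rfl (Complex.nonneg_iff.mp h4).2.symm
    rw [h5, Complex.norm_real]
  refine ⟨toPre hgs, ?_⟩
  have hΦg : Φ (toPre hgs) = G := by
    refine Lp.ext ?_
    filter_upwards [hΦ (toPre hgs), hGg] with t h1 h2
    change Φ₀ _ t = _
    rw [h1]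
    change WithLp.toLp 2 (R t *ᵥ g t) = _
    rw [← h2]
  rw [← hΦg] at hG
  exact Φ.isometry.isUniformInducing.isInducing.tendsto_nhds_iff.mpr hG

instance : CompleteSpace S.L2 := SeparationQuotient.instCompleteSpace

end CanonicalSystem

namespace CanonicalSystem
variable {p : ℕ} (S : CanonicalSystem p)

/-! ## Estimates in `L²_H(0, l)` -/

/-- The sum of the absolute values of the entries of `H t`. -/
def weight (t : ℝ) : ℝ := ∑ i, ∑ k, ‖S.H t i k‖

theorem integrable_weight : Integrable S.weight S.μ :=
  integrable_finsetSum _ fun i _ => integrable_finsetSum _ fun k _ => (S.H_integrable i k).norm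

theorem norm_form_le (g f : ℝ → Fin p → ℂ) (t : ℝ) :
    ‖S.form g f t‖ ≤ S.weight t * (‖g t‖ * ‖f t‖) := by
  unfold form weight dotProduct mulVec dotProduct
  refine (norm_sum_le _ _).trans ?_
  rw [Finset.sum_mul]
  refine Finset.sum_le_sum fun i _ => ?_
  rw [norm_mul, Pi.star_apply, norm_star, Finset.sum_mul]
  refine (mul_le_mul_of_nonneg_left (norm_sum_le _ _) (norm_nonneg _)).trans ?_
  rw [Finset.mul_sum]
  refine Finset.sum_le_sum fun k _ => ?_
  rw [norm_mul]
  calc ‖g t i‖ * (‖S.H t i k‖ * ‖f t k‖) = ‖S.H t i k‖ * (‖g t i‖ * ‖f t k‖) := by ring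
    _ ≤ _ := by
      gcongr
      · exact norm_le_pi_norm _ i
      · exact norm_le_pi_norm _ k

variable {S}

theorem mem_square_of_bounded {f : ℝ → Fin p → ℂ} {C : ℝ} (hf : AEStronglyMeasurable f S.μ)
    (hC : ∀ᵐ t ∂S.μ, ‖f t‖ ≤ C) : f ∈ S.square := by
  refine ⟨hf, (S.integrable_weight.mul_const (C * C)).mono' (S.form_aestronglyMeasurable hf hf) ?_⟩
  filter_upwards [hC] with t ht
  refine (S.norm_form_le f f t).trans ?_
  have : 0 ≤ S.weight t := Finset.sum_nonneg fun i _ => Finset.sum_nonneg fun k _ => norm_nonneg _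
  have := (norm_nonneg _).trans ht
  gcongr

variable (S) in
/-- The norm of the embedding of the bounded functions. -/
def embedConst : ℝ := Real.sqrt (∫ t, S.weight t ∂S.μ)

theorem norm_toL2_le {f : ℝ → Fin p → ℂ} {C : ℝ} (h0 : 0 ≤ C) (hf : AEStronglyMeasurable f S.μ)
    (hC : ∀ᵐ t ∂S.μ, ‖f t‖ ≤ C) : ‖S.toL2 f‖ ≤ S.embedConst * C := by
  have hm := mem_square_of_bounded hf hC
  have h1 : ‖S.toL2 f‖ ^ 2 ≤ (∫ t, S.weight t ∂S.μ) * (C * C) := by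
    have h2 : ‖S.toL2 f‖ ^ 2 = ‖inner ℂ (S.toL2 f) (S.toL2 f)‖ := by
      rw [inner_self_eq_norm_sq_to_K, norm_pow, RCLike.norm_ofReal, abs_norm]
    rw [h2, inner_toL2 hm hm, ← integral_mul_const]
    refine norm_integral_le_of_norm_le (S.integrable_weight.mul_const _) ?_
    filter_upwards [hC] with t ht
    refine (S.norm_form_le f f t).trans ?_
    have : 0 ≤ S.weight t := Finset.sum_nonneg fun i _ => Finset.sum_nonneg fun k _ => norm_nonneg _
    gcongr
  rw [embedConst, ← Real.sqrt_sq (norm_nonneg (S.toL2 f)), ← Real.sqrt_mul_self h0,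
    ← Real.sqrt_mul' _ (mul_self_nonneg C)]
  exact Real.sqrt_le_sqrt h1

theorem aestronglyMeasurable_of_continuousOn {f : ℝ → Fin p → ℂ} (hf : ContinuousOn f (Icc 0 S.l)) : AEStronglyMeasurable f S.μ :=
  (hf.mono Ioo_subset_Icc_self).aestronglyMeasurable measurableSet_Ioo

theorem mem_square_of_continuousOn {f : ℝ → Fin p → ℂ} (hf : ContinuousOn f (Icc 0 S.l)) :
    f ∈ S.square := by
  obtain ⟨C, hC⟩ := isCompact_Icc.exists_bound_of_continuousOn hf
  refine mem_square_of_bounded (aestronglyMeasurable_of_continuousOn hf) (C := C) ?_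
  filter_upwards [ae_restrict_mem measurableSet_Ioo] with t ht
  exact hC t (Ioo_subset_Icc_self ht)

theorem mulVec_apply_eq_form (g : ℝ → Fin p → ℂ) (i : Fin p) (t : ℝ) :
    (S.H t *ᵥ g t) i = S.form (fun _ => Pi.single i 1) g t := by
  unfold form
  simp

theorem integrable_H_mulVec {g : ℝ → Fin p → ℂ} (hg : g ∈ S.square) :
    Integrable (fun t => S.H t *ᵥ g t) S.μ := by
  refine Integrable.of_eval fun i => ?_
  simp only [mulVec_apply_eq_form]
  exact S.integrable_form hg (mem_square_of_continuousOn continuousOn_const)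

/-- Each component of the integral is the inner product of `g` with a coordinate vector times the
indicator of `(0, t)`, and the Cauchy–Schwarz inequality applies. -/
theorem norm_integral_H_mulVec_le {g : ℝ → Fin p → ℂ} (hg : g ∈ S.square) {t : ℝ}
    (ht : t ∈ Icc 0 S.l) : ‖∫ s in (0 : ℝ)..t, S.H s *ᵥ g s‖ ≤ S.embedConst * ‖S.toL2 g‖ := by
  have hi := intervalIntegrable_of_Ioo S.l_pos.le (integrable_H_mulVec hg)
  have hi' : IntervalIntegrable (fun s => S.H s *ᵥ g s) volume 0 t := hi.mono_set (by
    rw [uIcc_of_le ht.1, uIcc_of_le S.l_pos.le]; exact Icc_subset_Icc_right ht.2)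
  have hE : 0 ≤ S.embedConst := Real.sqrt_nonneg _
  rw [pi_norm_le_iff_of_nonneg (by positivity)]
  intro i
  have h1 : (∫ s in (0 : ℝ)..t, S.H s *ᵥ g s) i = ∫ s in (0 : ℝ)..t, (S.H s *ᵥ g s) i :=
    ((ContinuousLinearMap.proj (R := ℂ) (φ := fun _ : Fin p => ℂ) i).intervalIntegral_comp_comm
      hi').symm
  let e : ℝ → Fin p → ℂ := indicator (Ioo 0 t) fun _ => Pi.single i 1
  have hem : AEStronglyMeasurable e S.μ :=
    aestronglyMeasurable_const.indicator measurableSet_Ioo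
  have heb : ∀ᵐ s ∂S.μ, ‖e s‖ ≤ 1 := Filter.Eventually.of_forall fun s => by
    refine (norm_indicator_le_norm_self _ _).trans ?_
    rw [pi_norm_le_iff_of_nonneg zero_le_one]
    intro k
    by_cases h : k = i
    · subst h; simp
    · simp [h]
  have he := mem_square_of_bounded hem heb
  have h2 : ∫ s in (0 : ℝ)..t, (S.H s *ᵥ g s) i = inner ℂ (S.toL2 e) (S.toL2 g) := by
    rw [inner_toL2 hg he, intervalIntegral.integral_of_le ht.1, integral_Ioc_eq_integral_Ioo]
    have h3 : ∀ s, S.form e g s = indicator (Ioo 0 t) (fun s => (S.H s *ᵥ g s) i) s := fun s => by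
      by_cases h : s ∈ Ioo 0 t
      · rw [indicator_of_mem h, mulVec_apply_eq_form]
        simp [form, e, indicator_of_mem h]
      · simp [form, e, indicator_of_notMem h]
    simp only [h3]
    rw [setIntegral_indicator measurableSet_Ioo, inter_eq_self_of_subset_right
      (Ioo_subset_Ioo_right ht.2)]
  rw [h1, h2]
  refine (norm_inner_le_norm _ _).trans ?_
  have := norm_toL2_le zero_le_one hem heb
  rw [mul_one] at this
  gcongr

/-! ## The maximal relation -/

/-- The first entry needs no integrability hypothesis: solutions are continuous on `[0, l]` and `H`
is integrable. Writing the second entry as `z f + g` makes `g` the free forcing term. -/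
theorem maxPair_iff {z : ℂ} {f g : ℝ → Fin p → ℂ} (hg : g ∈ S.square) :
    S.MaxPair f (z • f + g) ↔ S.Solves f fun t => z • (S.H t *ᵥ f t) + S.H t *ᵥ g t := by
  have h1 : (fun t => S.H t *ᵥ (z • f + g) t) = fun t => z • (S.H t *ᵥ f t) + S.H t *ᵥ g t := by
    ext1 t
    simp [mulVec_add, mulVec_smul]
  constructor
  · intro h
    have := h.2.2
    rwa [h1] at this
  · intro h
    have hf := mem_square_of_continuousOn h.continuousOn
    exact ⟨hf, S.square.add_mem (S.square.smul_mem z hf) hg, by rwa [h1]⟩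

variable (S) in
theorem exists_maxPair (z : ℂ) : ∃ C : ℝ, 0 ≤ C ∧ ∀ (c : Fin p → ℂ), ∀ g ∈ S.square,
    ∃ f, f 0 = c ∧ S.MaxPair f (z • f + g) ∧ ‖S.toL2 f‖ ≤ C * (‖c‖ + ‖S.toL2 g‖) := by
  obtain ⟨C, hC, H⟩ := S.exists_solves z
  let Jc : (Fin p → ℂ) →L[ℂ] (Fin p → ℂ) := LinearMap.toContinuousLinearMap (Matrix.toLin' S.J)
  set D := ‖Jc‖ * S.embedConst with hDdef
  have hE : 0 ≤ S.embedConst := Real.sqrt_nonneg _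
  have hD : 0 ≤ D := mul_nonneg Jc.opNorm_nonneg hE
  refine ⟨S.embedConst * C * (1 + D), by positivity, fun c g hg => ?_⟩
  obtain ⟨f, hf0, hf, hfb⟩ := H c _ (integrable_H_mulVec hg) (D * ‖S.toL2 g‖) (fun t ht => by
    have hi := intervalIntegrable_of_Ioo S.l_pos.le (integrable_H_mulVec hg)
    have hi' : IntervalIntegrable (fun s => S.H s *ᵥ g s) volume 0 t := hi.mono_set (by
      rw [uIcc_of_le ht.1, uIcc_of_le S.l_pos.le]; exact Icc_subset_Icc_right ht.2)
    have h1 : ∫ s in (0 : ℝ)..t, S.J *ᵥ (S.H s *ᵥ g s) = Jc (∫ s in (0 : ℝ)..t, S.H s *ᵥ g s) :=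
      Jc.intervalIntegral_comp_comm hi'
    rw [h1, hDdef, mul_assoc]
    exact Jc.le_opNorm_of_le (norm_integral_H_mulVec_le hg ht))
  refine ⟨f, hf0, (maxPair_iff hg).mpr hf, ?_⟩
  refine (norm_toL2_le (C := C * (‖c‖ + D * ‖S.toL2 g‖)) (by positivity)
    (aestronglyMeasurable_of_continuousOn hf.continuousOn) ?_).trans ?_
  · filter_upwards [ae_restrict_mem measurableSet_Ioo] with t ht
    exact hfb t (Ioo_subset_Icc_self ht)
  · have h1 : ‖c‖ + D * ‖S.toL2 g‖ ≤ (1 + D) * (‖c‖ + ‖S.toL2 g‖) := by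
      nlinarith [norm_nonneg c, norm_nonneg (S.toL2 g), mul_nonneg hD (norm_nonneg c)]
    calc S.embedConst * (C * (‖c‖ + D * ‖S.toL2 g‖))
        ≤ S.embedConst * (C * ((1 + D) * (‖c‖ + ‖S.toL2 g‖))) := by gcongr
      _ = _ := by ring

theorem MaxPair.continuousOn {f g : ℝ → Fin p → ℂ} (h : S.MaxPair f g) :
    ContinuousOn f (Icc 0 S.l) := h.2.2.continuousOn

theorem MaxPair.sub {f g f' g' : ℝ → Fin p → ℂ} (h : S.MaxPair f g) (h' : S.MaxPair f' g') :
    S.MaxPair (f - f') (g - g') := by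
  have h1 := h.add S (h'.smul S (-1))
  simpa only [neg_smul, one_smul, ← sub_eq_add_neg] using h1

/-- A function in the domain of the maximal relation is determined by its initial value and by
the class of `g - z f`. -/
theorem MaxPair.eqOn {z : ℂ} {f g f' g' : ℝ → Fin p → ℂ} (h : S.MaxPair f g) (h' : S.MaxPair f' g')
    (h0 : f 0 = f' 0) (he : S.toL2 g - z • S.toL2 f = S.toL2 g' - z • S.toL2 f') :
    ∀ t ∈ Icc 0 S.l, f t = f' t := by
  have h1 := h.sub h'
  have h2 : S.Solves (f - f') fun t => z • (S.H t *ᵥ (f - f') t) := by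
    refine solves_congr h1.2.2 ?_
    have h3 : S.toL2 (g - g') = S.toL2 (z • (f - f')) := by
      rw [toL2_sub h.2.1 h'.2.1, S.toL2_smul _ h1.1, toL2_sub h.1 h'.1, smul_sub]
      rw [sub_eq_sub_iff_sub_eq_sub] at he
      exact he
    filter_upwards [(toL2_eq_iff h1.2.1 (S.square.smul_mem z h1.1)).mp h3] with t ht
    rw [ht, Pi.smul_apply, mulVec_smul]
  intro t ht
  have := h2.eq_zero (by simp [h0]) t ht
  rwa [Pi.sub_apply, sub_eq_zero] at this

theorem toL2_congr {f g : ℝ → Fin p → ℂ} (hf : f ∈ S.square) (hg : g ∈ S.square)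
    (h : ∀ t ∈ Icc 0 S.l, f t = g t) : S.toL2 f = S.toL2 g := by
  rw [toL2_eq_iff hf hg]
  filter_upwards [ae_restrict_mem measurableSet_Ioo] with t ht
  rw [h t (Ioo_subset_Icc_self ht)]

theorem mem_Amax_of_maxPair {f g : ℝ → Fin p → ℂ} (h : S.MaxPair f g) :
    (S.toL2 f, S.toL2 g) ∈ S.Amax := ⟨f, g, h, rfl⟩

/-- Green's identity for the maximal relation. -/
theorem MaxPair.green {f g h k : ℝ → Fin p → ℂ} (hf : S.MaxPair f g) (hh : S.MaxPair h k) :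
    inner ℂ (S.toL2 h) (S.toL2 g) - inner ℂ (S.toL2 k) (S.toL2 f) =
      star (h S.l) ⬝ᵥ (S.J *ᵥ f S.l) - star (h 0) ⬝ᵥ (S.J *ᵥ f 0) := by
  rw [inner_toL2 hf.2.1 hh.1, inner_toL2 hf.1 hh.2.1,
    ← hf.2.2.lagrange hh.2.2 (integrable_H_mulVec hf.2.1) (integrable_H_mulVec hh.2.1)]
  congr 1
  refine integral_congr_ae ?_
  filter_upwards [S.H_posSemidef] with t ht
  rw [star_mulVec, ht.isHermitian.eq, ← dotProduct_mulVec]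
  rfl

variable (S) in
-- By uniqueness for the initial value problem, the class of a solution with `f(0) = 0` depends only
-- on the class of `g - z f`. Linearity follows from the same uniqueness, boundedness from the a
-- priori estimate.
theorem exists_solutionOperator (z : ℂ) : ∃ T : S.L2 →L[ℂ] S.L2, ∀ f g, S.MaxPair f g → f 0 = 0 →
    T (S.toL2 g - z • S.toL2 f) = S.toL2 f := by
  obtain ⟨C, hC, H⟩ := S.exists_maxPair z
  have hex : ∀ x : S.L2, ∃ f g, S.MaxPair f g ∧ f 0 = 0 ∧ S.toL2 g - z • S.toL2 f = x ∧
      ‖S.toL2 f‖ ≤ C * ‖x‖ := by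
    intro x
    obtain ⟨g, hg, rfl⟩ := exists_toL2 x
    obtain ⟨f, hf0, hf, hb⟩ := H 0 g hg
    refine ⟨f, _, hf, hf0, ?_, by simpa using hb⟩
    rw [S.toL2_add (S.square.smul_mem z hf.1) hg, S.toL2_smul z hf.1, add_sub_cancel_left]
  choose F G hFG hF0 hx hb using hex
  have huniq : ∀ f g, S.MaxPair f g → f 0 = 0 →
      S.toL2 (F (S.toL2 g - z • S.toL2 f)) = S.toL2 f := fun f g h h0 =>
    toL2_congr (hFG _).1 h.1 ((hFG _).eqOn h ((hF0 _).trans h0.symm) (hx _))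
  refine ⟨LinearMap.mkContinuous
    { toFun := fun x => S.toL2 (F x)
      map_add' := fun x y => ?_
      map_smul' := fun c x => ?_ } C hb, huniq⟩
  · rw [← S.toL2_add (hFG x).1 (hFG y).1, ← huniq _ _ ((hFG x).add S (hFG y)) (by simp [hF0]),
      S.toL2_add (hFG x).1 (hFG y).1, S.toL2_add (hFG x).2.1 (hFG y).2.1]
    congr 2
    rw [smul_add, add_sub_add_comm, hx, hx]
  · rw [RingHom.id_apply, ← S.toL2_smul c (hFG x).1, ← huniq _ _ ((hFG x).smul S c) (by simp [hF0]),
      S.toL2_smul c (hFG x).1, S.toL2_smul c (hFG x).2.1]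
    congr 2
    rw [smul_comm z c, ← smul_sub, hx]

variable (S) in
/-- The operator `g ↦ f` that solves `J f' + F f = z H f + H g`, `f(0) = 0`. -/
def solutionOp (z : ℂ) : S.L2 →L[ℂ] S.L2 := (S.exists_solutionOperator z).choose

theorem solutionOp_apply (z : ℂ) {f g : ℝ → Fin p → ℂ} (h : S.MaxPair f g) (h0 : f 0 = 0) :
    S.solutionOp z (S.toL2 g - z • S.toL2 f) = S.toL2 f :=
  (S.exists_solutionOperator z).choose_spec f g h h0

variable (S) in
theorem exists_maxPair_solutionOp (z : ℂ) (x : S.L2) :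
    ∃ f g, S.MaxPair f g ∧ f 0 = 0 ∧ S.toL2 f = S.solutionOp z x ∧
      S.toL2 g = x + z • S.solutionOp z x := by
  obtain ⟨C, -, H⟩ := S.exists_maxPair z
  obtain ⟨g, hg, rfl⟩ := exists_toL2 x
  obtain ⟨f, hf0, hf, -⟩ := H 0 g hg
  have h1 : S.toL2 (z • f + g) = z • S.toL2 f + S.toL2 g := by
    rw [S.toL2_add (S.square.smul_mem z hf.1) hg, S.toL2_smul z hf.1]
  have h2 := solutionOp_apply z hf hf0
  rw [h1, add_sub_cancel_left] at h2
  exact ⟨f, _, hf, hf0, h2.symm, by rw [h1, h2, add_comm]⟩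

/-! ## The fundamental solution -/

variable (S) in
-- The columns are the solutions that start at the unit vectors.
theorem isFundamental_U (z : ℂ) : S.IsFundamental z (S.U z) := by
  refine Classical.epsilon_spec (p := S.IsFundamental z) ?_
  obtain ⟨C, -, H⟩ := S.exists_maxPair z
  choose f hf0 hf _ using fun i : Fin p => H (Pi.single i 1) 0 S.square.zero_mem
  refine ⟨fun t => Matrix.of fun k i => f i t k, ?_, fun v => ?_⟩
  · ext k i
    change f i 0 k = _
    rw [hf0, one_apply, Pi.single_apply]
  · have h1 : (fun t => (Matrix.of fun k i => f i t k) *ᵥ v) = ∑ i, v i • f i := by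
      ext t k
      simp only [mulVec, dotProduct, of_apply, Finset.sum_apply, Pi.smul_apply, smul_eq_mul,
        mul_comm]
    have hsum : ∀ s : Finset (Fin p), S.Solves (∑ i ∈ s, v i • f i)
        fun t => z • (S.H t *ᵥ (∑ i ∈ s, v i • f i) t) := by
      classical
      intro s
      induction s using Finset.induction_on with
      | empty => simpa using (MaxPair.zero S).2.2
      | insert i s hi ih =>
        simp only [Finset.sum_insert hi]
        have h2 := ((maxPair_iff S.square.zero_mem).mp (hf i)).smul (v i)
        refine solves_congr (h2.add ih) (Filter.Eventually.of_forall fun t => ?_)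
        simp [mulVec_add, mulVec_smul, smul_comm z]
    rw [h1]
    refine solves_congr (hsum Finset.univ) (Filter.Eventually.of_forall fun t => ?_)
    simp only [← h1]

variable (S) in
theorem maxPair_U (z : ℂ) (v : Fin p → ℂ) :
    S.MaxPair (fun t => S.U z t *ᵥ v) (z • fun t => S.U z t *ᵥ v) := by
  have h := (maxPair_iff (z := z) (f := fun t => S.U z t *ᵥ v) S.square.zero_mem).mpr (by
    simpa using (S.isFundamental_U z).2 v)
  simpa using h

variable (S) in
theorem U_zero (z : ℂ) : S.U z 0 = 1 := (S.isFundamental_U z).1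

variable (S) in
theorem solution_add (z : ℂ) (u v : Fin p → ℂ) :
    S.solution z (u + v) = S.solution z u + S.solution z v := by
  unfold solution
  rw [← S.toL2_add (S.maxPair_U z u).1 (S.maxPair_U z v).1]
  congr 1
  ext1 t
  rw [mulVec_add]
  rfl

variable (S) in
theorem solution_smul (z c : ℂ) (v : Fin p → ℂ) :
    S.solution z (c • v) = c • S.solution z v := by
  unfold solution
  rw [← S.toL2_smul c (S.maxPair_U z v).1]
  congr 1
  ext1 t
  rw [mulVec_smul]
  rfl

theorem maxPair_solution (z : ℂ) (v : Fin p → ℂ) :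
    S.toL2 (z • fun t => S.U z t *ᵥ v) = z • S.solution z v :=
  S.toL2_smul z (S.maxPair_U z v).1

variable (S) in
theorem solution_mem_Amax (z : ℂ) (v : Fin p → ℂ) :
    (S.solution z v, z • S.solution z v) ∈ S.Amax := by
  rw [← maxPair_solution]
  exact mem_Amax_of_maxPair (S.maxPair_U z v)

/-- In a definite system a pair whose classes vanish is zero. -/
theorem MaxPair.eq_zero_of_definite (hdef : S.Definite) {f g : ℝ → Fin p → ℂ} (h : S.MaxPair f g)
    (hf : S.toL2 f = 0) (hg : S.toL2 g = 0) : ∀ t ∈ Icc 0 S.l, f t = 0 := by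
  have h1 : S.Solves f 0 := solves_congr h.2.2 ((toL2_eq_zero_iff h.2.1).mp hg)
  have h2 := hdef f h1 ((toL2_eq_zero_iff h.1).mp hf)
  -- Definiteness yields zero on the open interval only; continuity carries it to the endpoints,
  -- where the boundary values are taken.
  have h3 : EqOn f 0 (closure (Ioo 0 S.l)) := by
    refine EqOn.of_subset_closure (s := Ioo 0 S.l) h2 (t := Icc 0 S.l) h.continuousOn
      continuousOn_const Ioo_subset_Icc_self ?_ |>.mono ?_
    · rw [closure_Ioo S.l_pos.ne]
    · rw [closure_Ioo S.l_pos.ne]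
  rw [closure_Ioo S.l_pos.ne] at h3
  exact h3

theorem solution_eq_zero (hdef : S.Definite) {z : ℂ} {v : Fin p → ℂ} (h : S.solution z v = 0) :
    v = 0 := by
  have h1 := (S.maxPair_U z v).eq_zero_of_definite hdef h (by rw [maxPair_solution, h, smul_zero])
    0 (left_mem_Icc.mpr S.l_pos.le)
  simpa [S.U_zero] using h1

theorem rep_spec {x : S.L2 × S.L2} (hx : x ∈ S.Amax) :
    ∃ g, S.MaxPair (S.rep x) g ∧ x = (S.toL2 (S.rep x), S.toL2 g) := by
  obtain ⟨f, g, h⟩ := hx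
  exact Classical.epsilon_spec (p := fun f => ∃ g, S.MaxPair f g ∧ x = (S.toL2 f, S.toL2 g))
    ⟨f, g, h⟩

theorem rep_eq (hdef : S.Definite) {f g : ℝ → Fin p → ℂ} (h : S.MaxPair f g) {t : ℝ}
    (ht : t ∈ Icc 0 S.l) : S.rep (S.toL2 f, S.toL2 g) t = f t := by
  obtain ⟨g', h', e⟩ := rep_spec (mem_Amax_of_maxPair h)
  rw [Prod.mk.injEq] at e
  have h1 := (h'.sub h).eq_zero_of_definite hdef
    (by rw [toL2_sub h'.1 h.1, e.1.symm, sub_self])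
    (by rw [toL2_sub h'.2.1 h.2.1, e.2.symm, sub_self]) t ht
  rwa [Pi.sub_apply, sub_eq_zero] at h1

end CanonicalSystem

namespace CanonicalSystem
variable {p : ℕ} (S : CanonicalSystem p)

/-! ## The adjoint of the minimal relation -/

/-- The restriction of a canonical system to `(0, m)`. -/
def truncate (m : ℝ) (hm : 0 < m) (hml : m ≤ S.l) : CanonicalSystem p where
  l := m
  l_pos := hm
  J := S.J
  J_adjoint := S.J_adjoint
  J_unitary := S.J_unitary
  F := S.F
  H := S.H
  F_integrable i k := (S.F_integrable i k).mono_set (Ioo_subset_Ioo_right hml)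
  H_integrable i k := (S.H_integrable i k).mono_set (Ioo_subset_Ioo_right hml)
  F_hermitian := ae_restrict_of_ae_restrict_of_subset (Ioo_subset_Ioo_right hml) S.F_hermitian
  H_posSemidef := ae_restrict_of_ae_restrict_of_subset (Ioo_subset_Ioo_right hml) S.H_posSemidef

variable {S}

theorem Solves.truncate {f r : ℝ → Fin p → ℂ} (h : S.Solves f r) {m : ℝ} (hm : 0 < m)
    (hml : m ≤ S.l) : (S.truncate m hm hml).Solves f r := by
  refine ⟨h.1.mono ?_, ae_restrict_of_ae_restrict_of_subset (Ioo_subset_Ioo_right hml) h.2⟩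
  rw [uIcc_of_le S.l_pos.le]
  change uIcc 0 m ⊆ _
  rw [uIcc_of_le hm.le]
  exact Icc_subset_Icc_right hml

/-- The Lagrange identity on `(0, m)` with solutions of the homogeneous system as test functions; it
recovers `f(m)` from `f(0)` and from integrals of the forcing over `(0, m)`. -/
theorem lagrange_truncate {f g : ℝ → Fin p → ℂ} (hf : S.MaxPair f g) (v : Fin p → ℂ) {m : ℝ}
    (hm : m ∈ Ioc 0 S.l) :
    ∫ t in Ioo 0 m, S.form (fun t => S.U 0 t *ᵥ v) g t =
      star (S.U 0 m *ᵥ v) ⬝ᵥ (S.J *ᵥ f m) - star v ⬝ᵥ (S.J *ᵥ f 0) := by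
  have h1 : S.Solves (fun t => S.U 0 t *ᵥ v) fun _ => 0 := by
    simpa using (S.isFundamental_U 0).2 v
  have h2 := (hf.2.2.truncate hm.1 hm.2).lagrange (h1.truncate hm.1 hm.2)
    ((integrable_H_mulVec hf.2.1).mono_measure
      (Measure.restrict_mono_set _ (Ioo_subset_Ioo_right hm.2))) (integrable_zero _ _ _)
  simp only [star_zero, zero_dotProduct, integral_zero, sub_zero, S.U_zero, one_mulVec] at h2
  exact h2

theorem eq_of_star_dotProduct_eq {x y : Fin p → ℂ} (h : ∀ u, star u ⬝ᵥ x = star u ⬝ᵥ y) :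
    x = y := by
  refine dotProduct_eq _ _ fun u => ?_
  rw [dotProduct_comm, dotProduct_comm y]
  simpa using h (star u)

theorem star_mulVec_dotProduct (M : Matrix (Fin p) (Fin p) ℂ) (u w : Fin p → ℂ) :
    star (M *ᵥ u) ⬝ᵥ w = star u ⬝ᵥ (Mᴴ *ᵥ w) := by
  rw [star_mulVec, ← dotProduct_mulVec]

theorem isUnit_of_conjTranspose_mul {V U : Matrix (Fin p) (Fin p) ℂ} (h : Vᴴ * S.J * U = S.J) :
    IsUnit U := by
  refine (Matrix.isUnit_iff_isUnit_det U).mpr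
    (Matrix.isUnit_det_of_left_inverse (B := -(S.J * (Vᴴ * S.J))) ?_)
  rw [neg_mul, mul_assoc, h, J_mul_J, neg_neg]

theorem U_zero_conjTranspose_mul {m : ℝ} (hm : m ∈ Ioc 0 S.l) :
    (S.U 0 m)ᴴ * S.J * S.U 0 m = S.J := by
  rw [Matrix.ext_iff_mulVec]
  refine fun v => eq_of_star_dotProduct_eq fun u => ?_
  have h := lagrange_truncate (S.maxPair_U 0 v) u hm
  have h0 : ∀ t, S.form (fun t => S.U 0 t *ᵥ u) 0 t = 0 := fun t => by simp [form]
  simp only [zero_smul, S.U_zero, one_mulVec, h0, integral_zero] at h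
  rw [eq_comm, sub_eq_zero, star_mulVec_dotProduct] at h
  rw [← h]
  simp only [mulVec_mulVec, mul_assoc]

theorem inner_solution {g : ℝ → Fin p → ℂ} (hg : g ∈ S.square) (z : ℂ) (v : Fin p → ℂ) :
    inner ℂ (S.solution z v) (S.toL2 g) = ∫ t in Ioo 0 S.l, S.form (fun t => S.U z t *ᵥ v) g t :=
  inner_toL2 hg (S.maxPair_U z v).1

/-- The truncated Lagrange identity gives `U(m, 0)^* J f(m) = 0`, and both matrices are invertible.
-/
theorem eq_zero_of_setIntegral_eq_zero {f g : ℝ → Fin p → ℂ} (hf : S.MaxPair f g) (h0 : f 0 = 0)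
    {m : ℝ} (hm : m ∈ Ioc 0 S.l)
    (h : ∀ v, ∫ t in Ioo 0 m, S.form (fun t => S.U 0 t *ᵥ v) g t = 0) : f m = 0 := by
  have h1 : (S.U 0 m)ᴴ *ᵥ (S.J *ᵥ f m) = 0 := by
    refine eq_of_star_dotProduct_eq fun u => ?_
    have h2 := lagrange_truncate hf u hm
    rw [h, h0, mulVec_zero, dotProduct_zero, sub_zero, star_mulVec_dotProduct] at h2
    rw [← h2, dotProduct_zero]
  have hu : IsUnit (S.U 0 m)ᴴ := by
    have := isUnit_of_conjTranspose_mul (U_zero_conjTranspose_mul hm)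
    exact (Matrix.isUnit_conjTranspose _).mpr this
  have h2 : S.J *ᵥ f m = 0 :=
    Matrix.mulVec_injective_iff_isUnit.mpr hu (h1.trans (mulVec_zero _).symm)
  rw [← neg_eq_zero, ← S.J_mulVec_J_mulVec, h2, mulVec_zero]

variable (S) in
/-- The square integrable functions with compact support in `(0, l)`. -/
def compactSquare : Submodule ℂ (ℝ → Fin p → ℂ) where
  carrier := {g | g ∈ S.square ∧ ∃ a b, 0 < a ∧ b < S.l ∧ ∀ t, t ∉ Icc a b → g t = 0}
  zero_mem' := ⟨S.square.zero_mem, S.l, 0, S.l_pos, S.l_pos, fun _ _ => rfl⟩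
  add_mem' := by
    rintro f g ⟨hf, a, b, ha, hb, hs⟩ ⟨hg, a', b', ha', hb', hs'⟩
    refine ⟨S.square.add_mem hf hg, min a a', max b b', lt_min ha ha', max_lt hb hb',
      fun t hn => ?_⟩
    have h1 : t ∉ Icc a b := fun hm =>
      hn ⟨(min_le_left _ _).trans hm.1, hm.2.trans (le_max_left _ _)⟩
    have h2 : t ∉ Icc a' b' := fun hm =>
      hn ⟨(min_le_right _ _).trans hm.1, hm.2.trans (le_max_right _ _)⟩
    simp [hs t h1, hs' t h2]
  smul_mem' := by
    rintro c f ⟨hf, a, b, ha, hb, hs⟩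
    exact ⟨S.square.smul_mem c hf, a, b, ha, hb, fun t hn => by simp [hs t hn]⟩

/-- A compactly supported function orthogonal to the solutions of the homogeneous system is the
second entry of a pair in the preminimal relation. -/
theorem exists_mem_Apre {g : ℝ → Fin p → ℂ} (hg : g ∈ S.compactSquare)
    (h : ∀ v, inner ℂ (S.solution 0 v) (S.toL2 g) = 0) : ∃ x, (x, S.toL2 g) ∈ S.Apre := by
  obtain ⟨hgs, a, b, ha, hb, hs⟩ := hg
  obtain ⟨C, -, H⟩ := S.exists_maxPair 0
  obtain ⟨f, hf0, hf, -⟩ := H 0 g hgs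
  rw [zero_smul, zero_add] at hf
  have hform : ∀ v t, t ∉ Icc a b → S.form (fun t => S.U 0 t *ᵥ v) g t = 0 := fun v t ht => by
    simp [form, hs t ht]
  refine ⟨S.toL2 f, f, g, hf, ⟨a, b, ha, hb, fun t ht hn => ?_⟩, rfl⟩
  rcases ht.1.eq_or_lt with rfl | ht0
  · exact hf0
  refine eq_zero_of_setIntegral_eq_zero hf hf0 ⟨ht0, ht.2⟩ fun v => ?_
  -- To the left of the support the integrand vanishes on all of `(0, t)`; to the right the integral
  -- over `(0, t)` is already the full inner product, which is zero by hypothesis.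
  rcases lt_or_ge t a with hta | hta
  · refine setIntegral_eq_zero_of_forall_eq_zero fun s hs => hform v s fun hm => ?_
    exact absurd (hm.1.trans_lt hs.2) hta.not_gt
  · have hbt : b < t := not_le.mp fun hle => hn ⟨hta, hle⟩
    have hv := h v
    rw [inner_solution hgs] at hv
    refine Eq.trans ?_ hv
    refine (setIntegral_eq_of_subset_of_forall_sdiff_eq_zero measurableSet_Ioo
      (Ioo_subset_Ioo_right ht.2) fun s hs => hform v s fun hm => ?_).symm
    exact hs.2 ⟨hs.1.1, hm.2.trans_lt hbt⟩

/-- Density of the compactly supported functions: the inner product of a representative with its own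
truncation to `[1/(n+1), l - 1/(n+1)]` is the squared norm of the truncation, and these intervals
exhaust `(0, l)`. -/
theorem eq_zero_of_inner_compactSquare {x : S.L2}
    (h : ∀ g ∈ S.compactSquare, inner ℂ x (S.toL2 g) = 0) : x = 0 := by
  obtain ⟨d, hd, rfl⟩ := exists_toL2 x
  let g : ℕ → ℝ → Fin p → ℂ := fun n =>
    indicator (Icc (1 / (n + 1) : ℝ) (S.l - 1 / (n + 1))) d
  have hform : ∀ n t, S.form (g n) (g n) t = S.form d (g n) t ∧ (S.form (g n) (g n) t =
      indicator (Icc (1 / (n + 1) : ℝ) (S.l - 1 / (n + 1))) (S.form d d) t) := fun n t => by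
    by_cases ht : t ∈ Icc (1 / (n + 1) : ℝ) (S.l - 1 / (n + 1))
    · simp only [form, g, indicator_of_mem ht, and_self]
    · simp only [form, g, indicator_of_notMem ht]
      simp
  have hg : ∀ n, g n ∈ S.compactSquare := fun n => by
    have hpos : (0 : ℝ) < 1 / (n + 1) := by positivity
    refine ⟨⟨hd.1.indicator measurableSet_Icc, ?_⟩, _, _, hpos, sub_lt_self _ hpos,
      fun t ht => indicator_of_notMem ht _⟩
    have h1 : S.form (g n) (g n) =
        indicator (Icc (1 / (n + 1) : ℝ) (S.l - 1 / (n + 1))) (S.form d d) :=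
      funext fun t => (hform n t).2
    rw [h1]
    exact hd.2.indicator measurableSet_Icc
  have hz : ∀ n, ∀ᵐ t ∂S.μ, S.H t *ᵥ g n t = 0 := fun n => by
    rw [← toL2_eq_zero_iff (hg n).1, ← inner_self_eq_zero (𝕜 := ℂ), inner_toL2 (hg n).1 (hg n).1]
    have h1 := h _ (hg n)
    rw [inner_toL2 (hg n).1 hd] at h1
    rw [← h1]
    exact integral_congr_ae (Filter.Eventually.of_forall fun t => (hform n t).1)
  rw [toL2_eq_zero_iff hd]
  filter_upwards [ae_all_iff.mpr hz, ae_restrict_mem measurableSet_Ioo] with t h1 ht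
  obtain ⟨n, hn⟩ := exists_nat_one_div_lt (lt_min ht.1 (sub_pos.mpr ht.2))
  rw [lt_min_iff] at hn
  have h2 := h1 n
  have h3 : t ∈ Icc (1 / (n + 1) : ℝ) (S.l - 1 / (n + 1)) := ⟨hn.1.le, by linarith [hn.2]⟩
  simpa only [g, indicator_of_mem h3] using h2

/-- An element orthogonal to the range of the preminimal relation is a solution of the homogeneous
system. -/
theorem exists_eq_solution {k : S.L2} (h : ∀ x ∈ S.Apre, inner ℂ k x.2 = 0) :
    ∃ v, k = S.solution 0 v := by
  let ι : S.compactSquare →ₗ[ℂ] S.L2 :=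
    { toFun := fun g => S.toL2 g.1
      map_add' := fun g g' => S.toL2_add g.2.1 g'.2.1
      map_smul' := fun c g => S.toL2_smul c g.2.1 }
  let φ : S.L2 → (S.compactSquare →ₗ[ℂ] ℂ) := fun x => (innerₛₗ ℂ x).comp ι
  have hφ : ∀ x g, φ x g = inner ℂ x (S.toL2 g.1) := fun x g => rfl
  have hk : φ k ∈ Submodule.span ℂ (range fun i : Fin p => φ (S.solution 0 (Pi.single i 1))) := by
    -- A functional that vanishes on the common kernel of finitely many functionals is a combination
    -- of them. Here a `g` in the common kernel is orthogonal to all homogeneous solutions, hence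
    -- lies in the range of the preminimal relation, to which `k` is orthogonal.
    refine mem_span_of_iInf_ker_le_ker fun g hg => ?_
    rw [LinearMap.mem_ker, hφ]
    have h1 : ∀ v, inner ℂ (S.solution 0 v) (S.toL2 g.1) = 0 := by
      intro v
      rw [pi_eq_sum_univ' v]
      have h2 : ∀ s : Finset (Fin p),
          inner ℂ (S.solution 0 (∑ i ∈ s, v i • Pi.single i 1)) (S.toL2 g.1) = 0 := by
        classical
        intro s
        induction s using Finset.induction_on with
        | empty =>
          have := S.solution_smul 0 0 0
          rw [zero_smul, zero_smul] at this
          rw [Finset.sum_empty, this, inner_zero_left]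
        | insert i s hi ih =>
          rw [Finset.sum_insert hi, solution_add, inner_add_left, ih, solution_smul,
            inner_smul_left]
          have h3 : φ (S.solution 0 (Pi.single i 1)) g = 0 :=
            LinearMap.mem_ker.mp ((Submodule.mem_iInf _).mp hg i)
          rw [hφ] at h3
          rw [h3, mul_zero, add_zero]
      convert h2 Finset.univ using 3
    obtain ⟨x, hx⟩ := exists_mem_Apre g.2 h1
    exact h _ hx
  obtain ⟨c, hc⟩ := (Submodule.mem_span_range_iff_exists_fun ℂ).mp hk
  have hsum : ∀ s : Finset (Fin p), ∃ v, ∑ i ∈ s, c i • φ (S.solution 0 (Pi.single i 1)) =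
      φ (S.solution 0 v) := by
    classical
    intro s
    induction s using Finset.induction_on with
    | empty =>
      have h0 := S.solution_smul 0 0 0
      rw [zero_smul, zero_smul] at h0
      refine ⟨0, ?_⟩
      ext g
      rw [hφ, h0, Finset.sum_empty, inner_zero_left, LinearMap.zero_apply]
    | insert i s hi ih =>
      obtain ⟨v, hv⟩ := ih
      -- The coefficient is conjugated because the inner product is conjugate linear in the slot
      -- that holds the solution.
      refine ⟨conj (c i) • Pi.single i 1 + v, ?_⟩
      ext g
      rw [Finset.sum_insert hi, hv, LinearMap.add_apply, LinearMap.smul_apply, hφ, hφ, hφ,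
        solution_add, inner_add_left, solution_smul, inner_smul_left, Complex.conj_conj,
        smul_eq_mul]
  obtain ⟨v, hv⟩ := hsum Finset.univ
  refine ⟨v, sub_eq_zero.mp (eq_zero_of_inner_compactSquare fun g hg => ?_)⟩
  have h1 : φ k ⟨g, hg⟩ = φ (S.solution 0 v) ⟨g, hg⟩ := by rw [← hc, hv]
  rw [hφ, hφ] at h1
  rw [inner_sub_left, h1, sub_self]

/-- The adjoint of the minimal relation is the maximal relation. -/
theorem adjoint_Amin : S.Amin.adjoint = S.Amax := by
  ext x
  rw [Submodule.mem_adjoint_iff]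
  constructor
  · intro hx
    obtain ⟨f, g, hf, -, hw, hg⟩ := S.exists_maxPair_solutionOp 0 x.2
    rw [zero_smul, add_zero] at hg
    -- Subtraction of a maximal pair with the same second entry leaves an element orthogonal to the
    -- range of the preminimal relation, and such an element is a homogeneous solution.
    have h1 : ∀ y ∈ S.Apre, inner ℂ (x.1 - S.toL2 f) y.2 = 0 := by
      rintro y ⟨a, b, hab, ⟨s, t, hs, ht, hst⟩, rfl⟩
      have hmem : (S.toL2 a, S.toL2 b) ∈ S.Amin :=
        S.Apre.le_topologicalClosure ⟨a, b, hab, ⟨s, t, hs, ht, hst⟩, rfl⟩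
      have h2 := hx _ _ hmem
      have h3 := hf.green hab
      have ha0 : a 0 = 0 := hst 0 (left_mem_Icc.mpr S.l_pos.le) fun hm => absurd hm.1 hs.not_ge
      have hal : a S.l = 0 := hst S.l (right_mem_Icc.mpr S.l_pos.le) fun hm => absurd hm.2 ht.not_ge
      rw [ha0, hal, star_zero, zero_dotProduct, zero_dotProduct, sub_zero, hg] at h3
      have h4 : inner ℂ (S.toL2 b) (x.1 - S.toL2 f) = 0 := by
        rw [inner_sub_right, sub_eq_zero.mp h2, h3]
      exact inner_eq_zero_symm.mp h4
    obtain ⟨v, hv⟩ := exists_eq_solution h1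
    have h2 := S.Amax.add_mem (mem_Amax_of_maxPair hf) (S.solution_mem_Amax 0 v)
    rw [← hv, zero_smul, hg] at h2
    convert h2 using 1
    ext <;> simp
  · rintro ⟨f, g, hf, rfl⟩ a b hab
    have hcl : IsClosed {y : S.L2 × S.L2 | inner ℂ y.2 (S.toL2 f) - inner ℂ y.1 (S.toL2 g) = 0} :=
      isClosed_eq (by fun_prop) continuous_const
    refine closure_minimal ?_ hcl hab
    rintro y ⟨a, b, hab, ⟨s, t, hs, ht, hst⟩, rfl⟩
    have h3 := hf.green hab
    have ha0 : a 0 = 0 := hst 0 (left_mem_Icc.mpr S.l_pos.le) fun hm => absurd hm.1 hs.not_ge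
    have hal : a S.l = 0 := hst S.l (right_mem_Icc.mpr S.l_pos.le) fun hm => absurd hm.2 ht.not_ge
    rw [ha0, hal, star_zero, zero_dotProduct, zero_dotProduct, sub_zero] at h3
    change inner ℂ (S.toL2 b) (S.toL2 f) - inner ℂ (S.toL2 a) (S.toL2 g) = 0
    rw [← neg_eq_zero, neg_sub, h3]

/-! ## Boundary values of elements of the maximal relation -/

theorem rep_add (hdef : S.Definite) {x y : S.L2 × S.L2} (hx : x ∈ S.Amax) (hy : y ∈ S.Amax)
    {t : ℝ} (ht : t ∈ Icc 0 S.l) : S.rep (x + y) t = S.rep x t + S.rep y t := by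
  obtain ⟨f, g, h, rfl⟩ := hx
  obtain ⟨f', g', h', rfl⟩ := hy
  rw [Prod.mk_add_mk, ← S.toL2_add h.1 h'.1, ← S.toL2_add h.2.1 h'.2.1, rep_eq hdef h ht,
    rep_eq hdef h' ht, rep_eq hdef (h.add S h') ht, Pi.add_apply]

theorem rep_smul (hdef : S.Definite) (c : ℂ) {x : S.L2 × S.L2} (hx : x ∈ S.Amax)
    {t : ℝ} (ht : t ∈ Icc 0 S.l) : S.rep (c • x) t = c • S.rep x t := by
  obtain ⟨f, g, h, rfl⟩ := hx
  rw [Prod.smul_mk, ← S.toL2_smul c h.1, ← S.toL2_smul c h.2.1, rep_eq hdef h ht,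
    rep_eq hdef (h.smul S c) ht, Pi.smul_apply]

theorem rep_sub (hdef : S.Definite) {x y : S.L2 × S.L2} (hx : x ∈ S.Amax) (hy : y ∈ S.Amax)
    {t : ℝ} (ht : t ∈ Icc 0 S.l) : S.rep (x - y) t = S.rep x t - S.rep y t := by
  have h : x - y = x + (-1 : ℂ) • y := by rw [neg_smul, one_smul, sub_eq_add_neg]
  rw [h, rep_add hdef hx (S.Amax.smul_mem _ hy) ht, rep_smul hdef _ hy ht, neg_smul, one_smul,
    sub_eq_add_neg]

theorem rep_solution (hdef : S.Definite) (z : ℂ) (v : Fin p → ℂ) {t : ℝ} (ht : t ∈ Icc 0 S.l) :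
    S.rep (S.solution z v, z • S.solution z v) t = S.U z t *ᵥ v := by
  rw [← maxPair_solution]
  exact rep_eq hdef (S.maxPair_U z v) ht

/-- Green's identity. -/
theorem green (hdef : S.Definite) {x y : S.L2 × S.L2} (hx : x ∈ S.Amax) (hy : y ∈ S.Amax) :
    inner ℂ y.1 x.2 - inner ℂ y.2 x.1 = star (S.rep y S.l) ⬝ᵥ (S.J *ᵥ S.rep x S.l) -
      star (S.rep y 0) ⬝ᵥ (S.J *ᵥ S.rep x 0) := by
  have h0 : (0 : ℝ) ∈ Icc 0 S.l := left_mem_Icc.mpr S.l_pos.le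
  have hl : S.l ∈ Icc 0 S.l := right_mem_Icc.mpr S.l_pos.le
  obtain ⟨f, g, h, rfl⟩ := hx
  obtain ⟨f', g', h', rfl⟩ := hy
  rw [rep_eq hdef h h0, rep_eq hdef h' h0, rep_eq hdef h hl, rep_eq hdef h' hl]
  exact h.green h'

/-- Green's identity for `U(·, z) v` and `U(·, conj z) u`: the conjugate parameters cancel on the
left-hand side, and at `0` both matrices are the identity. -/
theorem U_conjTranspose_mul (z : ℂ) : (S.U (conj z) S.l)ᴴ * S.J * S.U z S.l = S.J := by
  rw [Matrix.ext_iff_mulVec]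
  refine fun v => eq_of_star_dotProduct_eq fun u => ?_
  have h := (S.maxPair_U z v).green (S.maxPair_U (conj z) u)
  rw [maxPair_solution, maxPair_solution] at h
  change inner ℂ (S.solution (conj z) u) (z • S.solution z v) -
    inner ℂ (conj z • S.solution (conj z) u) (S.solution z v) = _ at h
  rw [inner_smul_right, inner_smul_left, Complex.conj_conj, sub_self, eq_comm, sub_eq_zero] at h
  simp only [S.U_zero, one_mulVec] at h
  rw [star_mulVec_dotProduct] at h
  rw [← h]
  simp only [mulVec_mulVec, mul_assoc]

theorem solutionOp_mem (z : ℂ) (x : S.L2) :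
    (S.solutionOp z x, x + z • S.solutionOp z x) ∈ S.Amax := by
  obtain ⟨f, g, h, -, h1, h2⟩ := S.exists_maxPair_solutionOp z x
  rw [← h1, h1, ← h2, ← h1]
  exact mem_Amax_of_maxPair h

theorem rep_solutionOp (hdef : S.Definite) (z : ℂ) (x : S.L2) :
    S.rep (S.solutionOp z x, x + z • S.solutionOp z x) 0 = 0 := by
  obtain ⟨f, g, h, h0, h1, h2⟩ := S.exists_maxPair_solutionOp z x
  rw [← h2, ← h1, rep_eq hdef h (left_mem_Icc.mpr S.l_pos.le), h0]

/-- Variation of constants: after subtraction of `U(·, z) f(0)` the initial value is zero and `g - z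
f` is unchanged. -/
theorem eq_solutionOp_add_solution (z : ℂ) {x : S.L2 × S.L2} (hx : x ∈ S.Amax) :
    x.1 = S.solutionOp z (x.2 - z • x.1) + S.solution z (S.rep x 0) := by
  obtain ⟨g, h, e⟩ := rep_spec hx
  have h1 := h.sub (S.maxPair_U z (S.rep x 0))
  have h2 := solutionOp_apply z h1 (by simp [S.U_zero])
  have h3 : S.toL2 (fun t => S.U z t *ᵥ S.rep x 0) = S.solution z (S.rep x 0) := rfl
  rw [toL2_sub h.2.1 (S.maxPair_U z _).2.1, toL2_sub h.1 (S.maxPair_U z _).1, maxPair_solution,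
    h3, smul_sub, sub_sub_sub_cancel_right] at h2
  have e1 : x.1 = S.toL2 (S.rep x) := congrArg Prod.fst e
  have e2 : x.2 = S.toL2 g := congrArg Prod.snd e
  rw [e2, e1, h2, sub_add_cancel]

theorem eq_solution (z : ℂ) {x : S.L2} (hx : (x, z • x) ∈ S.Amax) :
    x = S.solution z (S.rep (x, z • x) 0) := by
  have h := eq_solutionOp_add_solution z hx
  simpa using h

/-- For compact support the initial value is zero. Stated through the bounded solution operator,
this is a closed condition and passes to the closure. -/
theorem eq_solutionOp_of_mem_Amin (z : ℂ) {x : S.L2 × S.L2} (hx : x ∈ S.Amin) :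
    x.1 = S.solutionOp z (x.2 - z • x.1) := by
  have hcl : IsClosed {x : S.L2 × S.L2 | x.1 = S.solutionOp z (x.2 - z • x.1)} :=
    isClosed_eq (by fun_prop) (by fun_prop)
  refine closure_minimal ?_ hcl hx
  rintro y ⟨a, b, hab, ⟨s, t, hs, ht, hst⟩, rfl⟩
  exact (solutionOp_apply z hab (hst 0 (left_mem_Icc.mpr S.l_pos.le)
    fun hm => absurd hm.1 hs.not_ge)).symm

theorem rep_of_mem_Apre (hdef : S.Definite) {x : S.L2 × S.L2} (hx : x ∈ S.Apre) :
    x ∈ S.Amax ∧ S.rep x 0 = 0 ∧ S.rep x S.l = 0 := by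
  obtain ⟨a, b, hab, ⟨s, t, hs, ht, hst⟩, rfl⟩ := hx
  refine ⟨mem_Amax_of_maxPair hab, ?_, ?_⟩
  · rw [rep_eq hdef hab (left_mem_Icc.mpr S.l_pos.le)]
    exact hst 0 (left_mem_Icc.mpr S.l_pos.le) fun hm => absurd hm.1 hs.not_ge
  · rw [rep_eq hdef hab (right_mem_Icc.mpr S.l_pos.le)]
    exact hst S.l (right_mem_Icc.mpr S.l_pos.le) fun hm => absurd hm.2 ht.not_ge

/-- The initial value depends only on the first entry of a pair. -/
theorem rep_zero_eq (hdef : S.Definite) (hdelta : S.DeltaWellDefined) {x y : S.L2 × S.L2}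
    (hx : x ∈ S.Amax) (hy : y ∈ S.Amax) (h : x.1 = y.1) : S.rep x 0 = S.rep y 0 := by
  obtain ⟨g, hg, e⟩ := rep_spec (S.Amax.sub_mem hx hy)
  have e1 : S.toL2 (S.rep (x - y)) = 0 := by
    have e2 : (x - y).1 = S.toL2 (S.rep (x - y)) := congrArg Prod.fst e
    rw [← e2, Prod.fst_sub, h, sub_self]
  have := hdelta _ _ hg ((toL2_eq_zero_iff hg.1).mp e1)
  rwa [rep_sub hdef hx hy (left_mem_Icc.mpr S.l_pos.le), sub_eq_zero] at this

/-- The initial value is bounded by the graph norm. -/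
theorem exists_norm_rep_zero_le (hdef : S.Definite) :
    ∃ C : ℝ, ∀ x ∈ S.Amax, ‖S.rep x 0‖ ≤ C * (‖x.1‖ + ‖x.2‖) := by
  -- The map `v ↦ U(·, 0) v` is injective on a finite-dimensional space, hence bounded below; this
  -- converts an `L²_H` estimate of `U(·, 0) f(0)` into one of `f(0)`.
  let Λ : (Fin p → ℂ) →ₗ[ℂ] S.L2 :=
    { toFun := S.solution 0
      map_add' := S.solution_add 0
      map_smul' := S.solution_smul 0 }
  have hΛ : LinearMap.ker Λ = ⊥ := LinearMap.ker_eq_bot'.mpr fun v hv => solution_eq_zero hdef hv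
  obtain ⟨K, -, hK⟩ := Λ.exists_antilipschitzWith hΛ
  refine ⟨K * (1 + ‖S.solutionOp 0‖), fun x hx => ?_⟩
  have h1 := eq_solutionOp_add_solution 0 hx
  rw [zero_smul, sub_zero] at h1
  have h2 : ‖S.rep x 0‖ ≤ K * ‖S.solution 0 (S.rep x 0)‖ := by
    have h3 := hK.le_mul_dist (S.rep x 0) 0
    rw [map_zero, dist_zero_right, dist_zero_right] at h3
    exact h3
  have h3 : ‖S.solution 0 (S.rep x 0)‖ ≤ ‖x.1‖ + ‖S.solutionOp 0‖ * ‖x.2‖ := by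
    have h4 : S.solution 0 (S.rep x 0) = x.1 - S.solutionOp 0 x.2 := eq_sub_of_add_eq' h1.symm
    rw [h4]
    exact (norm_sub_le _ _).trans (by gcongr; exact (S.solutionOp 0).le_opNorm _)
  have h5 : 0 ≤ ‖S.solutionOp 0‖ := (S.solutionOp 0).opNorm_nonneg
  calc ‖S.rep x 0‖ ≤ K * (‖x.1‖ + ‖S.solutionOp 0‖ * ‖x.2‖) := h2.trans (by gcongr)
    _ ≤ K * ((1 + ‖S.solutionOp 0‖) * (‖x.1‖ + ‖x.2‖)) := by
      gcongr
      nlinarith [norm_nonneg x.1, norm_nonneg x.2, mul_nonneg h5 (norm_nonneg x.1)]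
    _ = _ := by ring

end CanonicalSystem

/-! ## Resolvents of linear relations -/

section Resolvent

variable {K : Type*} [NormedAddCommGroup K] [InnerProductSpace ℂ K]

theorem resolvent_mem {T : Set (K × K)} {z : ℂ} (hz : IsRegularPoint T z) (f : K) :
    (resolvent T z f, f + z • resolvent T z f) ∈ T :=
  Classical.epsilon_spec (p := fun h => (h, f + z • h) ∈ T) (hz.2 f)

theorem eq_resolvent {B : Submodule ℂ (K × K)} {z : ℂ} (hz : IsRegularPoint (B : Set (K × K)) z)
    {x : K × K} (hx : x ∈ B) : x.1 = resolvent (B : Set (K × K)) z (x.2 - z • x.1) := by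
  have h := B.sub_mem hx (resolvent_mem hz (x.2 - z • x.1))
  rw [← sub_eq_zero]
  refine hz.1 _ ?_
  have h2 : ∀ k : K, x - (k, x.2 - z • x.1 + z • k) = (x.1 - k, z • (x.1 - k)) := fun k => by
    refine Prod.ext rfl ?_
    simp only [Prod.snd_sub, smul_sub]
    abel
  rw [h2] at h
  exact h

/-- The resolvent of a closed relation at a regular point is a bounded operator. -/
theorem exists_resolvent_clm [CompleteSpace K] {B : Submodule ℂ (K × K)}
    (hB : IsClosed (B : Set (K × K))) {z : ℂ} (hz : IsRegularPoint (B : Set (K × K)) z) :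
    ∃ T : K →L[ℂ] K, ∀ f, resolvent (B : Set (K × K)) z f = T f := by
  have hsub : ∀ f, f + z • resolvent (B : Set (K × K)) z f - z • resolvent (B : Set (K × K)) z f = f :=
    fun f => add_sub_cancel_right _ _
  let T₀ : K →ₗ[ℂ] K :=
    { toFun := resolvent (B : Set (K × K)) z
      map_add' := fun f g => by
        have h := eq_resolvent hz (B.add_mem (resolvent_mem hz f) (resolvent_mem hz g))
        simp only [Prod.mk_add_mk, smul_add] at h
        rw [add_sub_add_comm, hsub, hsub] at h
        exact h.symm
      map_smul' := fun c f => by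
        have h := eq_resolvent hz (B.smul_mem c (resolvent_mem hz f))
        simp only [Prod.smul_mk, smul_comm z c] at h
        rw [← smul_sub, hsub] at h
        exact h.symm }
  refine ⟨⟨T₀, T₀.continuous_of_isClosed_graph ?_⟩, fun f => rfl⟩
  have h : (T₀.graph : Set (K × K)) = (fun x : K × K => (x.2, x.1 + z • x.2)) ⁻¹' B := by
    ext x
    simp only [SetLike.mem_coe, LinearMap.mem_graph_iff, mem_preimage]
    constructor
    · intro hx
      rw [hx]
      exact resolvent_mem hz x.1
    · intro hx
      have := eq_resolvent hz hx
      rwa [add_sub_cancel_right] at this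
  rw [h]
  exact hB.preimage (by fun_prop)

theorem isClosed_of_selfadjoint {j : K →L[ℂ] K} {B : Submodule ℂ (K × K)}
    (hB : ∀ x, x ∈ B ↔ ∀ y ∈ B, inner ℂ y.1 (j x.2) = inner ℂ y.2 (j x.1)) :
    IsClosed (B : Set (K × K)) := by
  have h : (B : Set (K × K)) =
      ⋂ y ∈ B, {x : K × K | inner ℂ y.1 (j x.2) = inner ℂ y.2 (j x.1)} := by
    ext x
    simp only [SetLike.mem_coe, mem_iInter, mem_ofPred_eq]
    exact hB x
  rw [h]
  exact isClosed_biInter fun y _ => isClosed_eq (by fun_prop) (by fun_prop)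

variable {j : K →L[ℂ] K} {B : Submodule ℂ (K × K)}

/-- The resolvent set of a relation that is selfadjoint with respect to an indefinite inner product
is symmetric with respect to the real axis, and `(B - z̄)⁻¹` is the adjoint of `(B - z)⁻¹`. -/
theorem isRegularPoint_conj [CompleteSpace K]
    (hjj : ∀ x, j (j x) = x)
    (hB : ∀ x, x ∈ B ↔ ∀ y ∈ B, inner ℂ y.1 (j x.2) = inner ℂ y.2 (j x.1)) {z : ℂ}
    (hz : IsRegularPoint (B : Set (K × K)) z) :
    IsRegularPoint (B : Set (K × K)) (conj z) ∧ ∀ f g,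
      inner ℂ (resolvent (B : Set (K × K)) (conj z) f) (j g) =
        inner ℂ f (j (resolvent (B : Set (K × K)) z g)) := by
  have hadj : ∀ h f g, (h, f + conj z • h) ∈ B →
      inner ℂ h (j g) = inner ℂ f (j (resolvent (B : Set (K × K)) z g)) := by
    intro h f g hh
    have h1 := (hB _).mp (resolvent_mem hz g) _ hh
    simp only [map_add, map_smul, inner_add_left, inner_add_right, inner_smul_left,
      inner_smul_right, Complex.conj_conj] at h1
    exact add_right_cancel h1
  have hreg : IsRegularPoint (B : Set (K × K)) (conj z) := by
    refine ⟨fun h hh => ?_, fun f => ?_⟩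
    · have h1 := hadj h 0 (j h) (by simpa using hh)
      rwa [hjj, inner_zero_left, inner_self_eq_zero] at h1
    · obtain ⟨T, hT⟩ := exists_resolvent_clm (isClosed_of_selfadjoint hB) hz
      -- With `T = (B - z)⁻¹`, the operator `j T^* j` is the adjoint of `T` with respect to the
      -- indefinite inner product, and it provides the resolvent at `conj z`.
      refine ⟨j (ContinuousLinearMap.adjoint T (j f)), (hB _).mpr fun y hy => ?_⟩
      have hy1 := eq_resolvent hz hy
      rw [hT] at hy1
      simp only [map_add, map_smul, hjj, inner_add_right, inner_smul_right]
      rw [ContinuousLinearMap.adjoint_inner_right, ContinuousLinearMap.adjoint_inner_right]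
      have hy2 : inner ℂ y.1 (j f) = inner ℂ (T y.2) (j f) - conj z * inner ℂ (T y.1) (j f) := by
        rw [← inner_smul_left, ← inner_sub_left, ← map_smul, ← map_sub, ← hy1]
      rw [hy2, sub_add_cancel]
  exact ⟨hreg, fun f g => hadj _ _ g (resolvent_mem hreg f)⟩

/-- A symmetric relation with regular points `z` and `z̄` is selfadjoint. -/
theorem mem_of_symmetric (hsymm : ∀ x ∈ B, ∀ y ∈ B, inner ℂ y.1 x.2 = inner ℂ y.2 x.1) {z : ℂ}
    (hz : IsRegularPoint (B : Set (K × K)) z) (hz' : IsRegularPoint (B : Set (K × K)) (conj z))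
    (x : K × K) : x ∈ B ↔ ∀ y ∈ B, inner ℂ y.1 x.2 = inner ℂ y.2 x.1 := by
  refine ⟨fun hx y hy => hsymm x hx y hy, fun hx => ?_⟩
  set k := resolvent (B : Set (K × K)) z (x.2 - z • x.1)
  have hk := resolvent_mem hz (x.2 - z • x.1)
  -- The defect `x.1 - k` is orthogonal to `ran (B - conj z)`, which is the whole space.
  have h1 : ∀ y ∈ B, inner ℂ (y.2 - conj z • y.1) (x.1 - k) = 0 := by
    intro y hy
    have h2 := hx y hy
    have h3 := hsymm _ hk y hy
    simp only [inner_add_right, inner_sub_right, inner_smul_right] at h3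
    simp only [inner_sub_left, inner_sub_right, inner_smul_left, Complex.conj_conj]
    rw [← h2, ← h3]
    ring
  have h2 := resolvent_mem hz' (x.1 - k)
  have h3 := h1 _ h2
  rw [add_sub_cancel_right, inner_self_eq_zero, sub_eq_zero] at h3
  have h4 : x = (k, x.2 - z • x.1 + z • k) := by
    rw [← h3, sub_add_cancel]
  rw [h4]
  exact hk

end Resolvent

/-! ### Functionals on `dom A^*` and extensions of operators by duality. -/

section Rigging

variable {H : Type*} [NormedAddCommGroup H] [InnerProductSpace ℂ H] {A : Submodule ℂ (H × H)}

theorem mem_Plus {x : H × H} (hx : x ∈ A.adjoint) : x.1 ∈ Plus A := ⟨x, hx, rfl⟩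

theorem pair_of_mem (φ : Minus A) {h : H} (hh : h ∈ Plus A) : pair φ h = φ.1 ⟨h, hh⟩ := dif_pos hh

theorem pair_add_right (φ : Minus A) {h k : H} (hh : h ∈ Plus A) (hk : k ∈ Plus A) :
    pair φ (h + k) = pair φ h + pair φ k := by
  rw [pair_of_mem φ hh, pair_of_mem φ hk, pair_of_mem φ ((Plus A).add_mem hh hk), ← map_add]
  rfl

theorem pair_smul_right (φ : Minus A) (c : ℂ) {h : H} (hh : h ∈ Plus A) :
    pair φ (c • h) = conj c * pair φ h := by
  rw [pair_of_mem φ hh, pair_of_mem φ ((Plus A).smul_mem c hh), ← smul_eq_mul, ← map_smulₛₗ]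
  rfl

theorem pair_embed (f : H) {h : H} (hh : h ∈ Plus A) : pair (embed A f) h = inner ℂ h f :=
  pair_of_mem _ hh

theorem pair_sub (φ ψ : Minus A) (h : H) : pair (φ - ψ) h = pair φ h - pair ψ h := by
  have h1 : φ - ψ = φ + (-1 : ℂ) • ψ := by module
  rw [h1, pair_add, pair_smul]
  ring

theorem exists_norm_pair_le (φ : Minus A) :
    ∃ C : ℝ, 0 ≤ C ∧ ∀ x ∈ A.adjoint, ‖pair φ x.1‖ ≤ C * (‖x.1‖ + ‖x.2‖) := by
  obtain ⟨C, hC⟩ := φ.2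
  refine ⟨max C 0, le_max_right _ _, fun x hx => ?_⟩
  rw [pair_of_mem φ (mem_Plus hx)]
  exact (hC ⟨x.1, mem_Plus hx⟩ x.2 hx).trans (by gcongr; exact le_max_left _ _)

/-- The Riesz representation of a functional in `H₋` composed with an operator into `H₊`. -/
theorem exists_inner_eq_pair [CompleteSpace H] {T T' : H →L[ℂ] H}
    (hT : ∀ g, (T g, T' g) ∈ A.adjoint) (φ : Minus A) : ∃ x, ∀ h, inner ℂ h x = pair φ (T h) := by
  obtain ⟨C, hC, hb⟩ := exists_norm_pair_le φ
  have hm : ∀ g, T g ∈ Plus A := fun g => mem_Plus (hT g)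
  let ℓ : StrongDual ℂ H := LinearMap.mkContinuous
    { toFun := fun h => conj (pair φ (T h))
      map_add' := fun h k => by rw [map_add, pair_add_right φ (hm h) (hm k), map_add]
      map_smul' := fun c h => by
        rw [map_smul, pair_smul_right φ c (hm h), map_mul, Complex.conj_conj]
        rfl } (C * (‖T‖ + ‖T'‖)) fun h => by
    change ‖conj (pair φ (T h))‖ ≤ _
    rw [RCLike.norm_conj]
    calc ‖pair φ (T h)‖ ≤ C * (‖T h‖ + ‖T' h‖) := hb _ (hT h)
      _ ≤ C * (‖T‖ * ‖h‖ + ‖T'‖ * ‖h‖) := by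
        gcongr
        · exact T.le_opNorm h
        · exact T'.le_opNorm h
      _ = _ := by ring
  refine ⟨(InnerProductSpace.toDual ℂ H).symm ℓ, fun h => ?_⟩
  rw [← inner_conj_symm, InnerProductSpace.toDual_symm_apply]
  exact Complex.conj_conj _

theorem inner_dualExt [CompleteSpace H] {T T' : H →L[ℂ] H} (hT : ∀ g, (T g, T' g) ∈ A.adjoint)
    (φ : Minus A) (h : H) : inner ℂ h (dualExt A T φ) = pair φ (T h) :=
  Classical.epsilon_spec (p := fun x => ∀ h, inner ℂ h x = pair φ (T h))
    (exists_inner_eq_pair hT φ) h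

theorem dualExt_eq [CompleteSpace H] {T T' : H →L[ℂ] H} (hT : ∀ g, (T g, T' g) ∈ A.adjoint)
    {φ : Minus A} {x : H} (hx : ∀ h, inner ℂ h x = pair φ (T h)) : dualExt A T φ = x :=
  ext_inner_left ℂ fun h => by rw [inner_dualExt hT, hx]

/-- The values of a generalized resolvent. -/
theorem IsGeneralizedResolvent.exists_clm [CompleteSpace H] {D : Set ℂ} {R : ℂ → H → H}
    (hR : IsGeneralizedResolvent A D R) {z : ℂ} (hz : z ∈ D) :
    ∃ T T' : H →L[ℂ] H, (∀ f, R z f = T f) ∧ (∀ f, R (conj z) f = T' f) ∧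
      (∀ f, (T' f, f + conj z • T' f) ∈ A.adjoint) ∧ ∀ f g, inner ℂ (T' f) g = inner ℂ f (T g) := by
  obtain ⟨K, _, _, _, j, V, B, hj, hjj, -, hV, hB, hAB, rfl, hRz⟩ := hR
  obtain ⟨hz', hadj⟩ := isRegularPoint_conj hjj hB hz
  have key : ∀ w ∈ {z | IsRegularPoint (B : Set (K × K)) z}, ∃ T : H →L[ℂ] H, ∀ f, R w f = T f := by
    intro w hw
    obtain ⟨T, hT⟩ := exists_resolvent_clm (isClosed_of_selfadjoint hB) hw
    refine ⟨ContinuousLinearMap.adjoint V ∘L j ∘L T ∘L V, fun f => ext_inner_left ℂ fun g => ?_⟩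
    rw [hRz w hw, hT]
    exact (ContinuousLinearMap.adjoint_inner_right V g _).symm
  obtain ⟨T, hT⟩ := key z hz
  obtain ⟨T', hT'⟩ := key _ hz'
  refine ⟨T, T', hT, hT', fun f => ?_, fun f g => ?_⟩
  · rw [Submodule.mem_adjoint_iff]
    intro a b hab
    -- An element of `A`, carried into `B` by `V`, is tested against the resolvent pair of `V f`.
    -- The isometry of `V` and the compression formula move the resulting identity back to `H`.
    have h1 := (hB _).mp (resolvent_mem hz' (V f)) _ (hAB _ hab)
    simp only [map_add, map_smul, inner_add_right, inner_smul_right, hV] at h1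
    rw [← hRz _ hz', ← hRz _ hz', hT'] at h1
    simp only [inner_add_right, inner_smul_right]
    rw [← h1, sub_self]
  · rw [← hT, hRz z hz, ← hadj, ← inner_conj_symm, ← hT', hRz _ hz', ← hj, inner_conj_symm]

end Rigging

namespace CanonicalSystem
variable {p : ℕ} {S : CanonicalSystem p}

/-! ## Quasiperiodic selfadjoint extensions -/

theorem zero_mem_Icc : (0 : ℝ) ∈ Icc 0 S.l := left_mem_Icc.mpr S.l_pos.le

theorem l_mem_Icc : S.l ∈ Icc 0 S.l := right_mem_Icc.mpr S.l_pos.le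

theorem rep_zero (hdef : S.Definite) {t : ℝ} (ht : t ∈ Icc 0 S.l) : S.rep 0 t = 0 := by
  have h := rep_smul hdef 0 S.Amax.zero_mem ht
  rwa [zero_smul, zero_smul] at h

/-- The restriction of the maximal relation by the boundary condition `f(l) = c f(0)`. -/
def quasi (hdef : S.Definite) (c : ℂ) : Submodule ℂ (S.L2 × S.L2) where
  carrier := {x | x ∈ S.Amax ∧ S.rep x S.l = c • S.rep x 0}
  zero_mem' := ⟨S.Amax.zero_mem, by
    rw [rep_zero hdef zero_mem_Icc, rep_zero hdef l_mem_Icc, smul_zero]⟩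
  add_mem' := by
    rintro x y ⟨hx, h⟩ ⟨hy, h'⟩
    refine ⟨S.Amax.add_mem hx hy, ?_⟩
    rw [rep_add hdef hx hy zero_mem_Icc, rep_add hdef hx hy l_mem_Icc, h, h', smul_add]
  smul_mem' := by
    rintro d x ⟨hx, h⟩
    refine ⟨S.Amax.smul_mem d hx, ?_⟩
    rw [rep_smul hdef d hx zero_mem_Icc, rep_smul hdef d hx l_mem_Icc, h, smul_comm]

theorem mem_quasi {hdef : S.Definite} {c : ℂ} {x : S.L2 × S.L2} :
    x ∈ quasi hdef c ↔ x ∈ S.Amax ∧ S.rep x S.l = c • S.rep x 0 := Iff.rfl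

theorem solution_mem_quasi {hdef : S.Definite} {c z : ℂ} {v : Fin p → ℂ} :
    (S.solution z v, z • S.solution z v) ∈ quasi hdef c ↔ (S.U z S.l - c • 1) *ᵥ v = 0 := by
  rw [mem_quasi, rep_solution hdef z v l_mem_Icc, rep_solution hdef z v zero_mem_Icc, U_zero,
    one_mulVec, sub_mulVec, smul_mulVec, one_mulVec, sub_eq_zero]
  exact and_iff_right (S.solution_mem_Amax z v)

/-- The boundary condition, imposed on the general solution `T f + U(·, z) v` with `T` solving from
initial value zero, is a linear equation for `v` with matrix `U(l, z) - c`. Definiteness excludes a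
nonzero `v` with zero class. -/
theorem isRegularPoint_quasi {hdef : S.Definite} {c z : ℂ} :
    IsRegularPoint (quasi hdef c : Set (S.L2 × S.L2)) z ↔ IsUnit (S.U z S.l - c • 1) := by
  rw [← Matrix.mulVec_injective_iff_isUnit]
  constructor
  · intro h
    refine (injective_iff_map_eq_zero (Matrix.mulVecLin (S.U z S.l - c • 1))).mpr fun v hv => ?_
    exact solution_eq_zero hdef (h.1 _ (solution_mem_quasi.mpr hv))
  · intro hinj
    have hu := Matrix.mulVec_injective_iff_isUnit.mp hinj
    refine ⟨fun h hh => ?_, fun f => ?_⟩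
    · have h1 := eq_solution z hh.1
      rw [h1] at hh ⊢
      have h2 := solution_mem_quasi.mp hh
      rw [hinj (h2.trans (mulVec_zero _).symm)]
      have h3 := S.solution_smul z 0 0
      rwa [zero_smul, zero_smul] at h3
    · have hm := solutionOp_mem (S := S) z f
      obtain ⟨v, hv⟩ := (Matrix.mulVec_surjective_iff_isUnit.mpr hu)
        (-S.rep (S.solutionOp z f, f + z • S.solutionOp z f) S.l)
      refine ⟨S.solutionOp z f + S.solution z v, ?_⟩
      have h1 : (S.solutionOp z f + S.solution z v, f + z • (S.solutionOp z f + S.solution z v)) =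
          (S.solutionOp z f, f + z • S.solutionOp z f) + (S.solution z v, z • S.solution z v) := by
        rw [Prod.mk_add_mk, smul_add, add_assoc]
      rw [h1]
      refine ⟨S.Amax.add_mem hm (S.solution_mem_Amax z v), ?_⟩
      rw [rep_add hdef hm (S.solution_mem_Amax z v) l_mem_Icc,
        rep_add hdef hm (S.solution_mem_Amax z v) zero_mem_Icc, rep_solutionOp hdef,
        rep_solution hdef z v l_mem_Icc, rep_solution hdef z v zero_mem_Icc, U_zero, one_mulVec,
        zero_add]
      rw [sub_mulVec, smul_mulVec, one_mulVec, sub_eq_iff_eq_add] at hv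
      rw [hv]
      abel

/-- For `|c| = 1` the contributions of the two endpoints to Green's identity are equal. -/
theorem quasi_symmetric {hdef : S.Definite} {c : ℂ} (hc : conj c * c = 1) :
    ∀ x ∈ quasi hdef c, ∀ y ∈ quasi hdef c, inner ℂ y.1 x.2 = inner ℂ y.2 x.1 := by
  rintro x ⟨hx, hx'⟩ y ⟨hy, hy'⟩
  rw [← sub_eq_zero, green hdef hx hy, hx', hy', mulVec_smul, star_smul, smul_dotProduct,
    dotProduct_smul, smul_smul]
  change (conj c * c) • _ - _ = _
  rw [hc, one_smul, sub_self]

/-- Symmetry excludes nonreal eigenvalues, so the square matrix `U(l, z) - c` is injective and hence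
invertible. -/
theorem isRegularPoint_quasi_of_nonreal {hdef : S.Definite} {c z : ℂ} (hc : conj c * c = 1)
    (hz : z ≠ conj z) : IsRegularPoint (quasi hdef c : Set (S.L2 × S.L2)) z := by
  rw [isRegularPoint_quasi, ← Matrix.mulVec_injective_iff_isUnit]
  refine (injective_iff_map_eq_zero (Matrix.mulVecLin (S.U z S.l - c • 1))).mpr fun v hv => ?_
  have hm := solution_mem_quasi (hdef := hdef).mpr hv
  have h := quasi_symmetric hc _ hm _ hm
  simp only [inner_smul_left, inner_smul_right] at h
  rw [← sub_eq_zero, ← sub_mul, mul_eq_zero, sub_eq_zero, or_iff_right hz, inner_self_eq_zero] at h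
  exact solution_eq_zero hdef h

theorem I_ne_conj_I : Complex.I ≠ conj Complex.I := by
  intro h
  have := congrArg Complex.im h
  norm_num at this

theorem quasi_selfadjoint {hdef : S.Definite} {c : ℂ} (hc : conj c * c = 1) (x : S.L2 × S.L2) :
    x ∈ quasi hdef c ↔ ∀ y ∈ quasi hdef c, inner ℂ y.1 x.2 = inner ℂ y.2 x.1 :=
  mem_of_symmetric (quasi_symmetric hc) (isRegularPoint_quasi_of_nonreal hc I_ne_conj_I)
    (isRegularPoint_quasi_of_nonreal hc (by rw [Complex.conj_conj]; exact I_ne_conj_I.symm)) x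

theorem Amin_le_quasi {hdef : S.Definite} {c : ℂ} (hc : conj c * c = 1) :
    S.Amin ≤ quasi hdef c := by
  have hcl : IsClosed (quasi hdef c : Set (S.L2 × S.L2)) :=
    isClosed_of_selfadjoint (j := ContinuousLinearMap.id ℂ S.L2) (quasi_selfadjoint hc)
  refine Submodule.topologicalClosure_minimal _ (fun x hx => ?_) hcl
  obtain ⟨h1, h2, h3⟩ := rep_of_mem_Apre hdef hx
  exact ⟨h1, by rw [h2, h3, smul_zero]⟩

/-- The Hilbert space itself serves as the Pontryagin space, with `j` and `V` the identity; then `j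
+ 1` is multiplication by `2` and has trivial kernel. -/
theorem isGeneralizedResolvent_quasi {hdef : S.Definite} {c : ℂ} (hc : conj c * c = 1) :
    IsGeneralizedResolvent S.Amin {z | IsRegularPoint (quasi hdef c : Set (S.L2 × S.L2)) z}
      (resolvent (quasi hdef c : Set (S.L2 × S.L2))) := by
  refine ⟨S.L2, _, _, inferInstance, ContinuousLinearMap.id ℂ S.L2, ContinuousLinearMap.id ℂ S.L2,
    quasi hdef c, fun _ _ => rfl, fun _ => rfl, ?_, fun _ _ => rfl, quasi_selfadjoint hc,
    fun x hx => Amin_le_quasi hc hx, rfl, fun _ _ _ _ => rfl⟩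
  have h : LinearMap.ker (((ContinuousLinearMap.id ℂ S.L2 : S.L2 →L[ℂ] S.L2) : S.L2 →ₗ[ℂ] S.L2) +
      LinearMap.id) = ⊥ := by
    refine LinearMap.ker_eq_bot'.mpr fun x hx => ?_
    have h2 : (2 : ℂ) • x = 0 := by
      rw [two_smul]
      exact hx
    exact (smul_eq_zero.mp h2).resolve_left two_ne_zero
  rw [h]
  infer_instance

/-- Every complex number is a regular point of some selfadjoint extension. -/
theorem exists_isRegularPoint_quasi (hdef : S.Definite) (z : ℂ) :
    ∃ c : ℂ, conj c * c = 1 ∧ IsRegularPoint (quasi hdef c : Set (S.L2 × S.L2)) z := by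
  -- Only finitely many `c` are eigenvalues of `U(l, z)`, while the unit circle is infinite.
  have hfin : (spectrum ℂ (S.U z S.l)).Finite := Matrix.finite_spectrum _
  have : Infinite Circle :=
    Circle.argEquiv.infinite_iff.mpr (Ioc_infinite (neg_lt_self Real.pi_pos)).to_subtype
  have hinf : (range ((↑) : Circle → ℂ)).Infinite := @infinite_range_of_injective _ _ this _ Circle.coe_injective
  obtain ⟨_, ⟨c, rfl⟩, hc⟩ := hinf.exists_notMem_finite hfin
  refine ⟨c, ?_, isRegularPoint_quasi.mpr ?_⟩
  · exact Complex.normSq_eq_conj_mul_self.symm.trans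
      (by rw [Circle.normSq_coe c, Complex.ofReal_one])
  · rwa [spectrum.notMem_iff, Algebra.algebraMap_eq_smul_one, ← IsUnit.neg_iff, neg_sub] at hc

/-! ## The boundary triplet -/

theorem neg_one_conj_mul : conj (-1 : ℂ) * (-1) = 1 := by simp

theorem A₀_eq (hdef : S.Definite) : S.gauge.A₀ = (quasi hdef (-1) : Set (S.L2 × S.L2)) := by
  ext x
  change x ∈ S.Amin.adjoint ∧ S.Γ₀ x = 0 ↔ x ∈ S.Amax ∧ _
  rw [adjoint_Amin, Γ₀, smul_eq_zero, or_iff_right (by simp), neg_smul, one_smul,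
    add_comm, eq_neg_iff_add_eq_zero]

theorem mem_rhoA₀ (hdef : S.Definite) {z : ℂ} : z ∈ S.gauge.rhoA₀ ↔ IsUnit (S.U z S.l + 1) := by
  change IsRegularPoint S.gauge.A₀ z ↔ _
  rw [A₀_eq hdef, isRegularPoint_quasi, neg_smul, one_smul, sub_neg_eq_add]

theorem isGeneralizedResolvent_R₀ (hdef : S.Definite) :
    IsGeneralizedResolvent S.Amin S.gauge.rhoA₀ S.gauge.R₀ := by
  have h := isGeneralizedResolvent_quasi (hdef := hdef) neg_one_conj_mul
  rw [← A₀_eq hdef] at h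
  exact h

theorem conj_mem_rhoA₀ (hdef : S.Definite) {z : ℂ} (hz : z ∈ S.gauge.rhoA₀) :
    conj z ∈ S.gauge.rhoA₀ := by
  have h : IsRegularPoint S.gauge.A₀ z := hz
  change IsRegularPoint S.gauge.A₀ (conj z)
  rw [A₀_eq hdef] at h ⊢
  exact (isRegularPoint_conj (j := ContinuousLinearMap.id ℂ S.L2) (fun _ => rfl)
    (quasi_selfadjoint neg_one_conj_mul) h).1

theorem I_mem_rhoA₀ (hdef : S.Definite) : Complex.I ∈ S.gauge.rhoA₀ := by
  change IsRegularPoint S.gauge.A₀ _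
  rw [A₀_eq hdef]
  exact isRegularPoint_quasi_of_nonreal neg_one_conj_mul I_ne_conj_I

/-- The number `√2`. -/
def rt : ℂ := ((Real.sqrt 2 : ℝ) : ℂ)

theorem rt_mul_rt : rt * rt = 2 := by
  rw [rt, ← Complex.ofReal_mul, Real.mul_self_sqrt zero_le_two]
  norm_num

theorem rt_ne_zero : rt ≠ 0 := fun h => by
  have := rt_mul_rt
  rw [h] at this
  norm_num at this

theorem one_div_sqrt_two : ((1 / Real.sqrt 2 : ℝ) : ℂ) = rt⁻¹ := by
  rw [rt, one_div, Complex.ofReal_inv]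

theorem conj_rt : conj rt = rt := Complex.conj_ofReal _

theorem rt_inv_mul_rt_inv : rt⁻¹ * rt⁻¹ = 1 / 2 := by
  rw [← mul_inv, rt_mul_rt, one_div]

theorem rt_inv_eq : rt⁻¹ = rt / 2 := by
  rw [← rt_mul_rt]
  field_simp [rt_ne_zero]

theorem Γ₀_eq (x : S.L2 × S.L2) : S.Γ₀ x = rt⁻¹ • (S.rep x 0 + S.rep x S.l) := by
  rw [Γ₀, one_div_sqrt_two]

theorem Γ₁_eq (x : S.L2 × S.L2) : S.Γ₁ x = -rt⁻¹ • (S.J *ᵥ (S.rep x 0 - S.rep x S.l)) := by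
  rw [Γ₁, one_div_sqrt_two]

theorem Γ₀_solution (hdef : S.Definite) (z : ℂ) (v : Fin p → ℂ) :
    S.Γ₀ (S.solution z v, z • S.solution z v) = rt⁻¹ • ((S.U z S.l + 1) *ᵥ v) := by
  rw [Γ₀_eq, rep_solution hdef z v l_mem_Icc, rep_solution hdef z v zero_mem_Icc, U_zero,
    one_mulVec, add_mulVec, one_mulVec, add_comm]

theorem Γ₁_solution (hdef : S.Definite) (z : ℂ) (v : Fin p → ℂ) :
    S.Γ₁ (S.solution z v, z • S.solution z v) = rt⁻¹ • ((S.J * (S.U z S.l - 1)) *ᵥ v) := by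
  rw [Γ₁_eq, rep_solution hdef z v l_mem_Icc, rep_solution hdef z v zero_mem_Icc, U_zero,
    one_mulVec, ← mulVec_mulVec, sub_mulVec, one_mulVec, ← neg_sub (S.U z S.l *ᵥ v), mulVec_neg,
    neg_smul_neg]

theorem inv_mulVec_mulVec {A : Matrix (Fin p) (Fin p) ℂ} (h : IsUnit A) (v : Fin p → ℂ) :
    A⁻¹ *ᵥ (A *ᵥ v) = v := by
  rw [mulVec_mulVec, Matrix.nonsing_inv_mul _ ((Matrix.isUnit_iff_isUnit_det A).mp h), one_mulVec]

theorem mulVec_inv_mulVec {A : Matrix (Fin p) (Fin p) ℂ} (h : IsUnit A) (v : Fin p → ℂ) :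
    A *ᵥ (A⁻¹ *ᵥ v) = v := by
  rw [mulVec_mulVec, Matrix.mul_nonsing_inv _ ((Matrix.isUnit_iff_isUnit_det A).mp h), one_mulVec]

variable (S) in
/-- The matrix `(U(l, z) + I)⁻¹`. -/
def E (z : ℂ) : Matrix (Fin p) (Fin p) ℂ := (S.U z S.l + 1)⁻¹

theorem gammaField_eq (hdef : S.Definite) {z : ℂ} (hz : z ∈ S.gauge.rhoA₀) (u : Fin p → ℂ) :
    S.gauge.gammaField z u = S.solution z (rt • (S.E z *ᵥ u)) := by
  have hu := (mem_rhoA₀ hdef).mp hz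
  have hex : ∃ h, (h, z • h) ∈ S.gauge.A.adjoint ∧ S.gauge.Γ₀ (h, z • h) = u := by
    refine ⟨S.solution z (rt • (S.E z *ᵥ u)), ?_, ?_⟩
    · change _ ∈ S.Amin.adjoint
      rw [adjoint_Amin]
      exact S.solution_mem_Amax _ _
    · refine (Γ₀_solution hdef _ _).trans ?_
      rw [mulVec_smul, E, mulVec_inv_mulVec hu, smul_smul, inv_mul_cancel₀ rt_ne_zero, one_smul]
  obtain ⟨h1, h2⟩ : (S.gauge.gammaField z u, z • S.gauge.gammaField z u) ∈ S.Amin.adjoint ∧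
      S.Γ₀ (S.gauge.gammaField z u, z • S.gauge.gammaField z u) = u :=
    Classical.epsilon_spec hex
  rw [adjoint_Amin] at h1
  have h3 := eq_solution z h1
  set v := S.rep (S.gauge.gammaField z u, z • S.gauge.gammaField z u) 0
  rw [h3, Γ₀_solution hdef] at h2
  rw [h3, ← h2, mulVec_smul, E, inv_mulVec_mulVec hu, smul_smul, mul_inv_cancel₀ rt_ne_zero,
    one_smul]

theorem matrixOf_mulVec (M : Matrix (Fin p) (Fin p) ℂ) : matrixOf (fun v => M *ᵥ v) = M := by
  ext i k
  simp [matrixOf]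

theorem matrixOf_eq {T : (Fin p → ℂ) → Fin p → ℂ} {M : Matrix (Fin p) (Fin p) ℂ}
    (h : ∀ v, T v = M *ᵥ v) : matrixOf T = M := by
  rw [← matrixOf_mulVec M]
  congr 1
  exact funext h

theorem weyl_eq (hdef : S.Definite) {z : ℂ} (hz : z ∈ S.gauge.rhoA₀) :
    S.gauge.weyl z = S.J * (S.U z S.l - 1) * S.E z := by
  refine matrixOf_eq fun u => ?_
  change S.Γ₁ (S.gauge.gammaField z u, z • S.gauge.gammaField z u) = _
  rw [gammaField_eq hdef hz, Γ₁_solution hdef, mulVec_smul, smul_smul, inv_mul_cancel₀ rt_ne_zero,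
    one_smul, mulVec_mulVec]

theorem add_one_mul_E (hdef : S.Definite) {z : ℂ} (hz : z ∈ S.gauge.rhoA₀) :
    (S.U z S.l + 1) * S.E z = 1 :=
  Matrix.mul_nonsing_inv _ ((Matrix.isUnit_iff_isUnit_det _).mp ((mem_rhoA₀ hdef).mp hz))

theorem E_mul_add_one (hdef : S.Definite) {z : ℂ} (hz : z ∈ S.gauge.rhoA₀) :
    S.E z * (S.U z S.l + 1) = 1 :=
  Matrix.nonsing_inv_mul _ ((Matrix.isUnit_iff_isUnit_det _).mp ((mem_rhoA₀ hdef).mp hz))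

/-- `J M` is, up to sign, the Cayley transform `(U - 1)(U + 1)⁻¹`, hence affine in `E`. -/
theorem J_mul_weyl (hdef : S.Definite) {z : ℂ} (hz : z ∈ S.gauge.rhoA₀) :
    S.J * S.gauge.weyl z = 2 • S.E z - 1 := by
  have h : S.U z S.l - 1 = (S.U z S.l + 1) - 2 • 1 := by
    rw [two_smul]
    abel
  rw [weyl_eq hdef hz, mul_assoc S.J, ← mul_assoc S.J S.J, J_mul_J, h, sub_mul,
    add_one_mul_E hdef hz, smul_mul_assoc, one_mul, neg_mul, one_mul, neg_sub]

/-- With `A = U(l, z)` and `B = U(l, conj z)^*`, the relation `B J A = J` is equivalent to the skew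
identity `(B - 1) J (A + 1) = -(B + 1) J (A - 1)`; multiplication by the inverses of `A + 1` and `B
+ 1` gives the claim. -/
theorem weyl_conj (hdef : S.Definite) {z : ℂ} (hz : z ∈ S.gauge.rhoA₀) :
    (S.gauge.weyl (conj z))ᴴ = S.gauge.weyl z := by
  have hz' := conj_mem_rhoA₀ hdef hz
  set A := S.U z S.l with hA
  set B := (S.U (conj z) S.l)ᴴ with hB
  have hBA : B * S.J * A = S.J := U_conjTranspose_mul z
  have h1 : A + 1 * 1 = A + 1 := by rw [mul_one]
  have hE : (A + 1) * S.E z = 1 := add_one_mul_E hdef hz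
  have hE' : (S.E (conj z))ᴴ * (B + 1) = 1 := by
    have := congrArg conjTranspose (add_one_mul_E hdef hz')
    rwa [conjTranspose_mul, conjTranspose_add, conjTranspose_one] at this
  have key : (B - 1) * S.J * (A + 1) = -((B + 1) * S.J * (A - 1)) := by
    simp only [add_mul, sub_mul, mul_add, mul_sub, one_mul, mul_one, hBA]
    abel
  rw [weyl_eq hdef hz, weyl_eq hdef hz', conjTranspose_mul, conjTranspose_mul, conjTranspose_sub,
    conjTranspose_one, S.J_adjoint]
  change (S.E (conj z))ᴴ * ((B - 1) * -S.J) = S.J * (A - 1) * S.E z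
  calc (S.E (conj z))ᴴ * ((B - 1) * -S.J)
      = -((S.E (conj z))ᴴ * ((B - 1) * S.J * ((A + 1) * S.E z))) := by
        rw [hE, mul_one, mul_neg, mul_neg]
    _ = -((S.E (conj z))ᴴ * ((B - 1) * S.J * (A + 1)) * S.E z) := by simp only [mul_assoc]
    _ = ((S.E (conj z))ᴴ * (B + 1)) * (S.J * (A - 1) * S.E z) := by
        rw [key]
        simp only [mul_neg, neg_mul, neg_neg, mul_assoc]
    _ = _ := by rw [hE', one_mul]

theorem K_conjTranspose : S.Kᴴ = S.K := by
  have h : star (1 / 2 : ℂ) = 1 / 2 := by simp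
  rw [K, conjTranspose_mul, conjTranspose_mul, conjTranspose_smul, conjTranspose_add,
    conjTranspose_conjTranspose, S.J_adjoint, h, neg_mul, mul_neg, mul_neg, neg_neg,
    ← mul_assoc, add_comm]

/-- This is the source of `K`: the regularizer averages the resolvents at `i` and `-i`, and `M(i) +
M(i)^* = M(i) + M(-i)` expresses the sum of the two values of `E` through `Re M(i)`. -/
theorem E_add_E_mul_J (hdef : S.Definite) :
    (S.E Complex.I + S.E (-Complex.I)) * S.J = S.J + S.K := by
  have hI := I_mem_rhoA₀ hdef
  have hI' := conj_mem_rhoA₀ hdef hI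
  have h1 := J_mul_weyl hdef hI
  have h2 := J_mul_weyl hdef hI'
  rw [← weyl_conj hdef hI', Complex.conj_conj] at h2
  rw [Complex.conj_I] at h2
  have h3 : S.E Complex.I + S.E (-Complex.I) = 1 + S.J * ((1 / 2 : ℂ) •
      (S.gauge.weyl Complex.I + (S.gauge.weyl Complex.I)ᴴ)) := by
    rw [mul_smul_comm, mul_add, h1, h2]
    module
  rw [h3, add_mul, one_mul, K]

end CanonicalSystem

/-! ### Adjoints and dual extensions of generalized resolvents. -/

section Rigging

variable {H : Type*} [NormedAddCommGroup H] [InnerProductSpace ℂ H] [CompleteSpace H]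
  {A : Submodule ℂ (H × H)} {D : Set ℂ} {R : ℂ → H → H} {z : ℂ}

theorem IsGeneralizedResolvent.mem_adjoint (hR : IsGeneralizedResolvent A D R) (hz : z ∈ D)
    (f : H) : (R (conj z) f, f + conj z • R (conj z) f) ∈ A.adjoint := by
  obtain ⟨T, T', -, h, h', -⟩ := hR.exists_clm hz
  rw [h]
  exact h' f

theorem IsGeneralizedResolvent.inner_left (hR : IsGeneralizedResolvent A D R) (hz : z ∈ D)
    (f g : H) : inner ℂ (R (conj z) f) g = inner ℂ f (R z g) := by
  obtain ⟨T, T', h, h', -, h''⟩ := hR.exists_clm hz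
  rw [h, h', h'']

theorem IsGeneralizedResolvent.inner_dualExt (hR : IsGeneralizedResolvent A D R) (hz : z ∈ D)
    (φ : Minus A) (f : H) : inner ℂ f (dualExt A (R (conj z)) φ) = pair φ (R (conj z) f) := by
  obtain ⟨T, T', -, h, h', -⟩ := hR.exists_clm hz
  have h1 : R (conj z) = T' := funext h
  rw [h1]
  exact LResolvent.inner_dualExt (T' := ContinuousLinearMap.id ℂ H + conj z • T') h' φ f

/-- The extension to `H₋` of the mean value of two values of a generalized resolvent. -/
theorem IsGeneralizedResolvent.dualExt_mean (hR : IsGeneralizedResolvent A D R) {w : ℂ}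
    (hz : z ∈ D) (hw : w ∈ D) (φ : Minus A) :
    dualExt A (fun f => (1 / 2 : ℂ) • (R (conj z) f + R (conj w) f)) φ =
      (1 / 2 : ℂ) • (dualExt A (R (conj z)) φ + dualExt A (R (conj w)) φ) := by
  obtain ⟨-, T, -, h, h', -⟩ := hR.exists_clm hz
  obtain ⟨-, V, -, k, k', -⟩ := hR.exists_clm hw
  have e : (fun f => (1 / 2 : ℂ) • (R (conj z) f + R (conj w) f)) =
      ((1 / 2 : ℂ) • (T + V) : H →L[ℂ] H) := by
    ext f
    rw [h, k]
    rfl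
  rw [e]
  refine dualExt_eq (T' := (1 / 2 : ℂ) • ((ContinuousLinearMap.id ℂ H + conj z • T) +
    (ContinuousLinearMap.id ℂ H + conj w • V)))
    (fun g => A.adjoint.smul_mem _ (A.adjoint.add_mem (h' g) (k' g))) fun f => ?_
  have h1 := mem_Plus (h' f)
  have h2 := mem_Plus (k' f)
  change _ = pair φ ((1 / 2 : ℂ) • (T f + V f))
  rw [pair_smul_right φ _ ((Plus A).add_mem h1 h2), pair_add_right φ h1 h2, inner_smul_right,
    inner_add_right, hR.inner_dualExt hz, hR.inner_dualExt hw, h, k, map_div₀, map_one, map_ofNat]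

end Rigging

namespace CanonicalSystem
variable {p : ℕ} {S : CanonicalSystem p}

/-! ## The gauge -/

theorem mem_adjoint_Amin {x : S.L2 × S.L2} : x ∈ S.Amin.adjoint ↔ x ∈ S.Amax := by
  rw [adjoint_Amin]

theorem mem_Plus_Amin {x : S.L2 × S.L2} (hx : x ∈ S.Amax) : x.1 ∈ Plus S.Amin :=
  mem_Plus (mem_adjoint_Amin.mpr hx)

/-- The functional is defined through a chosen pair over each element of `dom A^*`. The initial
value does not depend on the chosen pair by the hypothesis on `δ`, which gives linearity, and it is
bounded by the graph norm. -/
theorem isDelta_delta (hdef : S.Definite) (hdelta : S.DeltaWellDefined) : S.IsDelta S.delta := by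
  refine Classical.epsilon_spec (p := S.IsDelta) ?_
  have hex : ∀ h : Plus S.Amin, ∃ x ∈ S.Amax, x.1 = h := fun h => by
    obtain ⟨x, hx, e⟩ := h.2
    exact ⟨x, mem_adjoint_Amin.mp hx, e⟩
  choose ext hmem hfst using hex
  have hval : ∀ (h : Plus S.Amin) (x : S.L2 × S.L2), x ∈ S.Amax → x.1 = h →
      S.rep (ext h) 0 = S.rep x 0 := fun h x hx e =>
    rep_zero_eq hdef hdelta (hmem h) hx ((hfst h).trans e.symm)
  obtain ⟨C, hC⟩ := exists_norm_rep_zero_le hdef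
  let d : (Fin p → ℂ) → Minus S.Amin := fun u =>
    ⟨{ toFun := fun h => star (S.rep (ext h) 0) ⬝ᵥ u
       map_add' := fun h k => by
        rw [hval (h + k) (ext h + ext k) (S.Amax.add_mem (hmem h) (hmem k))
          (congrArg₂ (· + ·) (hfst h) (hfst k)), rep_add hdef (hmem h) (hmem k) zero_mem_Icc, star_add,
          add_dotProduct]
       map_smul' := fun c h => by
        rw [hval (c • h) (c • ext h) (S.Amax.smul_mem c (hmem h)) (congrArg (c • ·) (hfst h)),
          rep_smul hdef c (hmem h) zero_mem_Icc, star_smul, smul_dotProduct]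
        rfl }, ∑ i, C * ‖u i‖, fun h h' hh => by
      change ‖star (S.rep (ext h) 0) ⬝ᵥ u‖ ≤ _
      have hm := mem_adjoint_Amin.mp hh
      rw [hval h _ hm rfl, Finset.sum_mul]
      refine (norm_sum_le _ _).trans (Finset.sum_le_sum fun i _ => ?_)
      rw [norm_mul, mul_right_comm]
      refine mul_le_mul_of_nonneg_right ?_ (norm_nonneg _)
      rw [Pi.star_apply, norm_star]
      exact (norm_le_pi_norm _ i).trans (hC _ hm)⟩
  refine ⟨{ toFun := d, map_add' := fun u v => ?_, map_smul' := fun c u => ?_ },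
    fun u f g hfg => ?_⟩
  · exact Subtype.ext (LinearMap.ext fun h =>
      dotProduct_add (star (S.rep (ext h) 0)) u v)
  · exact Subtype.ext (LinearMap.ext fun h =>
      dotProduct_smul c (star (S.rep (ext h) 0)) u)
  · have hm := mem_Amax_of_maxPair hfg
    rw [pair_of_mem _ (mem_Plus_Amin hm)]
    change star (S.rep (ext _) 0) ⬝ᵥ u = _
    rw [hval _ _ hm rfl, rep_eq hdef hfg zero_mem_Icc]

theorem pair_delta (hdef : S.Definite) (hdelta : S.DeltaWellDefined) (u : Fin p → ℂ)
    {x : S.L2 × S.L2} (hx : x ∈ S.Amax) : pair (S.delta u) x.1 = star (S.rep x 0) ⬝ᵥ u := by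
  obtain ⟨f, g, h, rfl⟩ := hx
  rw [rep_eq hdef h zero_mem_Icc]
  exact isDelta_delta hdef hdelta u f g h

theorem pair_L (hdef : S.Definite) (hdelta : S.DeltaWellDefined) (u : Fin p → ℂ)
    {x : S.L2 × S.L2} (hx : x ∈ S.Amax) :
    pair (S.gauge.L u) x.1 = rt * (star (S.rep x 0) ⬝ᵥ u) := by
  rw [← pair_delta hdef hdelta u hx]
  exact pair_smul rt (S.delta u) x.1

theorem pair_L_solution (hdef : S.Definite) (hdelta : S.DeltaWellDefined) (u : Fin p → ℂ) (z : ℂ)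
    (v : Fin p → ℂ) : pair (S.gauge.L u) (S.solution z v) = rt * (star v ⬝ᵥ u) := by
  have h := pair_L hdef hdelta u (S.solution_mem_Amax z v)
  rwa [rep_solution hdef z v zero_mem_Icc, U_zero, one_mulVec] at h

theorem Ldual_eq (hdef : S.Definite) (hdelta : S.DeltaWellDefined) {x : S.L2 × S.L2}
    (hx : x ∈ S.Amax) : S.gauge.Ldual x.1 = rt • S.rep x 0 := by
  ext i
  rw [GaugeData.Ldual, pair_L hdef hdelta _ hx, map_mul, conj_rt]
  simp

theorem L_injective (hdef : S.Definite) (hdelta : S.DeltaWellDefined) :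
    Function.Injective S.gauge.L := by
  refine (injective_iff_map_eq_zero _).mpr fun u hu => eq_of_star_dotProduct_eq fun v => ?_
  have h := pair_L_solution hdef hdelta u 0 v
  have h0 : pair (0 : Minus S.Amin) (S.solution 0 v) = 0 := by
    simpa using pair_smul (0 : ℂ) (0 : Minus S.Amin) (S.solution 0 v)
  rw [hu] at h
  rw [dotProduct_zero]
  exact (mul_eq_zero.mp (h.symm.trans h0)).resolve_left rt_ne_zero

/-- The range of `A - z` is the preimage of the closed relation `A` under the continuous map sending
`g` to the pair built from its solution with initial value zero. -/
theorem isRegularType_Amin (z : ℂ) : IsRegularType S.Amin z := by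
  refine ⟨fun h hh => ?_, ?_⟩
  · have h1 := eq_solutionOp_of_mem_Amin z hh
    rwa [sub_self, map_zero] at h1
  · have h1 : {g : S.L2 | ∃ x ∈ S.Amin, g = x.2 - z • x.1} =
        (fun g => (S.solutionOp z g, g + z • S.solutionOp z g)) ⁻¹' (S.Amin : Set _) := by
      ext g
      constructor
      · rintro ⟨x, hx, rfl⟩
        rw [mem_preimage, ← eq_solutionOp_of_mem_Amin z hx, sub_add_cancel]
        exact hx
      · exact fun hg => ⟨_, hg, (add_sub_cancel_right _ _).symm⟩
    rw [h1]
    exact (Submodule.isClosed_topologicalClosure _).preimage (by fun_prop)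

/-- The range is the full annihilator of `ker (A^* - conj z)`. If `φ` annihilates the solutions, let
`f` be the Riesz representative of `φ` composed with the solution operator at `conj z`; variation of
constants then shows that `(f, φ + z f)` lies in the extended relation. -/
theorem mem_boldRange {z : ℂ} {φ : Minus S.Amin} :
    φ ∈ boldRange S.Amin z ↔ ∀ v, pair φ (S.solution (conj z) v) = 0 := by
  constructor
  · rintro ⟨x, hx, rfl⟩ v
    have hm := mem_adjoint_Amin.mpr (S.solution_mem_Amax (conj z) v)
    have h := hx _ hm
    change pair (x.2 - z • embed S.Amin x.1) _ = 0
    rw [pair_sub, pair_smul, pair_embed _ (mem_Plus hm), h, inner_smul_left, Complex.conj_conj,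
      sub_self]
  · intro h
    have hT : ∀ g, (S.solutionOp (conj z) g,
        (ContinuousLinearMap.id ℂ S.L2 + conj z • S.solutionOp (conj z)) g) ∈ S.Amin.adjoint :=
      fun g => mem_adjoint_Amin.mpr (solutionOp_mem (conj z) g)
    obtain ⟨f, hf⟩ := exists_inner_eq_pair hT φ
    refine ⟨(f, φ + z • embed S.Amin f), fun k hk => ?_, add_sub_cancel_right _ _⟩
    have hk' := mem_adjoint_Amin.mp hk
    have h1 := eq_solutionOp_add_solution (conj z) hk'
    have h2 : pair φ k.1 = inner ℂ (k.2 - conj z • k.1) f := by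
      rw [hf]
      nth_rw 1 [h1]
      rw [pair_add_right φ (mem_Plus (hT _)) (mem_Plus_Amin (S.solution_mem_Amax _ _)), h, add_zero]
    change pair (φ + z • embed S.Amin f) k.1 = _
    rw [pair_add, pair_smul, pair_embed _ (mem_Plus hk), h2, inner_sub_left, inner_smul_left,
      Complex.conj_conj, sub_add_cancel]

theorem eq_zero_of_pair_L (hdef : S.Definite) (hdelta : S.DeltaWellDefined) {u : Fin p → ℂ} {z : ℂ}
    (h : ∀ v, pair (S.gauge.L u) (S.solution z v) = 0) : u = 0 := by
  refine eq_of_star_dotProduct_eq fun v => ?_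
  have h1 := h v
  rw [pair_L_solution hdef hdelta] at h1
  rw [dotProduct_zero]
  exact (mul_eq_zero.mp h1).resolve_left rt_ne_zero

theorem exists_star_dotProduct_eq (ℓ : (Fin p → ℂ) →ₗ[ℂ] ℂ) :
    ∃ u, ∀ v, star v ⬝ᵥ u = conj (ℓ v) := by
  refine ⟨fun i => conj (ℓ (Pi.single i 1)), fun v => ?_⟩
  have h : v = ∑ i, v i • (Pi.single i 1 : Fin p → ℂ) := by
    ext k
    simp [Finset.sum_apply, Pi.single_apply]
  conv_rhs => rw [h]
  rw [map_sum, map_sum]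
  refine Finset.sum_congr rfl fun i _ => ?_
  rw [map_smul, smul_eq_mul, map_mul]
  rfl

theorem exists_star_dotProduct_eq_pair (z : ℂ) (φ : Minus S.gauge.A) :
    ∃ u, ∀ v, star v ⬝ᵥ u = pair φ (S.solution z v) := by
  have hm : ∀ v, S.solution z v ∈ Plus S.gauge.A := fun v =>
    mem_Plus_Amin (S.solution_mem_Amax z v)
  have hadd : ∀ u v, pair φ (S.solution z (u + v)) =
      pair φ (S.solution z u) + pair φ (S.solution z v) := fun u v => by
    rw [solution_add, pair_add_right φ (hm u) (hm v)]
  have hsmul : ∀ (c : ℂ) v, pair φ (S.solution z (c • v)) = conj c * pair φ (S.solution z v) :=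
    fun c v => by rw [solution_smul, pair_smul_right φ c (hm v)]
  obtain ⟨u, hu⟩ := exists_star_dotProduct_eq
    { toFun := fun v => conj (pair φ (S.solution z v))
      map_add' := fun u v => by rw [hadd, map_add]
      map_smul' := fun c v => by
        rw [hsmul, map_mul, Complex.conj_conj]
        rfl }
  exact ⟨u, fun v => (hu v).trans (Complex.conj_conj _)⟩

/-- On the functions `U(·, conj z) v` the functional `L u` takes the values `√2 v^* u`. Hence each
`φ` agrees there with exactly one element of the gauge, and the difference lies in the range. -/
theorem isCompl_boldRange (hdef : S.Definite) (hdelta : S.DeltaWellDefined) (z : ℂ) :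
    IsCompl (LinearMap.range S.gauge.L) (boldRange S.gauge.A z) := by
  constructor
  · rw [Submodule.disjoint_def]
    rintro _ ⟨u, rfl⟩ hu
    rw [eq_zero_of_pair_L hdef hdelta (mem_boldRange.mp hu), map_zero]
  · rw [codisjoint_iff, Submodule.eq_top_iff']
    intro φ
    obtain ⟨u, hu⟩ := exists_star_dotProduct_eq_pair (conj z) φ
    rw [Submodule.mem_sup]
    refine ⟨_, ⟨rt⁻¹ • u, rfl⟩, φ - S.gauge.L (rt⁻¹ • u), mem_boldRange.mpr fun v => ?_,
      add_sub_cancel _ _⟩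
    refine (pair_sub φ (S.gauge.L (rt⁻¹ • u)) _).trans ?_
    rw [← hu, pair_L_solution hdef hdelta, dotProduct_smul, smul_eq_mul,
      mul_inv_cancel_left₀ rt_ne_zero, sub_self]

theorem rhoL_eq (hdef : S.Definite) (hdelta : S.DeltaWellDefined) : S.gauge.rhoL = univ :=
  eq_univ_of_forall fun z => ⟨isRegularType_Amin z, isCompl_boldRange hdef hdelta z⟩

/-! ## The functions `P` and `Q` -/

theorem L_P (hdef : S.Definite) (hdelta : S.DeltaWellDefined) (z : ℂ) (φ : Minus S.gauge.A) :
    S.gauge.L (S.gauge.P z φ) = S.gauge.gaugeProj z φ ∧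
      φ - S.gauge.gaugeProj z φ ∈ boldRange S.gauge.A z := by
  have h := isCompl_boldRange hdef hdelta z
  have e : S.gauge.gaugeProj z φ = Submodule.projection _ _ h φ := by
    rw [GaugeData.gaugeProj, dif_pos h]
  rw [GaugeData.P, e]
  exact ⟨Function.invFun_eq (Submodule.projection_apply_mem h φ),
    Submodule.sub_projection_mem h φ⟩

/-- `φ` and its projection `L (𝒫 φ)` differ by an element of the range, which annihilates the
solutions for `conj z`. Both adjoint formulas in (i) rest on this. -/
theorem rt_mul_star_dotProduct_P (hdef : S.Definite) (hdelta : S.DeltaWellDefined) (z : ℂ)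
    (φ : Minus S.gauge.A) (v : Fin p → ℂ) :
    rt * (star v ⬝ᵥ S.gauge.P z φ) = pair φ (S.solution (conj z) v) := by
  obtain ⟨h1, h2⟩ := L_P hdef hdelta z φ
  rw [← h1] at h2
  rw [← pair_L_solution hdef hdelta _ (conj z), ← sub_eq_zero, ← neg_sub, neg_eq_zero]
  exact (pair_sub _ _ _).symm.trans (mem_boldRange.mp h2 v)

theorem isDualAdjoint_P (hdef : S.Definite) (hdelta : S.DeltaWellDefined) (z : ℂ) :
    IsDualAdjoint (S.gauge.P z) fun v => rt⁻¹ • S.solution (conj z) v := by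
  refine fun v => ⟨?_, fun φ => ?_⟩
  · exact (Plus S.Amin).smul_mem _ (mem_Plus_Amin (S.solution_mem_Amax (conj z) v))
  · refine (pair_smul_right φ _ (mem_Plus_Amin (S.solution_mem_Amax (conj z) v))).trans ?_
    rw [map_inv₀, conj_rt, inv_mul_eq_iff_eq_mul₀ rt_ne_zero]
    exact (rt_mul_star_dotProduct_P hdef hdelta z φ v).symm

/-- The left inverse `-J U(l, conj z)^* J` of `U(l, z)` is also a right inverse. -/
theorem U_mul_J_mul_conjTranspose (z : ℂ) :
    S.U z S.l * S.J * (S.U (conj z) S.l)ᴴ = S.J := by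
  have h := U_conjTranspose_mul (S := S) z
  have h1 : (-(S.J * (S.U (conj z) S.l)ᴴ * S.J)) * S.U z S.l = 1 := by
    rw [neg_mul, mul_assoc, mul_assoc, ← mul_assoc _ S.J, h, J_mul_J, neg_neg]
  have h2 := mul_eq_one_comm.mp h1
  have h3 := congrArg (· * S.J) h2
  simp only [mul_neg, neg_mul, one_mul, ← mul_assoc] at h3
  rw [mul_assoc _ S.J S.J, J_mul_J] at h3
  simpa using h3

/-- The element `w` with `J w' + F w = z H w + H f` and `w(l) = 0`. -/
theorem exists_pair_rep_l_eq_zero (hdef : S.Definite) (hdelta : S.DeltaWellDefined) (z : ℂ)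
    (f : S.L2) : ∃ w, (w, f + z • w) ∈ S.Amax ∧ S.rep (w, f + z • w) S.l = 0 ∧
      S.rep (w, f + z • w) 0 = rt • (S.J *ᵥ S.gauge.P z (embed S.gauge.A f)) := by
  set u := S.gauge.P z (embed S.gauge.A f)
  have hm := solutionOp_mem (S := S) z f
  set a := S.rep (S.solutionOp z f, f + z • S.solutionOp z f) S.l with ha
  have hs := S.solution_mem_Amax z (rt • (S.J *ᵥ u))
  have hw : (S.solutionOp z f + S.solution z (rt • (S.J *ᵥ u)),
      f + z • (S.solutionOp z f + S.solution z (rt • (S.J *ᵥ u)))) =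
      (S.solutionOp z f, f + z • S.solutionOp z f) +
        (S.solution z (rt • (S.J *ᵥ u)), z • S.solution z (rt • (S.J *ᵥ u))) := by
    rw [Prod.mk_add_mk, smul_add, add_assoc]
  -- Green's identity against `U(·, conj z) v`: the zero initial value leaves only the endpoint `l`,
  -- so `√2 𝒫 f` is determined by the terminal value `a`. The added solution then ends at `U J U^* J
  -- a = J² a = -a`.
  have hu : rt • u = (S.U (conj z) S.l)ᴴ *ᵥ (S.J *ᵥ a) := by
    refine eq_of_star_dotProduct_eq fun v => ?_
    have hv := S.solution_mem_Amax (conj z) v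
    have h1 := rt_mul_star_dotProduct_P hdef hdelta z (embed S.gauge.A f) v
    replace h1 := h1.trans (pair_embed f (mem_Plus_Amin hv))
    have h2 := green hdef hm hv
    rw [rep_solution hdef _ v l_mem_Icc, rep_solutionOp hdef, mulVec_zero, dotProduct_zero,
      sub_zero, inner_add_right, inner_smul_right, inner_smul_left, Complex.conj_conj,
      add_sub_cancel_right, star_mulVec_dotProduct] at h2
    rw [dotProduct_smul, smul_eq_mul, ← h2, ← h1]
  refine ⟨_, hw ▸ S.Amax.add_mem hm hs, ?_, ?_⟩
  · rw [hw, rep_add hdef hm hs l_mem_Icc, rep_solution hdef z _ l_mem_Icc, ← mulVec_smul, hu,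
      mulVec_mulVec, mulVec_mulVec, U_mul_J_mul_conjTranspose, mulVec_mulVec, J_mul_J,
      neg_mulVec, one_mulVec, add_neg_cancel]
  · rw [hw, rep_add hdef hm hs zero_mem_Icc, rep_solution hdef z _ zero_mem_Icc, rep_solutionOp hdef,
      U_zero, one_mulVec, zero_add]

/-- Test against `h` and apply Green's identity to `w` and the pair of `R (conj z) h`. The term at
`l` vanishes because `w(l) = 0`, and the term at `0` is exactly the value of `L u` at `R (conj z)
h`. Nothing about `R` enters beyond adjointness and its range in `dom A^*`, so the result is the
same for all generalized resolvents. -/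
theorem sub_dualExt_eq (hdef : S.Definite) (hdelta : S.DeltaWellDefined) {D : Set ℂ}
    {R : ℂ → S.L2 → S.L2} (hR : IsGeneralizedResolvent S.gauge.A D R) {z : ℂ} (hz : z ∈ D) {f w : S.L2}
    {u : Fin p → ℂ} (hw : (w, f + z • w) ∈ S.Amax) (hl : S.rep (w, f + z • w) S.l = 0)
    (h0 : S.rep (w, f + z • w) 0 = rt • (S.J *ᵥ u)) :
    R z f - dualExt S.gauge.A (R (conj z)) (S.gauge.L u) = w := by
  refine ext_inner_left ℂ fun h => ?_
  have hk := mem_adjoint_Amin.mp (hR.mem_adjoint hz h)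
  have h1 := green hdef hw hk
  have h2 : pair (S.gauge.L u) (R (conj z) h) = _ := pair_L hdef hdelta u hk
  rw [hl, h0, mulVec_zero, dotProduct_zero, zero_sub, mulVec_smul, J_mulVec_J_mulVec, smul_neg,
    dotProduct_neg, neg_neg, dotProduct_smul, smul_eq_mul, ← h2, inner_add_right, inner_smul_right,
    inner_add_left, inner_smul_left, Complex.conj_conj] at h1
  rw [inner_sub_right, hR.inner_dualExt hz, ← h1, ← hR.inner_left hz]
  ring

/-- For test pairs with `h(l) = -h(0)`, the boundary form of `U(·, w) c` collapses to `-h(0)^* J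
(U(l, w) + 1) c`. It reproduces the functional `L u` when `(U(l, w) + 1) c = -√2 J u`. -/
theorem dualExt_R₀_L (hdef : S.Definite) (hdelta : S.DeltaWellDefined) {w : ℂ}
    (hw : w ∈ S.gauge.rhoA₀) (u : Fin p → ℂ) :
    dualExt S.gauge.A (S.gauge.R₀ (conj w)) (S.gauge.L u) =
      S.solution w (-rt • (S.E w *ᵥ (S.J *ᵥ u))) := by
  have hR : IsGeneralizedResolvent S.gauge.A _ _ := isGeneralizedResolvent_R₀ hdef
  refine ext_inner_left ℂ fun h => ?_
  set c := -rt • (S.E w *ᵥ (S.J *ᵥ u)) with hc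
  have hk := mem_adjoint_Amin.mp (hR.mem_adjoint hw h)
  have hk' : (S.gauge.R₀ (conj w) h, h + conj w • S.gauge.R₀ (conj w) h) ∈ quasi hdef (-1) := by
    have h1 : IsRegularPoint S.gauge.A₀ (conj w) := conj_mem_rhoA₀ hdef hw
    have h2 := resolvent_mem h1 h
    rw [A₀_eq hdef] at h2
    rw [GaugeData.R₀, A₀_eq hdef]
    exact h2
  have h1 := green hdef (S.solution_mem_Amax w c) hk
  have h2 : pair (S.gauge.L u) (S.gauge.R₀ (conj w) h) = _ := pair_L hdef hdelta u hk
  have h3 : (S.U w S.l + 1) *ᵥ c = -rt • (S.J *ᵥ u) := by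
    rw [hc, mulVec_smul, E, mulVec_inv_mulVec ((mem_rhoA₀ hdef).mp hw)]
  rw [hk'.2, rep_solution hdef w c l_mem_Icc, rep_solution hdef w c zero_mem_Icc, U_zero, neg_smul,
    one_smul, star_neg, neg_dotProduct, ← neg_add', ← dotProduct_add, ← mulVec_add, ← add_mulVec, h3,
    mulVec_smul, J_mulVec_J_mulVec, neg_smul_neg, dotProduct_smul, smul_eq_mul, ← h2,
    inner_smul_right, inner_add_left, inner_smul_left, Complex.conj_conj, sub_add_cancel_right,
    neg_inj] at h1
  rw [hR.inner_dualExt hw, h1]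

theorem dualExt_regularizer_L (hdef : S.Definite) (hdelta : S.DeltaWellDefined) (u : Fin p → ℂ) :
    dualExt S.gauge.A S.gauge.regularizer (S.gauge.L u) = (1 / 2 : ℂ) •
      (S.solution (-Complex.I) (-rt • (S.E (-Complex.I) *ᵥ (S.J *ᵥ u))) +
        S.solution Complex.I (-rt • (S.E Complex.I *ᵥ (S.J *ᵥ u)))) := by
  have hI := I_mem_rhoA₀ hdef
  have hI' := conj_mem_rhoA₀ hdef hI
  have hR : IsGeneralizedResolvent S.gauge.A _ _ := isGeneralizedResolvent_R₀ hdef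
  have h := hR.dualExt_mean hI' hI (S.gauge.L u)
  rw [dualExt_R₀_L hdef hdelta hI, dualExt_R₀_L hdef hdelta hI', Complex.conj_conj,
    Complex.conj_I] at h
  exact h

theorem Ldual_dualExt_regularizer (hdef : S.Definite) (hdelta : S.DeltaWellDefined)
    (u : Fin p → ℂ) : dualExt S.gauge.A S.gauge.regularizer (S.gauge.L u) ∈ Plus S.Amin ∧
      S.gauge.Ldual (dualExt S.gauge.A S.gauge.regularizer (S.gauge.L u)) = -((S.J + S.K) *ᵥ u) := by
  have h1 := S.solution_mem_Amax (-Complex.I) (-rt • (S.E (-Complex.I) *ᵥ (S.J *ᵥ u)))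
  have h2 := S.solution_mem_Amax Complex.I (-rt • (S.E Complex.I *ᵥ (S.J *ᵥ u)))
  have h3 := S.Amax.smul_mem (1 / 2 : ℂ) (S.Amax.add_mem h1 h2)
  rw [dualExt_regularizer_L hdef hdelta]
  refine ⟨mem_Plus_Amin h3, (Ldual_eq hdef hdelta h3).trans ?_⟩
  rw [rep_smul hdef _ (S.Amax.add_mem h1 h2) zero_mem_Icc, rep_add hdef h1 h2 zero_mem_Icc,
    rep_solution hdef _ _ zero_mem_Icc, rep_solution hdef _ _ zero_mem_Icc, U_zero, U_zero,
    one_mulVec, one_mulVec, ← smul_add, ← add_mulVec, mulVec_mulVec, add_comm (S.E _),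
    E_add_E_mul_J hdef, smul_smul, smul_smul, ← neg_one_smul ℂ (_ *ᵥ u)]
  congr 1
  linear_combination (-1 / 2 : ℂ) * rt_mul_rt

theorem Ldual_add (hdef : S.Definite) (hdelta : S.DeltaWellDefined) {x y : S.L2}
    (hx : x ∈ Plus S.Amin) (hy : y ∈ Plus S.Amin) :
    S.gauge.Ldual (x + y) = S.gauge.Ldual x + S.gauge.Ldual y := by
  obtain ⟨x, hx, rfl⟩ := hx
  obtain ⟨y, hy, rfl⟩ := hy
  have hx' := mem_adjoint_Amin.mp hx
  have hy' := mem_adjoint_Amin.mp hy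
  refine (Ldual_eq hdef hdelta (S.Amax.add_mem hx' hy')).trans ?_
  rw [rep_add hdef hx' hy' zero_mem_Icc, smul_add]
  exact (congrArg₂ (· + ·) (Ldual_eq hdef hdelta hx') (Ldual_eq hdef hdelta hy')).symm

theorem Ldual_sub (hdef : S.Definite) (hdelta : S.DeltaWellDefined) {x y : S.L2}
    (hx : x ∈ Plus S.Amin) (hy : y ∈ Plus S.Amin) :
    S.gauge.Ldual (x - y) = S.gauge.Ldual x - S.gauge.Ldual y := by
  rw [eq_sub_iff_add_eq, ← Ldual_add hdef hdelta ((Plus S.Amin).sub_mem hx hy) hy, sub_add_cancel]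

theorem Ldual_regExt_L (hdef : S.Definite) (hdelta : S.DeltaWellDefined) {w : ℂ}
    (hw : w ∈ S.gauge.rhoA₀) (u : Fin p → ℂ) :
    S.gauge.Ldual (S.gauge.regExt S.gauge.R₀ w (S.gauge.L u)) =
      (S.J + S.K - 2 • S.E w * S.J) *ᵥ u := by
  obtain ⟨h1, h2⟩ := Ldual_dualExt_regularizer hdef hdelta u
  have h3 := dualExt_R₀_L hdef hdelta hw u
  have h4 := S.solution_mem_Amax w (-rt • (S.E w *ᵥ (S.J *ᵥ u)))
  have h5 := Ldual_eq hdef hdelta h4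
  rw [rep_solution hdef _ _ zero_mem_Icc, U_zero, one_mulVec, smul_smul] at h5
  refine (congrArg (fun x => S.gauge.Ldual (x - _)) h3).trans ?_
  refine (Ldual_sub hdef hdelta (mem_Plus_Amin h4) h1).trans ?_
  refine (congrArg₂ (· - ·) h5 h2).trans ?_
  rw [mul_neg, rt_mul_rt, mulVec_mulVec, sub_mulVec, sub_neg_eq_add, smul_mul_assoc,
    smul_mulVec, neg_smul, ofNat_smul_eq_nsmul]
  abel

/-- The unregularized difference has initial value `√2 J u` with `u = 𝒫 f`, so `L^{⟨*⟩}` sends it to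
`2 J u`. The regularizer adds `-(J + K) u`, and the total `(J - K) u` is free of the generalized
resolvent. -/
theorem isQ_iff (hdef : S.Definite) (hdelta : S.DeltaWellDefined) (z : ℂ)
    (Q : S.L2 → Fin p → ℂ) :
    S.gauge.IsQ z Q ↔ Q = fun f => (S.J - S.K) *ᵥ S.gauge.P z (embed S.gauge.A f) := by
  have key : ∀ D R, IsGeneralizedResolvent S.gauge.A D R → z ∈ D → ∀ f : S.L2,
      S.gauge.Ldual (R z f - S.gauge.regExt R z (S.gauge.gaugeProj z (embed S.gauge.A f))) =
        (S.J - S.K) *ᵥ S.gauge.P z (embed S.gauge.A f) := by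
    intro D R hR hz f
    obtain ⟨w, h1, h2, h3⟩ := exists_pair_rep_l_eq_zero hdef hdelta z f
    obtain ⟨h4, h5⟩ := Ldual_dualExt_regularizer hdef hdelta (S.gauge.P z (embed S.gauge.A f))
    have h6 := sub_dualExt_eq hdef hdelta hR hz h1 h2 h3
    have h7 := Ldual_eq hdef hdelta h1
    rw [← (L_P hdef hdelta z (embed S.gauge.A f)).1, GaugeData.regExt, sub_sub_eq_add_sub,
      add_sub_right_comm, h6, Ldual_add hdef hdelta (mem_Plus_Amin h1) h4, h5, h7, h3, smul_smul,
      rt_mul_rt, add_mulVec, sub_mulVec, two_smul]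
    abel
  constructor
  · rintro ⟨D, R, hR, hz, hQ⟩
    exact funext fun f => (hQ f).trans (key D R hR hz f)
  · rintro rfl
    obtain ⟨c, hc, hz⟩ := exists_isRegularPoint_quasi hdef z
    exact ⟨_, _, isGeneralizedResolvent_quasi hc, hz,
      fun f => (key _ _ (isGeneralizedResolvent_quasi hc) hz f).symm⟩

theorem Q_eq (hdef : S.Definite) (hdelta : S.DeltaWellDefined) (z : ℂ) :
    S.gauge.Q z = fun f => (S.J - S.K) *ᵥ S.gauge.P z (embed S.gauge.A f) :=
  (isQ_iff hdef hdelta z _).mp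
    (Classical.epsilon_spec ⟨_, (isQ_iff hdef hdelta z _).mpr rfl⟩)

theorem existsUnique_isQ (hdef : S.Definite) (hdelta : S.DeltaWellDefined) (z : ℂ) :
    ∃! Q, S.gauge.IsQ z Q :=
  ⟨_, (isQ_iff hdef hdelta z _).mpr rfl, fun Q hQ => (isQ_iff hdef hdelta z Q).mp hQ⟩

theorem isHilbertAdjoint_Q (hdef : S.Definite) (hdelta : S.DeltaWellDefined) (z : ℂ) :
    IsHilbertAdjoint (S.gauge.Q z)
      fun v => -rt⁻¹ • S.solution (conj z) ((S.J + S.K) *ᵥ v) := by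
  intro v f
  have h := rt_mul_star_dotProduct_P hdef hdelta z (embed S.gauge.A f) ((S.J + S.K) *ᵥ v)
  replace h := h.trans (pair_embed f (mem_Plus_Amin (S.solution_mem_Amax (conj z) _)))
  rw [star_mulVec_dotProduct,
    conjTranspose_add, S.J_adjoint, K_conjTranspose, neg_add_eq_sub, ← neg_sub S.J, neg_mulVec,
    dotProduct_neg] at h
  rw [Q_eq hdef hdelta, inner_smul_left, ← h, map_neg, map_inv₀, conj_rt, mul_neg,
    neg_mul_neg, inv_mul_cancel_left₀ rt_ne_zero]

theorem Pdual_eq (hdef : S.Definite) (hdelta : S.DeltaWellDefined) (z : ℂ) (v : Fin p → ℂ) :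
    S.gauge.Pdual z v = rt⁻¹ • S.solution (conj z) v := by
  have h := isDualAdjoint_P hdef hdelta z
  have h' : IsDualAdjoint (S.gauge.P z) (S.gauge.Pdual z) := Classical.epsilon_spec ⟨_, h⟩
  refine ext_inner_right ℂ fun f => ?_
  rw [← pair_embed f (h v).1, ← pair_embed f (h' v).1, (h v).2, (h' v).2]

theorem Qdual_eq (hdef : S.Definite) (hdelta : S.DeltaWellDefined) (z : ℂ) (v : Fin p → ℂ) :
    S.gauge.Qdual z v = -rt⁻¹ • S.solution (conj z) ((S.J + S.K) *ᵥ v) := by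
  have h := isHilbertAdjoint_Q hdef hdelta z
  have h' : IsHilbertAdjoint (S.gauge.Q z) (S.gauge.Qdual z) := Classical.epsilon_spec ⟨_, h⟩
  exact ext_inner_right ℂ fun f => (h' v f).trans (h v f).symm

/-! ## The extended boundary maps -/

theorem star_J_mulVec_dotProduct_eq (u v : Fin p → ℂ) :
    star (S.J *ᵥ u) ⬝ᵥ v = -(star u ⬝ᵥ (S.J *ᵥ v)) := by
  rw [star_mulVec_dotProduct, S.J_adjoint, neg_mulVec, dotProduct_neg]

theorem green_Γ (hdef : S.Definite) {x y : S.L2 × S.L2} (hx : x ∈ S.Amax) (hy : y ∈ S.Amax) :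
    inner ℂ y.1 x.2 - inner ℂ y.2 x.1 = star (S.Γ₀ y) ⬝ᵥ S.Γ₁ x - star (S.Γ₁ y) ⬝ᵥ S.Γ₀ x := by
  have hrt : star rt⁻¹ = rt⁻¹ := (map_inv₀ (starRingEnd ℂ) rt).trans (by rw [conj_rt])
  have hr := rt_inv_mul_rt_inv
  rw [green hdef hx hy, Γ₀_eq, Γ₁_eq, Γ₀_eq, Γ₁_eq]
  simp only [star_smul, star_neg, hrt, smul_dotProduct, dotProduct_smul, star_J_mulVec_dotProduct_eq,
    star_add, star_sub, add_dotProduct, sub_dotProduct, dotProduct_add, dotProduct_sub, mulVec_sub,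
    smul_eq_mul]
  linear_combination (-2 * (star (S.rep y S.l) ⬝ᵥ (S.J *ᵥ S.rep x S.l) -
      star (S.rep y 0) ⬝ᵥ (S.J *ᵥ S.rep x 0))) * hr

theorem Γ₀_add_J_mulVec_Γ₁ (x : S.L2 × S.L2) : S.Γ₀ x + S.J *ᵥ S.Γ₁ x = rt • S.rep x 0 := by
  rw [Γ₀_eq, Γ₁_eq, mulVec_smul, J_mulVec_J_mulVec, neg_smul_neg, ← smul_add, add_add_sub_cancel,
    ← two_smul ℂ, smul_smul, rt_inv_eq]
  congr 1
  ring

/-- The value of the functional `L v` in terms of `Γ₀, Γ₁`; compared with the abstract Green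
identity, it says that `L v` contributes the boundary values `(J v, v)`. -/
theorem rt_mul_star_rep_dotProduct (x : S.L2 × S.L2) (v : Fin p → ℂ) :
    rt * (star (S.rep x 0) ⬝ᵥ v) = star (S.Γ₀ x) ⬝ᵥ v - star (S.Γ₁ x) ⬝ᵥ (S.J *ᵥ v) := by
  have h : star (rt • S.rep x 0) ⬝ᵥ v = rt * (star (S.rep x 0) ⬝ᵥ v) := by
    rw [star_smul, smul_dotProduct]
    exact congrArg (· * _) conj_rt
  rw [← h, ← Γ₀_add_J_mulVec_Γ₁, star_add, add_dotProduct, star_J_mulVec_dotProduct_eq,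
    sub_eq_add_neg]

theorem gammaField_mem (hdef : S.Definite) {z : ℂ} (hz : z ∈ S.gauge.rhoA₀) (u : Fin p → ℂ) :
    (S.gauge.gammaField z u, z • S.gauge.gammaField z u) ∈ S.Amax := by
  rw [gammaField_eq hdef hz]
  exact S.solution_mem_Amax _ _

theorem Γ₀_gammaField (hdef : S.Definite) {z : ℂ} (hz : z ∈ S.gauge.rhoA₀) (u : Fin p → ℂ) :
    S.Γ₀ (S.gauge.gammaField z u, z • S.gauge.gammaField z u) = u := by
  rw [gammaField_eq hdef hz, Γ₀_solution hdef, mulVec_smul, E,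
    mulVec_inv_mulVec ((mem_rhoA₀ hdef).mp hz), smul_smul, inv_mul_cancel₀ rt_ne_zero, one_smul]

theorem Γ₁_gammaField (hdef : S.Definite) {z : ℂ} (hz : z ∈ S.gauge.rhoA₀) (u : Fin p → ℂ) :
    S.Γ₁ (S.gauge.gammaField z u, z • S.gauge.gammaField z u) = S.gauge.weyl z *ᵥ u := by
  rw [gammaField_eq hdef hz, Γ₁_solution hdef, mulVec_smul, smul_smul, inv_mul_cancel₀ rt_ne_zero,
    one_smul, mulVec_mulVec, weyl_eq hdef hz]

theorem star_dotProduct_gammaDual (hdef : S.Definite) {z : ℂ} (hz : z ∈ S.gauge.rhoA₀)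
    (φ : Minus S.gauge.A) (u : Fin p → ℂ) :
    star u ⬝ᵥ S.gauge.gammaDual z φ = pair φ (S.gauge.gammaField z u) := by
  obtain ⟨c, hc⟩ := exists_star_dotProduct_eq_pair z φ
  have h : ∀ v, star v ⬝ᵥ (rt • ((S.E z)ᴴ *ᵥ c)) = pair φ (S.gauge.gammaField z v) := fun v => by
    rw [gammaField_eq hdef hz, ← hc, ← mulVec_smul, ← star_mulVec_dotProduct, star_smul,
      smul_dotProduct, dotProduct_smul]
    exact congrArg (· * _) conj_rt.symm
  have h2 : S.gauge.gammaDual z φ = rt • ((S.E z)ᴴ *ᵥ c) := by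
    ext i
    rw [GaugeData.gammaDual, ← h]
    simp
  rw [h2, h]

theorem R₀_pair_mem {z : ℂ} (hz : z ∈ S.gauge.rhoA₀) (f : S.L2) :
    (S.gauge.R₀ z f, f + z • S.gauge.R₀ z f) ∈ S.Amax ∧
      S.Γ₀ (S.gauge.R₀ z f, f + z • S.gauge.R₀ z f) = 0 := by
  have h : IsRegularPoint S.gauge.A₀ z := hz
  obtain ⟨h1, h2⟩ := resolvent_mem h f
  exact ⟨mem_adjoint_Amin.mp h1, h2⟩

theorem Γ₀_sub (hdef : S.Definite) {x y : S.L2 × S.L2} (hx : x ∈ S.Amax) (hy : y ∈ S.Amax) :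
    S.Γ₀ (x - y) = S.Γ₀ x - S.Γ₀ y := by
  rw [Γ₀_eq, Γ₀_eq, Γ₀_eq, rep_sub hdef hx hy zero_mem_Icc, rep_sub hdef hx hy l_mem_Icc, ← smul_sub,
    add_sub_add_comm]

theorem eq_gammaField (hdef : S.Definite) {z : ℂ} (hz : z ∈ S.gauge.rhoA₀) {h : S.L2}
    (hh : (h, z • h) ∈ S.Amax) : h = S.gauge.gammaField z (S.Γ₀ (h, z • h)) := by
  have h1 := eq_solution z hh
  rw [gammaField_eq hdef hz]
  generalize S.rep (h, z • h) 0 = v at h1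
  rw [h1, Γ₀_solution hdef, mulVec_smul, E, inv_mulVec_mulVec ((mem_rhoA₀ hdef).mp hz), smul_smul,
    mul_inv_cancel₀ rt_ne_zero, one_smul]

/-- The decomposition of `A^*` into `A₀` and the pairs `(h, z h)`: subtraction of the resolvent pair
leaves an element of `ker (A^* - z)` with the same `Γ₀`. -/
theorem fst_eq_R₀_add_gammaField (hdef : S.Definite) {z : ℂ} (hz : z ∈ S.gauge.rhoA₀)
    {h : S.L2 × S.L2} (hh : h ∈ S.Amax) :
    h.1 = S.gauge.R₀ z (h.2 - z • h.1) + S.gauge.gammaField z (S.Γ₀ h) := by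
  obtain ⟨h1, h2⟩ := R₀_pair_mem hz (h.2 - z • h.1)
  set k := S.gauge.R₀ z (h.2 - z • h.1)
  have h3 : (h.1 - k, z • (h.1 - k)) = h - (k, h.2 - z • h.1 + z • k) := by
    refine Prod.ext rfl ?_
    change z • (h.1 - k) = h.2 - (h.2 - z • h.1 + z • k)
    rw [smul_sub]
    abel
  have h4 := S.Amax.sub_mem hh h1
  rw [← h3] at h4
  have h5 := eq_gammaField hdef hz h4
  rw [h3, Γ₀_sub hdef hh h1, h2, sub_zero] at h5
  rw [← h5, add_sub_cancel]

/-- The abstract Green identity that determines the extended boundary values. -/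
theorem pair_sub_inner_eq (hdef : S.Definite) {x : S.L2 × Minus S.gauge.A}
    {b : (Fin p → ℂ) × (Fin p → ℂ)} (hb : S.gauge.IsExtBoundaryValue x b) {h : S.L2 × S.L2}
    (hh : h ∈ S.Amax) :
    pair x.2 h.1 - inner ℂ h.2 x.1 = star (S.Γ₀ h) ⬝ᵥ b.2 - star (S.Γ₁ h) ⬝ᵥ b.1 := by
  obtain ⟨w, hw, φ, u, h1, h2, h3, h4⟩ := hb
  have hw' := conj_mem_rhoA₀ hdef hw
  have hR : IsGeneralizedResolvent S.gauge.A _ _ := isGeneralizedResolvent_R₀ hdef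
  have hP : h.1 ∈ Plus S.gauge.A := mem_Plus_Amin hh
  set g := S.gauge.gammaField w u
  set r := dualExt S.gauge.A (S.gauge.R₀ (conj w)) φ with hr
  have e1 : pair φ h.1 = inner ℂ (h.2 - conj w • h.1) r +
      star (S.Γ₀ h) ⬝ᵥ S.gauge.gammaDual (conj w) φ := by
    rw [hr, hR.inner_dualExt hw, star_dotProduct_gammaDual hdef hw',
      ← pair_add_right φ (mem_Plus_Amin (R₀_pair_mem hw' _).1)
        (mem_Plus_Amin (gammaField_mem hdef hw' _)), ← fst_eq_R₀_add_gammaField hdef hw' hh]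
  have e2 := green_Γ hdef (gammaField_mem hdef hw u) hh
  have h3' : b.1 = S.Γ₀ (g, w • g) := h3
  have h4' : b.2 = S.gauge.gammaDual (conj w) φ + S.Γ₁ (g, w • g) := h4
  change inner ℂ h.1 (w • g) - inner ℂ h.2 g = star (S.Γ₀ h) ⬝ᵥ S.Γ₁ (g, w • g) -
    star (S.Γ₁ h) ⬝ᵥ S.Γ₀ (g, w • g) at e2
  rw [inner_sub_left, inner_smul_left, Complex.conj_conj] at e1
  rw [inner_smul_right] at e2
  rw [h1, h2, h3', h4', pair_add, pair_add, pair_smul, pair_smul, pair_embed _ hP, pair_embed _ hP,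
    e1, inner_add_right, dotProduct_add]
  linear_combination e2

/-- The boundary values are nondegenerate. Testing with `γ(-i) u` gives `d = M(i) c`; testing with
`γ(i) c` makes the boundary form of that element with itself vanish, so `γ(i) c = 0` because `i` is
not real. -/
theorem eq_zero_of_forall_Γ (hdef : S.Definite) {c d : Fin p → ℂ}
    (h : ∀ x ∈ S.Amax, star (S.Γ₀ x) ⬝ᵥ d = star (S.Γ₁ x) ⬝ᵥ c) : c = 0 ∧ d = 0 := by
  have hI := I_mem_rhoA₀ hdef
  have hI' := conj_mem_rhoA₀ hdef hI
  have h1 : d = S.gauge.weyl Complex.I *ᵥ c := by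
    refine eq_of_star_dotProduct_eq fun u => ?_
    have := h _ (gammaField_mem hdef hI' u)
    rwa [Γ₀_gammaField hdef hI', Γ₁_gammaField hdef hI', star_mulVec_dotProduct,
      weyl_conj hdef hI] at this
  have hm := gammaField_mem hdef hI c
  have h2 := h _ hm
  have h3 := green_Γ hdef hm hm
  rw [Γ₁_gammaField hdef hI, Γ₀_gammaField hdef hI, ← h1] at h2 h3
  rw [h2, sub_self] at h3
  simp only [inner_smul_left, inner_smul_right] at h3
  rw [← sub_mul, mul_eq_zero, sub_eq_zero, or_iff_right I_ne_conj_I, inner_self_eq_zero,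
    gammaField_eq hdef hI] at h3
  have h4 := Γ₀_gammaField hdef hI c
  rw [gammaField_eq hdef hI, Γ₀_solution hdef, solution_eq_zero hdef h3, mulVec_zero,
    smul_zero] at h4
  subst h4
  exact ⟨rfl, h1.trans (mulVec_zero _)⟩

theorem boundaryValue_unique (hdef : S.Definite) {b c : (Fin p → ℂ) × (Fin p → ℂ)}
    (h : ∀ x ∈ S.Amax, star (S.Γ₀ x) ⬝ᵥ b.2 - star (S.Γ₁ x) ⬝ᵥ b.1 =
      star (S.Γ₀ x) ⬝ᵥ c.2 - star (S.Γ₁ x) ⬝ᵥ c.1) : b = c := by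
  obtain ⟨h1, h2⟩ := eq_zero_of_forall_Γ hdef (c := b.1 - c.1) (d := b.2 - c.2) fun x hx => by
    rw [dotProduct_sub, dotProduct_sub]
    linear_combination h x hx
  exact Prod.ext (sub_eq_zero.mp h1) (sub_eq_zero.mp h2)

/-- The abstract Green identity characterizes the extended boundary values. -/
theorem isExtBoundaryValue_of_forall (hdef : S.Definite) {x : S.L2 × Minus S.gauge.A}
    {b : (Fin p → ℂ) × (Fin p → ℂ)}
    (h : ∀ h ∈ S.Amax, pair x.2 h.1 - inner ℂ h.2 x.1 =
      star (S.Γ₀ h) ⬝ᵥ b.2 - star (S.Γ₁ h) ⬝ᵥ b.1) : S.gauge.IsExtBoundaryValue x b := by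
  have hI := I_mem_rhoA₀ hdef
  have hI' := conj_mem_rhoA₀ hdef hI
  have hR : IsGeneralizedResolvent S.gauge.A _ _ := isGeneralizedResolvent_R₀ hdef
  -- The decomposition is built at the point `i`. Testing the Green identity with the pairs of
  -- `R⁰_{-i} f`, for which `Γ₀ = 0`, identifies `x.1` without knowledge of `b₁`; uniqueness then
  -- forces `b₁`.
  set φ := x.2 - Complex.I • embed S.gauge.A x.1 with hφ
  have hmg := gammaField_mem hdef hI b.1
  have h0 := Γ₀_gammaField hdef hI b.1
  set g := S.gauge.gammaField Complex.I b.1 with hg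
  have hx : x.1 = dualExt S.gauge.A (S.gauge.R₀ (conj Complex.I)) φ + g := by
    refine ext_inner_left ℂ fun f => ?_
    obtain ⟨hk, hk0⟩ := R₀_pair_mem hI' f
    have e1 := h _ hk
    have e2 := green_Γ hdef hmg hk
    have hP : S.gauge.R₀ (conj Complex.I) f ∈ Plus S.gauge.A := mem_Plus_Amin hk
    rw [hk0, star_zero, zero_dotProduct, zero_sub] at e1 e2
    rw [h0] at e2
    simp only [inner_add_left, inner_smul_left, inner_smul_right, Complex.conj_conj] at e1 e2
    rw [inner_add_right, hR.inner_dualExt hI, hφ, pair_sub, pair_smul, pair_embed _ hP]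
    linear_combination e2 - e1
  have hx2 : x.2 = (φ + Complex.I • embed S.gauge.A
      (dualExt S.gauge.A (S.gauge.R₀ (conj Complex.I)) φ)) + Complex.I • embed S.gauge.A g := by
    rw [add_assoc, ← smul_add, ← map_add, ← hx, hφ, sub_add_cancel]
  have hext : S.gauge.IsExtBoundaryValue x
      (b.1, S.gauge.gammaDual (conj Complex.I) φ + S.Γ₁ (g, Complex.I • g)) :=
    ⟨Complex.I, hI, φ, b.1, hx, hx2, h0.symm, rfl⟩
  have e : b = (b.1, S.gauge.gammaDual (conj Complex.I) φ + S.Γ₁ (g, Complex.I • g)) :=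
    boundaryValue_unique hdef fun k hk => (h k hk).symm.trans (pair_sub_inner_eq hdef hext hk)
  rw [e]
  exact hext

/-- Any pair that satisfies the abstract Green identity is the pair of extended boundary values, so
these are computed without an explicit decomposition of `x`. -/
theorem Γhat_eq (hdef : S.Definite) {x : S.L2 × Minus S.gauge.A}
    {b : (Fin p → ℂ) × (Fin p → ℂ)}
    (h : ∀ h ∈ S.Amax, pair x.2 h.1 - inner ℂ h.2 x.1 =
      star (S.Γ₀ h) ⬝ᵥ b.2 - star (S.Γ₁ h) ⬝ᵥ b.1) :
    S.gauge.Γhat₀ x = b.1 ∧ S.gauge.Γhat₁ x = b.2 := by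
  have h1 : S.gauge.IsExtBoundaryValue x (Classical.epsilon (S.gauge.IsExtBoundaryValue x)) :=
    Classical.epsilon_spec ⟨b, isExtBoundaryValue_of_forall hdef h⟩
  have h2 : Classical.epsilon (S.gauge.IsExtBoundaryValue x) = b :=
    boundaryValue_unique hdef fun k hk => (pair_sub_inner_eq hdef h1 hk).symm.trans (h k hk)
  exact ⟨congrArg Prod.fst h2, congrArg Prod.snd h2⟩

/-! ## The resolvent matrices -/

theorem Γ_smul_solution (hdef : S.Definite) (c z : ℂ) (v : Fin p → ℂ) :
    (c • S.solution z v, z • c • S.solution z v) ∈ S.Amax ∧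
      S.Γ₀ (c • S.solution z v, z • c • S.solution z v) = (c * rt⁻¹) • ((S.U z S.l + 1) *ᵥ v) ∧
      S.Γ₁ (c • S.solution z v, z • c • S.solution z v) =
        (c * rt⁻¹) • ((S.J * (S.U z S.l - 1)) *ᵥ v) := by
  rw [← solution_smul, Γ₀_solution hdef, Γ₁_solution hdef, mulVec_smul, mulVec_smul, smul_smul,
    smul_smul, mul_comm]
  exact ⟨S.solution_mem_Amax _ _, rfl, rfl⟩

theorem Γhat_PhatDual (hdef : S.Definite) (hdelta : S.DeltaWellDefined) (z : ℂ) (v : Fin p → ℂ) :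
    S.gauge.Γhat₀ (S.gauge.PhatDual z v) = ((1 / 2 : ℂ) • (S.U (conj z) S.l + 1)) *ᵥ v ∧
      S.gauge.Γhat₁ (S.gauge.PhatDual z v) =
        ((1 / 2 : ℂ) • (S.J * (S.U (conj z) S.l - 1))) *ᵥ v := by
  obtain ⟨h1, h2, h3⟩ := Γ_smul_solution hdef rt⁻¹ (conj z) v
  rw [rt_inv_mul_rt_inv] at h2 h3
  rw [smul_mulVec, smul_mulVec, ← h2, ← h3]
  refine Γhat_eq hdef (b := (_, _)) fun h hh => ?_
  have hP : h.1 ∈ Plus S.gauge.A := mem_Plus_Amin hh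
  have h4 := green_Γ hdef h1 hh
  rw [inner_smul_right] at h4
  rw [GaugeData.PhatDual, Pdual_eq hdef hdelta, pair_smul, pair_embed _ hP]
  exact h4

/-- The part along `𝒬^* v` is an ordinary element of `ker (A^* - conj z)` with known boundary
values; the extra summand `L v` adds `(J v, v)`. -/
theorem Γhat_QhatDual (hdef : S.Definite) (hdelta : S.DeltaWellDefined) (z : ℂ) (v : Fin p → ℂ) :
    S.gauge.Γhat₀ (S.gauge.QhatDual z v) =
        (S.J - (1 / 2 : ℂ) • ((S.U (conj z) S.l + 1) * (S.J + S.K))) *ᵥ v ∧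
      S.gauge.Γhat₁ (S.gauge.QhatDual z v) =
        (1 - (1 / 2 : ℂ) • (S.J * (S.U (conj z) S.l - 1) * (S.J + S.K))) *ᵥ v := by
  obtain ⟨h1, h2, h3⟩ := Γ_smul_solution hdef (-rt⁻¹) (conj z) ((S.J + S.K) *ᵥ v)
  rw [neg_mul, rt_inv_mul_rt_inv] at h2 h3
  have e0 : (S.J - (1 / 2 : ℂ) • ((S.U (conj z) S.l + 1) * (S.J + S.K))) *ᵥ v =
      -(1 / 2 : ℂ) • ((S.U (conj z) S.l + 1) *ᵥ ((S.J + S.K) *ᵥ v)) + S.J *ᵥ v := by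
    rw [sub_mulVec, smul_mulVec, mulVec_mulVec, neg_smul, neg_add_eq_sub]
  have e1 : (1 - (1 / 2 : ℂ) • (S.J * (S.U (conj z) S.l - 1) * (S.J + S.K))) *ᵥ v =
      -(1 / 2 : ℂ) • ((S.J * (S.U (conj z) S.l - 1)) *ᵥ ((S.J + S.K) *ᵥ v)) + v := by
    rw [sub_mulVec, smul_mulVec, mulVec_mulVec, neg_smul, neg_add_eq_sub, one_mulVec]
  rw [e0, e1, ← h2, ← h3]
  refine Γhat_eq hdef (b := (_, _)) fun h hh => ?_
  have hP : h.1 ∈ Plus S.gauge.A := mem_Plus_Amin hh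
  have h4 := green_Γ hdef h1 hh
  rw [inner_smul_right] at h4
  rw [GaugeData.QhatDual, Qdual_eq hdef hdelta, pair_add, pair_smul, pair_embed _ hP,
    pair_L hdef hdelta v hh, rt_mul_star_rep_dotProduct, dotProduct_add, dotProduct_add]
  linear_combination h4

/-- The double adjoint cancels, leaving the boundary values of `𝒫̂` and `-𝒬̂`. The constants are
absorbed by `(U + 1) J - 2 J = (U - 1) J` in the upper left block and by `J² = -1` in the lower left
one. -/
theorem WhatLeft_eq (hdef : S.Definite) (hdelta : S.DeltaWellDefined) (z : ℂ) :
    S.gauge.WhatLeft z = (1 / 2 : ℂ) • Matrix.fromBlocks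
      ((S.U z S.l - 1) * S.J + (S.U z S.l + 1) * S.K) (S.U z S.l + 1)
      (S.J * (S.U z S.l + 1) * S.J + S.J * (S.U z S.l - 1) * S.K) (S.J * (S.U z S.l - 1)) := by
  rw [GaugeData.WhatLeft, GaugeData.What, conjTranspose_conjTranspose,
    matrixOf_eq fun v => (Γhat_QhatDual hdef hdelta (conj z) v).1,
    matrixOf_eq fun v => (Γhat_QhatDual hdef hdelta (conj z) v).2,
    matrixOf_eq fun v => (Γhat_PhatDual hdef hdelta (conj z) v).1,
    matrixOf_eq fun v => (Γhat_PhatDual hdef hdelta (conj z) v).2, Complex.conj_conj,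
    fromBlocks_smul]
  congr 1
  · simp only [add_mul, sub_mul, mul_add, one_mul]
    module
  · simp only [add_mul, sub_mul, mul_add, mul_sub, mul_one, J_mul_J]
    module

theorem a₁₂_eq (hdef : S.Definite) (hdelta : S.DeltaWellDefined) {z : ℂ}
    (hz : z ∈ S.gauge.rhoA₀) : S.gauge.a₁₂ (conj z) = (2 : ℂ) • (S.E z)ᴴ := by
  refine matrixOf_eq fun u => eq_of_star_dotProduct_eq fun v => ?_
  rw [Complex.conj_conj, star_dotProduct_gammaDual hdef hz, gammaField_eq hdef hz,
    pair_L_solution hdef hdelta, ← mulVec_smul, star_mulVec_dotProduct, star_smul, smul_dotProduct,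
    smul_mulVec, dotProduct_smul, smul_eq_mul, smul_eq_mul, ← mul_assoc, ← rt_mul_rt]
  exact congrArg (fun c => rt * c * _) conj_rt

theorem inv_a₁₂ (hdef : S.Definite) (hdelta : S.DeltaWellDefined) {z : ℂ}
    (hz : z ∈ S.gauge.rhoA₀) :
    (S.gauge.a₁₂ (conj z))⁻¹ = (1 / 2 : ℂ) • (S.U z S.l + 1)ᴴ := by
  refine Matrix.inv_eq_left_inv ?_
  rw [a₁₂_eq hdef hdelta hz, smul_mul_smul_comm, ← conjTranspose_mul, E_mul_add_one hdef hz,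
    conjTranspose_one, div_mul_cancel₀ _ two_ne_zero, one_smul]

theorem a₂₁_eq (hdef : S.Definite) (hdelta : S.DeltaWellDefined) {z : ℂ}
    (hz : z ∈ S.gauge.rhoA₀) : S.gauge.a₂₁ z = (2 : ℂ) • S.E z := by
  refine matrixOf_eq fun u => (Ldual_eq hdef hdelta (gammaField_mem hdef hz u)).trans ?_
  rw [gammaField_eq hdef hz, rep_solution hdef _ _ zero_mem_Icc, U_zero, one_mulVec, smul_smul,
    rt_mul_rt, smul_mulVec]

theorem a₂₂_eq (hdef : S.Definite) (hdelta : S.DeltaWellDefined) {z : ℂ}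
    (hz : z ∈ S.gauge.rhoA₀) : S.gauge.a₂₂ z = S.J + S.K - 2 • S.E z * S.J :=
  matrixOf_eq fun u => Ldual_regExt_L hdef hdelta hz u

/-- The symmetry `M(conj z)^* = M(z)`, rewritten for `E` through `J M = 2 E - 1`. -/
theorem E_conj_conjTranspose (hdef : S.Definite) {z : ℂ} (hz : z ∈ S.gauge.rhoA₀) :
    (S.E (conj z))ᴴ = 1 + S.J * S.E z * S.J := by
  have hz' := conj_mem_rhoA₀ hdef hz
  have h1 := congrArg conjTranspose (J_mul_weyl hdef hz')
  rw [conjTranspose_mul, weyl_conj hdef hz, conjTranspose_sub, conjTranspose_one,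
    conjTranspose_nsmul, S.J_adjoint] at h1
  have h2 : S.J * (S.J * S.gauge.weyl z) * S.J = S.J * (2 • S.E z - 1) * S.J := by
    rw [J_mul_weyl hdef hz]
  rw [← mul_assoc, J_mul_J, neg_mul, one_mul, neg_mul, ← mul_neg, h1, mul_sub, sub_mul, mul_one,
    J_mul_J, mul_smul_comm, smul_mul_assoc] at h2
  have h3 : (2 : ℂ) • (S.E (conj z))ᴴ = (2 : ℂ) • (1 + S.J * S.E z * S.J) := by
    rw [ofNat_smul_eq_nsmul, eq_add_of_sub_eq h2]
    module
  exact smul_right_injective _ (two_ne_zero' ℂ) h3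

/-- With `E = E(z)`, the adjoint entries are `½ (U + 1)` for `a₁₂⁻¹`, `J + K - 2 E J` for `a₂₂` and
`2 (1 + J E J)` for `a₂₁`. Multiplication by `U + 1` removes every `E` except in the lower left
block, where `M (U + 1)(J + K - 2 E J)` leaves `4 (1 + J E J)`; half of it is cancelled by the term
from `a₂₁`. -/
theorem Wleft_eq (hdef : S.Definite) (hdelta : S.DeltaWellDefined) {z : ℂ}
    (hz : z ∈ S.gauge.rhoA₀) : S.gauge.Wleft z = S.gauge.WhatLeft z := by
  have hz' := conj_mem_rhoA₀ hdef hz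
  have hhalf : star (1 / 2 : ℂ) = 1 / 2 := by simp
  have htwo : star (2 : ℂ) = 2 := by simp
  have hE := E_mul_add_one hdef hz
  have hE' := add_one_mul_E hdef hz
  have hM : S.gauge.weyl z = S.J - (2 : ℂ) • (S.J * S.E z) := by
    have := congrArg (S.J * ·) (J_mul_weyl hdef hz)
    simp only [← mul_assoc, J_mul_J, mul_sub, mul_one, neg_mul, one_mul, mul_smul_comm] at this
    rw [neg_eq_iff_eq_neg, neg_sub] at this
    rw [this]
    module
  have hM' : S.gauge.weyl z * (S.U z S.l + 1) = S.J * (S.U z S.l - 1) := by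
    rw [weyl_eq hdef hz, mul_assoc, hE, mul_one]
  have h22 : (S.gauge.a₂₂ (conj z))ᴴ = S.J + S.K - (2 : ℂ) • (S.E z * S.J) := by
    rw [a₂₂_eq hdef hdelta hz', conjTranspose_sub, conjTranspose_add, conjTranspose_mul,
      conjTranspose_nsmul, E_conj_conjTranspose hdef hz, K_conjTranspose, S.J_adjoint,
      mul_smul_comm, neg_mul, mul_add, mul_one, ← mul_assoc, ← mul_assoc, J_mul_J, neg_mul, one_mul,
      neg_mul]
    module
  have h11 : (S.U z S.l + 1) * (S.J + S.K - (2 : ℂ) • (S.E z * S.J)) =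
      (S.U z S.l - 1) * S.J + (S.U z S.l + 1) * S.K := by
    rw [mul_sub, mul_smul_comm, ← mul_assoc, hE', one_mul, mul_add, add_mul, sub_mul, one_mul]
    module
  have h21 : S.gauge.weyl z * ((S.U z S.l - 1) * S.J + (S.U z S.l + 1) * S.K) =
      S.J * (S.U z S.l + 1) * S.J + S.J * (S.U z S.l - 1) * S.K + (4 : ℂ) • (1 + S.J * S.E z * S.J) := by
    have e : (S.U z S.l - 1) * S.J = (S.U z S.l + 1) * S.J - (2 : ℂ) • S.J := by
      rw [sub_mul, add_mul, one_mul]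
      module
    rw [e, mul_add, mul_sub, ← mul_assoc, ← mul_assoc, hM', mul_smul_comm, hM, sub_mul, J_mul_J,
      mul_sub, mul_add, sub_mul, add_mul, mul_one, J_mul_J, smul_mul_assoc]
    module
  rw [WhatLeft_eq hdef hdelta, GaugeData.Wleft, GaugeData.W, fromBlocks_conjTranspose,
    conjTranspose_sub, conjTranspose_mul, conjTranspose_mul, conjTranspose_mul, conjTranspose_mul, h22,
    a₂₁_eq hdef hdelta hz', inv_a₁₂ hdef hdelta hz, GaugeData.a₁₁, weyl_conj hdef hz,
    conjTranspose_smul, conjTranspose_smul, conjTranspose_conjTranspose, hhalf, htwo,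
    E_conj_conjTranspose hdef hz, fromBlocks_smul, smul_mul_assoc, h11,
    mul_smul_comm, mul_smul_comm, h21, hM']
  congr 1
  module

end CanonicalSystem

end LResolvent

end

/-! ### The main theorem. -/

open LResolvent in
theorem proposition5p4 {p : ℕ} (S : CanonicalSystem p) (hdef : S.Definite)
    (hdelta : S.DeltaWellDefined) :
    -- the objects of the statement are well defined
    ((∀ z, S.IsFundamental z (S.U z)) ∧ S.IsDelta S.delta ∧ Function.Injective S.gauge.L ∧
      S.gauge.rhoL = Set.univ ∧ ∀ z, ∃! Q, S.gauge.IsQ z Q) ∧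
    -- (i)
    (∀ z : ℂ,
      IsDualAdjoint (S.gauge.P z)
        (fun v => ((1 / Real.sqrt 2 : ℝ) : ℂ) • S.solution (conj z) v) ∧
      IsHilbertAdjoint (S.gauge.Q z)
        (fun v => -((1 / Real.sqrt 2 : ℝ) : ℂ) • S.solution (conj z) ((S.J + S.K) *ᵥ v))) ∧
    -- (ii)
    (∀ z : ℂ,
      S.gauge.WhatLeft z = (1 / 2 : ℂ) • Matrix.fromBlocks
        ((S.U z S.l - 1) * S.J + (S.U z S.l + 1) * S.K) (S.U z S.l + 1)
        (S.J * (S.U z S.l + 1) * S.J + S.J * (S.U z S.l - 1) * S.K) (S.J * (S.U z S.l - 1))) ∧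
    (∀ z ∈ S.gauge.rhoA₀, S.gauge.Wleft z = S.gauge.WhatLeft z) := by
  exact ⟨⟨S.isFundamental_U, CanonicalSystem.isDelta_delta hdef hdelta,
    CanonicalSystem.L_injective hdef hdelta, CanonicalSystem.rhoL_eq hdef hdelta,
    CanonicalSystem.existsUnique_isQ hdef hdelta⟩,
    fun z => by
      rw [CanonicalSystem.one_div_sqrt_two]
      exact ⟨CanonicalSystem.isDualAdjoint_P hdef hdelta z,
        CanonicalSystem.isHilbertAdjoint_Q hdef hdelta z⟩,
    CanonicalSystem.WhatLeft_eq hdef hdelta,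
    fun _ hz => CanonicalSystem.Wleft_eq hdef hdelta hz⟩
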